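/- Let $p$ be a prime and $G$ a finite $p$-group of order $n$. Let $N/\mathbb{Q}_p$ be a finite Galois extension containing all $n$-th roots of unity, and let $\mathbb{Q}_p\subseteq K\subseteq M\subseteq N$ with $M/K$ Galois. Write $O_K, O_M, O_N$ for the valuation rings, $\pi_M O_M$ for the maximal ideal of $O_M$, and let $p^q$ be the order of the residue field of $K$. Fix a Frobenius lift $F\in \mathrm{Gal}(M/K)$, that is, $F(z)\equiv z^{p^q} \pmod{\pi_M O_M}$ for all $z\in O_M$, and extend $F$ to $O_M[G]$ by acting on coefficients. Let $R(G)=K_0(N[G])$, let $\psi^m$ be the $m$-th Adams operation on $R(G)$ (on characters, $\chi_{\psi^m T}(g)=\chi_T(g^m)$), and let $$\mathrm{Det}: O_M[G]^*\to \mathrm{Hom}_{\mathrm{Gal}(N/M)}(R(G),O_N^*),\qquad \mathrm{Det}\Big(\sum_\gamma \lambda_\gamma\gamma\Big)(T)=\det\Big(\sum_\gamma \lambda_\gamma T(\gamma)\Big).$$ For $z\in O_M[G]^*$ and $T\in R(G)$ put $$\mathrm{Log}_F(z)(T)=\log\left(\frac{\mathrm{Det}(F(z))(\psi^{p^q}(T))}{(\mathrm{Det}(z)(T))^{p^q}}\right)\in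 N,\qquad \log(1+x)=\sum_{k\ge 1}(-1)^{k-1}\frac{x^k}{k}.$$ Let $M\{G\}$ be the $M$-vector space with basis the conjugacy classes of $G$, let $$\psi: M\{G\}\to \mathrm{Hom}_{\mathrm{Gal}(N/M)}(R(G),N),\qquad \psi\Big(\sum_\gamma m_\gamma \gamma\Big)(T)=\sum_\gamma m_\gamma\,\mathrm{Trace}(T(\gamma)),$$ and let $\alpha_G=\psi^{-1}\circ \mathrm{Log}_F: O_M[G]^*\to M\{G\}$. Let $A_M(G)=\ker\big(O_M[G]\to O_M[G^{ab}]\big)$. Then $1+A_M(G)\subseteq O_M[G]^*$; for every $u\in O_M[G]^*$ there is exactly one element $\alpha_G(u)\in M\{G\}$ with $\psi(\alpha_G(u))=\mathrm{Log}_F(u)$; and there is a well-defined injective homomorphism $$\hat\alpha_G: \mathrm{Det}(1+A_M(G))\to M\{G\},\qquad \hat\alpha_G(\mathrm{Det}(u))=\alpha_G(u)\quad (u\in 1+A_M(G)),$$ from a multiplicative group to an additive group. -/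

import Mathlib

noncomputable section

namespace DetDescent

section ValuationRing

/-- The valuation ring `O_L` of a field `L`, for an embedding of `L` in the nonarchimedean normed
field `N`: the elements of absolute value at most one. `O_N` itself is `valRing N N`. -/
def valRing (L N : Type*) [Field L] [NormedField N] [IsUltrametricDist N] [Algebra L N] :
    ValuationSubring L :=
  ((NormedField.valuation (K := N)).comap (algebraMap L N)).valuationSubring

lemma mem_valRing {L N : Type*} [Field L] [NormedField N] [IsUltrametricDist N] [Algebra L N]
    (x : L) : x ∈ valRing L N ↔ ‖algebraMap L N x‖ ≤ 1 := by
  simp only [valRing, Valuation.mem_valuationSubring_iff, Valuation.comap_apply,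
    NormedField.valuation_apply]
  rfl

/-- The inclusion `O_L ⊆ L ⊆ N`. -/
def valRingToN (L N : Type*) [Field L] [NormedField N] [IsUltrametricDist N] [Algebra L N] :
    valRing L N →+* N :=
  (algebraMap L N).comp (valRing L N).subtype

lemma norm_valRingToN_le {L N : Type*} [Field L] [NormedField N] [IsUltrametricDist N]
    [Algebra L N] (x : valRing L N) : ‖valRingToN L N x‖ ≤ 1 :=
  (mem_valRing x.1).1 x.2

/-- Automorphisms of `M` over `K` preserve the absolute value. -/
lemma norm_algebraMap_aut (p : ℕ) [Fact p.Prime] {K M N : Type*} [Field K] [Field M]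
    [NormedField N] [NormedAlgebra ℚ_[p] N] [FiniteDimensional ℚ_[p] N]
    [Algebra ℚ_[p] K] [Algebra ℚ_[p] M] [Algebra K M] [Algebra M N]
    [IsScalarTower ℚ_[p] K M] [IsScalarTower ℚ_[p] M N]
    (F : M ≃ₐ[K] M) (x : M) : ‖algebraMap M N (F x)‖ = ‖algebraMap M N x‖ := by
  rw [NormedAlgebra.norm_eq_spectralNorm ℚ_[p], NormedAlgebra.norm_eq_spectralNorm ℚ_[p],
    ← spectralNorm.eq_of_tower (K := ℚ_[p]) (L := N) (F x),
    ← spectralNorm.eq_of_tower (K := ℚ_[p]) (L := N) x]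
  exact (spectralNorm_eq_of_equiv (F.restrictScalars ℚ_[p]) x).symm

/-- The restriction to `O_M` of an automorphism of `M` over `K`. -/
def galValRing (p : ℕ) [Fact p.Prime] {K M : Type*} (N : Type*) [Field K] [Field M]
    [NormedField N] [IsUltrametricDist N] [NormedAlgebra ℚ_[p] N] [FiniteDimensional ℚ_[p] N]
    [Algebra ℚ_[p] K] [Algebra ℚ_[p] M] [Algebra K M] [Algebra M N]
    [IsScalarTower ℚ_[p] K M] [IsScalarTower ℚ_[p] M N]
    (F : M ≃ₐ[K] M) : valRing M N →+* valRing M N :=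
  ((F : M →+* M).comp (valRing M N).subtype).codRestrict (valRing M N) fun x => by
    rw [mem_valRing]
    exact (norm_algebraMap_aut p F x.1).trans_le (norm_valRingToN_le x)

end ValuationRing

section RepresentationRing

/-- A representation `T : G → GL_u(N)`. -/
structure MatRep (G N : Type*) [Group G] [Field N] where
  dim : ℕ
  rho : G →* Matrix.GeneralLinearGroup (Fin dim) N

variable {G N : Type*} [Group G] [Field N]

/-- `S` is isomorphic to the direct sum `T ⊕ T'`; the matrix `P`, with inverse `Q`, is an
intertwining isomorphism. -/
def IsDirectSum (S T T' : MatRep G N) : Prop :=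
  ∃ (P : Matrix (Fin S.dim) (Fin T.dim ⊕ Fin T'.dim) N)
    (Q : Matrix (Fin T.dim ⊕ Fin T'.dim) (Fin S.dim) N),
    P * Q = 1 ∧ Q * P = 1 ∧
    ∀ g : G, (S.rho g).1 * P = P * Matrix.fromBlocks (T.rho g).1 0 0 (T'.rho g).1

/-- The relations `[S] = [T] + [T']` for `S ≅ T ⊕ T'`. Taking `T'` zero-dimensional, they
identify isomorphic representations. -/
def repRelations (G N : Type*) [Group G] [Field N] : AddSubgroup (FreeAbelianGroup (MatRep G N)) :=
  AddSubgroup.closure {x | ∃ S T T' : MatRep G N, IsDirectSum S T T' ∧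
    x = FreeAbelianGroup.of S - (FreeAbelianGroup.of T + FreeAbelianGroup.of T')}

/-- The representation ring `R_N(G) = K_0(N[G])` (its additive group): the Grothendieck group of
finite-dimensional representations of `G` over `N`. -/
abbrev RepRing (G N : Type*) [Group G] [Field N] : Type _ :=
  FreeAbelianGroup (MatRep G N) ⧸ repRelations G N

/-- The class of a representation in the representation ring. -/
def repClass (T : MatRep G N) : RepRing G N :=
  QuotientAddGroup.mk (FreeAbelianGroup.of T)

/-- Additive functions of representations extend to the representation ring. -/
def repLift {A : Type*} [AddCommGroup A] (f : MatRep G N → A)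
    (hf : ∀ S T T' : MatRep G N, IsDirectSum S T T' → f S = f T + f T') : RepRing G N →+ A :=
  QuotientAddGroup.lift (repRelations G N) (FreeAbelianGroup.lift f) <| by
    rw [repRelations, AddSubgroup.closure_le]
    rintro x ⟨S, T, T', h, rfl⟩
    simp [hf S T T' h]

@[simp] lemma repLift_repClass {A : Type*} [AddCommGroup A] (f : MatRep G N → A)
    (hf : ∀ S T T' : MatRep G N, IsDirectSum S T T' → f S = f T + f T') (T : MatRep G N) :
    repLift f hf (repClass T) = f T := by
  simp [repLift, repClass]

lemma repRing_induction {motive : RepRing G N → Prop}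
    (of : ∀ T, motive (repClass T)) (add : ∀ x y, motive x → motive y → motive (x + y))
    (zero : motive 0) (neg : ∀ x, motive x → motive (-x)) (x : RepRing G N) : motive x := by
  induction x using QuotientAddGroup.induction_on with
  | H z =>
    induction z using FreeAbelianGroup.induction_on with
    | zero => exact zero
    | of T => exact of T
    | neg T _ => exact neg _ (of T)
    | add a b ha hb => exact add _ _ ha hb

/-- The conjugate of a representation by a field automorphism, applied to the matrix entries. -/
def MatRep.conj (σ : N →+* N) (T : MatRep G N) : MatRep G N where
  dim := T.dim
  rho := (Matrix.GeneralLinearGroup.map σ).comp T.rho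

lemma conj_isDirectSum (σ : N →+* N) {S T T' : MatRep G N} (h : IsDirectSum S T T') :
    IsDirectSum (S.conj σ) (T.conj σ) (T'.conj σ) := by
  obtain ⟨P, Q, h1, h2, h3⟩ := h
  refine ⟨P.map σ, Q.map σ, ?_, ?_, fun g => ?_⟩
  · have := congrArg (fun A => A.map σ) h1
    simp only [Matrix.map_mul, Matrix.map_one _ (map_zero σ) (map_one σ)] at this
    exact this
  · have := congrArg (fun A => A.map σ) h2
    simp only [Matrix.map_mul, Matrix.map_one _ (map_zero σ) (map_one σ)] at this
    exact this
  · have := congrArg (fun A => A.map σ) (h3 g)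
    simp only [Matrix.map_mul, Matrix.fromBlocks_map, Matrix.map_zero _ (map_zero σ)] at this
    exact this

/-- The action of a field automorphism on the representation ring. -/
def repConj (σ : N →+* N) : RepRing G N →+ RepRing G N :=
  repLift (fun T => repClass (T.conj σ)) fun S T T' h => by
    rw [← sub_eq_zero]
    exact (QuotientAddGroup.eq_zero_iff _).2
      (AddSubgroup.subset_closure ⟨_, _, _, conj_isDirectSum σ h, rfl⟩)

/-- The trace of `T` as a function of conjugacy classes. -/
def traceFun (T : MatRep G N) : ConjClasses G → N :=
  Quotient.lift (fun g => Matrix.trace (T.rho g).1) fun a b h => by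
    obtain ⟨c, hc⟩ := isConj_iff.1 h
    simp only [← hc, map_mul, map_inv]
    exact (Matrix.trace_units_conj (T.rho c) (T.rho a).1).symm

/-- The character of an element of the representation ring, a function of conjugacy classes. -/
def character : RepRing G N →+ (ConjClasses G → N) :=
  repLift traceFun fun S T T' ⟨P, Q, h1, h2, h3⟩ => by
    funext c
    induction c using Quotient.inductionOn with
    | h g =>
      have e : (S.rho g).1 = P * Matrix.fromBlocks (T.rho g).1 0 0 (T'.rho g).1 * Q := by
        rw [← h3 g, Matrix.mul_assoc, h1, Matrix.mul_one]
      change Matrix.trace (S.rho g).1 = Matrix.trace (T.rho g).1 + Matrix.trace (T'.rho g).1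
      rw [e, Matrix.trace_mul_comm, ← Matrix.mul_assoc, h2, Matrix.one_mul]
      simp [Matrix.trace]

/-- The `m`-th Adams operation: `ψ^m(x)` is the element of the representation ring whose character
is `g ↦ χ_x(g^m)`. (In characteristic zero, such an element exists and is unique.) -/
def adams (m : ℕ) (x : RepRing G N) : RepRing G N :=
  Classical.epsilon fun y : RepRing G N =>
    ∀ g : G, character y (ConjClasses.mk g) = character x (ConjClasses.mk (g ^ m))

lemma character_repConj (σ : N →+* N) (x : RepRing G N) (c : ConjClasses G) :
    character (repConj σ x) c = σ (character x c) := by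
  induction x using repRing_induction with
  | of T =>
    induction c using Quotient.inductionOn with
    | h g =>
      simp only [character, repConj, repLift_repClass]
      change Matrix.trace ((T.rho g).1.map σ) = σ (Matrix.trace (T.rho g).1)
      exact (AddMonoidHom.map_trace (σ : N →+ N) _).symm
  | add x y hx hy => simp [hx, hy]
  | zero => simp
  | neg x hx => simp [hx]

end RepresentationRing

section EquivariantFunctions

variable (G M N : Type*) [Group G] [Field M]

/-- `Hom_{Gal(N/M)}(R(G), N)`, an `M`-vector space. -/
def HomGal [Field N] [Algebra M N] : Submodule M (RepRing G N →+ N) where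
  carrier := {f | ∀ (σ : N ≃ₐ[M] N) (x : RepRing G N), f (repConj (σ : N →+* N) x) = σ (f x)}
  add_mem' hf hg σ x := by
    simp [hf σ x, hg σ x]
  zero_mem' σ x := by simp
  smul_mem' c f hf σ x := by
    simp [hf σ x]

/-- `Hom_{Gal(N/M)}(R(G), O_N^*)`, with the group law of pointwise multiplication. -/
def HomGalUnits [NormedField N] [IsUltrametricDist N] [Algebra M N] :
    Subgroup (Multiplicative (RepRing G N) →* (valRing N N)ˣ) where
  carrier := {f | ∀ (σ : N ≃ₐ[M] N) (x : RepRing G N),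
    ((f (Multiplicative.ofAdd (repConj (σ : N →+* N) x)) : valRing N N) : N) =
      σ ((f (Multiplicative.ofAdd x) : valRing N N) : N)}
  mul_mem' hf hg σ x := by
    simp [hf σ x, hg σ x]
  one_mem' σ x := by simp
  inv_mem' {f} hf σ x := by
    have h (u : (valRing N N)ˣ) : ((u⁻¹ : (valRing N N)ˣ) : valRing N N).1 = (u.1.1)⁻¹ := by
      apply eq_inv_of_mul_eq_one_left
      exact congrArg Subtype.val u.inv_mul
    simp only [MonoidHom.inv_apply, h, map_inv₀]
    exact congrArg _ (hf σ x)

variable {G N}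

/-- The evaluation of characters at a conjugacy class, as an element of
`Hom_{Gal(N/M)}(R(G), N)`. -/
def evalClass [Field N] [Algebra M N] (c : ConjClasses G) : HomGal G M N :=
  ⟨(Pi.evalAddMonoidHom (fun _ : ConjClasses G => N) c).comp character,
    fun σ x => character_repConj (σ : N →+* N) x c⟩

variable (G N)

/-- The map `ψ : M{G} → Hom_{Gal(N/M)}(R(G), N)`, `ψ(∑ m_γ γ)(T) = ∑ m_γ Trace(T(γ))`, where `M{G}`
is the `M`-vector space with basis the conjugacy classes of `G`. -/
def psi [Field N] [Algebra M N] : (ConjClasses G →₀ M) →ₗ[M] HomGal G M N :=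
  Finsupp.linearCombination M (evalClass M)

end EquivariantFunctions

section Determinant

variable {G M N : Type*} [Group G]

/-- The extension of `T` to a ring homomorphism `R[G] → Mat_u(N)`,
`∑ λ_γ γ ↦ ∑ λ_γ T(γ)`, where the coefficients are mapped to `N` by `f`. -/
def evalRep {R : Type*} [CommRing R] [Field N] (f : R →+* N) {n : ℕ}
    (T : G →* Matrix.GeneralLinearGroup (Fin n) N) :
    MonoidAlgebra R G →+* Matrix (Fin n) (Fin n) N :=
  MonoidAlgebra.liftNCRingHom ((Matrix.scalar (Fin n)).comp f)
    ((Units.coeHom _).comp T) fun _ _ => Matrix.scalar_commute _ (fun _ => Commute.all _ _) _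

lemma evalRep_single {R : Type*} [CommRing R] [Field N] (f : R →+* N) {n : ℕ}
    (T : G →* Matrix.GeneralLinearGroup (Fin n) N) (g : G) (r : R) :
    evalRep f T (MonoidAlgebra.single g r) = f r • (T g).1 := by
  simp [evalRep, Matrix.smul_eq_diagonal_mul]

lemma evalRep_map {R : Type*} [CommRing R] [Field N] (f : R →+* N) {n : ℕ}
    (T : G →* Matrix.GeneralLinearGroup (Fin n) N)
    (σ : N →+* N) (hσ : ∀ r, σ (f r) = f r) (u : MonoidAlgebra R G) :
    evalRep f ((Matrix.GeneralLinearGroup.map σ).comp T) u = (evalRep f T u).map σ := by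
  induction u using MonoidAlgebra.induction_linear with
  | zero => ext i j; simp
  | add a b ha hb => rw [map_add, map_add, ha, hb]; ext i j; simp
  | single g r =>
    rw [evalRep_single, evalRep_single]
    ext i j
    simp [hσ]

lemma det_evalRep_directSum {R : Type*} [CommRing R] [Field N] (f : R →+* N)
    {S T T' : MatRep G N} (h : IsDirectSum S T T') (u : MonoidAlgebra R G) :
    (evalRep f S.rho u).det = (evalRep f T.rho u).det * (evalRep f T'.rho u).det := by
  obtain ⟨P, Q, h1, h2, h3⟩ := h
  have key : evalRep f S.rho u * P =
      P * Matrix.fromBlocks (evalRep f T.rho u) 0 0 (evalRep f T'.rho u) := by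
    induction u using MonoidAlgebra.induction_linear with
    | zero => simp
    | add a b ha hb =>
      have : Matrix.fromBlocks (evalRep f T.rho (a + b)) 0 0 (evalRep f T'.rho (a + b)) =
          Matrix.fromBlocks (evalRep f T.rho a) 0 0 (evalRep f T'.rho a) +
          Matrix.fromBlocks (evalRep f T.rho b) 0 0 (evalRep f T'.rho b) := by
        simp [Matrix.fromBlocks_add]
      rw [this, map_add, Matrix.add_mul, ha, hb, Matrix.mul_add]
    | single g r =>
      have : Matrix.fromBlocks (evalRep f T.rho (.single g r)) 0 0 (evalRep f T'.rho (.single g r)) =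
          f r • Matrix.fromBlocks (T.rho g).1 0 0 (T'.rho g).1 := by
        simp [evalRep_single, Matrix.fromBlocks_smul]
      rw [this, evalRep_single, Matrix.smul_mul, h3, Matrix.mul_smul]
  have e : evalRep f S.rho u = P * (Matrix.fromBlocks (evalRep f T.rho u) 0 0 (evalRep f T'.rho u) * Q) := by
    rw [← Matrix.mul_assoc, ← key, Matrix.mul_assoc, h1, Matrix.mul_one]
  rw [e, Matrix.det_comm' h1 h2, Matrix.mul_assoc, h2, Matrix.mul_one,
    Matrix.det_fromBlocks_zero₂₁]

variable [Finite G] [Field M] [NormedField N] [IsUltrametricDist N] [Algebra M N]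

/-- Entries of `T(u)` are bounded uniformly in `u ∈ O_M[G]`. -/
lemma exists_entry_bound (T : MatRep G N) : ∃ C : ℝ, 0 ≤ C ∧
    ∀ (u : MonoidAlgebra (valRing M N) G) (i j : Fin T.dim),
      ‖evalRep (valRingToN M N) T.rho u i j‖ ≤ C := by
  have := Fintype.ofFinite G
  refine ⟨∑ g : G, ∑ i, ∑ j, ‖(T.rho g).1 i j‖, by positivity, fun u i j => ?_⟩
  induction u using MonoidAlgebra.induction_linear with
  | zero => simp; positivity
  | add a b ha hb =>
    rw [map_add, Matrix.add_apply]
    exact (IsUltrametricDist.norm_add_le_max _ _).trans (max_le ha hb)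
  | single g r =>
    rw [evalRep_single, Matrix.smul_apply, smul_eq_mul, norm_mul]
    calc _ ≤ 1 * ‖(T.rho g).1 i j‖ := by
            gcongr; exact norm_valRingToN_le r
      _ = ‖(T.rho g).1 i j‖ := one_mul _
      _ ≤ ∑ j, ‖(T.rho g).1 i j‖ :=
            Finset.single_le_sum (f := fun j => ‖(T.rho g).1 i j‖)
              (fun _ _ => norm_nonneg _) (Finset.mem_univ j)
      _ ≤ ∑ i, ∑ j, ‖(T.rho g).1 i j‖ :=
            Finset.single_le_sum (f := fun i => ∑ j, ‖(T.rho g).1 i j‖)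
              (fun _ _ => Finset.sum_nonneg fun _ _ => norm_nonneg _) (Finset.mem_univ i)
      _ ≤ _ :=
            Finset.single_le_sum (f := fun g => ∑ i, ∑ j, ‖(T.rho g).1 i j‖)
              (fun _ _ => Finset.sum_nonneg fun _ _ =>
                Finset.sum_nonneg fun _ _ => norm_nonneg _) (Finset.mem_univ g)

lemma norm_det_evalRep_le (T : MatRep G N) (u : MonoidAlgebra (valRing M N) G) :
    ‖(evalRep (valRingToN M N) T.rho u).det‖ ≤ 1 := by
  obtain ⟨C, hC0, hC⟩ := exists_entry_bound (M := M) T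
  have hb (k : ℕ) : ‖(evalRep (valRingToN M N) T.rho u).det‖ ^ k ≤ C ^ T.dim := by
    rw [← norm_pow, ← Matrix.det_pow, ← map_pow, Matrix.det_apply]
    refine IsUltrametricDist.norm_sum_le_of_forall_le_of_nonneg (by positivity) fun τ _ => ?_
    have hs : ∀ (s : ℤˣ) (x : N), ‖s • x‖ = ‖x‖ := fun s x => by
      rcases Int.units_eq_one_or s with rfl | rfl <;> simp
    rw [hs, norm_prod]
    calc _ ≤ ∏ _i : Fin T.dim, C :=
          Finset.prod_le_prod (fun _ _ => norm_nonneg _) fun i _ => hC _ _ _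
      _ = _ := by simp
  by_contra! h
  obtain ⟨k, hk⟩ := pow_unbounded_of_one_lt (C ^ T.dim) h
  exact absurd (hb k) (not_le.2 hk)

/-- `det T(u)` as an element of `O_N`, multiplicatively in `u ∈ O_M[G]`. -/
def detRep (T : MatRep G N) : MonoidAlgebra (valRing M N) G →* valRing N N where
  toFun u := ⟨(evalRep (valRingToN M N) T.rho u).det,
    (mem_valRing _).2 (norm_det_evalRep_le T u)⟩
  map_one' := by ext; simp
  map_mul' a b := by ext; simp

/-- The function `T ↦ det T(u)` on the representation ring, for a unit `u` of `O_M[G]`. -/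
def detFun (u : (MonoidAlgebra (valRing M N) G)ˣ) :
    RepRing G N →+ Additive (valRing N N)ˣ :=
  repLift (fun T => Additive.ofMul (Units.map (detRep T) u)) fun S T T' h => by
    apply Additive.toMul.injective
    ext
    exact det_evalRep_directSum (valRingToN M N) h u.1

lemma detFun_mul (u v : (MonoidAlgebra (valRing M N) G)ˣ) :
    detFun (u * v) = detFun u + detFun v := by
  refine DFunLike.ext _ _ fun x => ?_
  induction x using repRing_induction with
  | of T => simp [detFun]
  | add x y hx hy => simp only [map_add, hx, hy]
  | zero => simp
  | neg x hx => simp only [map_neg, hx]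

lemma detFun_conj (u : (MonoidAlgebra (valRing M N) G)ˣ) (σ : N ≃ₐ[M] N) (x : RepRing G N) :
    (((detFun u (repConj (σ : N →+* N) x)).toMul : valRing N N) : N) =
      σ (((detFun u x).toMul : valRing N N) : N) := by
  have h (u : (valRing N N)ˣ) : ((u⁻¹ : (valRing N N)ˣ) : valRing N N).1 = (u.1.1)⁻¹ := by
    apply eq_inv_of_mul_eq_one_left
    exact congrArg Subtype.val u.inv_mul
  induction x using repRing_induction with
  | of T =>
    simp only [detFun, repConj, repLift_repClass]
    change (evalRep (valRingToN M N) (T.conj (σ : N →+* N)).rho u.1).det =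
      σ (evalRep (valRingToN M N) T.rho u.1).det
    refine (congrArg Matrix.det
      (evalRep_map (valRingToN M N) T.rho (σ : N →+* N) (fun r => σ.commutes _) u.1)).trans ?_
    exact ((σ : N →+* N).map_det _).symm
  | add x y hx hy => simp [hx, hy]
  | zero => simp
  | neg x hx => simp only [map_neg, toMul_neg, h, hx, map_inv₀]

variable (G M N)

/-- The determinantal homomorphism `Det : O_M[G]^* → Hom_{Gal(N/M)}(R(G), O_N^*)`,
`Det(∑ λ_γ γ)(T) = det(∑ λ_γ T(γ))`. -/
def Det : (MonoidAlgebra (valRing M N) G)ˣ →* HomGalUnits G M N :=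
  MonoidHom.mk' (fun u => ⟨AddMonoidHom.toMultiplicativeLeft (detFun u), detFun_conj u⟩)
    fun u v => by
    exact Subtype.ext (congrArg AddMonoidHom.toMultiplicativeLeft (detFun_mul u v))

end Determinant

section KernelOfAbelianization

variable (G M N : Type*) [Group G] [Field M] [NormedField N] [IsUltrametricDist N] [Algebra M N]

/-- `A_M(G)`, the kernel of `O_M[G] → O_M[G^ab]`. -/
def kerAb : Ideal (MonoidAlgebra (valRing M N) G) :=
  RingHom.ker (MonoidAlgebra.mapDomainRingHom (valRing M N)
    (Abelianization.of : G →* Abelianization G))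

/-- `1 + A_M(G)`, as a subgroup of `O_M[G]^*`. -/
def oneAddKerAb : Subgroup (MonoidAlgebra (valRing M N) G)ˣ :=
  (Units.map (MonoidAlgebra.mapDomainRingHom (valRing M N)
    (Abelianization.of : G →* Abelianization G)).toMonoidHom).ker

lemma mem_oneAddKerAb (u : (MonoidAlgebra (valRing M N) G)ˣ) :
    u ∈ oneAddKerAb G M N ↔ ∃ a ∈ kerAb G M N, (u : MonoidAlgebra (valRing M N) G) = 1 + a := by
  rw [oneAddKerAb, MonoidHom.mem_ker, Units.ext_iff]
  constructor
  · intro h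
    refine ⟨u - 1, ?_, by simp⟩
    rw [kerAb, RingHom.mem_ker, map_sub, map_one, sub_eq_zero]
    exact h
  · rintro ⟨a, ha, hu⟩
    rw [kerAb, RingHom.mem_ker] at ha
    change MonoidAlgebra.mapDomainRingHom (valRing M N) Abelianization.of u.1 = 1
    rw [hu, map_add, map_one, ha, add_zero]

end KernelOfAbelianization

section Logarithm

/-- The `p`-adic logarithm, `log(1 + x) = ∑_{n ≥ 1} (-1)^(n-1) x^n / n`. -/
def padicLog {N : Type*} [NormedField N] (y : N) : N :=
  ∑' n : ℕ, (-1) ^ n * (y - 1) ^ (n + 1) / (n + 1 : N)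

variable (p : ℕ) [Fact p.Prime] (G : Type*) {K M : Type*} (N : Type*) [Group G] [Finite G]
  [Field K] [Field M] [NormedField N] [IsUltrametricDist N] [NormedAlgebra ℚ_[p] N]
  [FiniteDimensional ℚ_[p] N] [Algebra ℚ_[p] K] [Algebra ℚ_[p] M] [Algebra K M] [Algebra M N]
  [IsScalarTower ℚ_[p] K M] [IsScalarTower ℚ_[p] M N]

/-- The action of `F ∈ Gal(M/K)` on units of `O_M[G]`, through the coefficients. -/
def galUnits (F : M ≃ₐ[K] M) :
    (MonoidAlgebra (valRing M N) G)ˣ →* (MonoidAlgebra (valRing M N) G)ˣ :=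
  Units.map (MonoidAlgebra.mapRingHom G (galValRing p N F)).toMonoidHom

/-- The logarithm
`Log_F(z)(T) = log (Det(F(z))(ψ^(p^q)(T)) / Det(z)(T)^(p^q))`. -/
def LogF (q : ℕ) (F : M ≃ₐ[K] M) (z : (MonoidAlgebra (valRing M N) G)ˣ) (T : RepRing G N) : N :=
  padicLog
    ((((Det G M N (galUnits p G N F z)).1 (Multiplicative.ofAdd (adams (p ^ q) T)) /
      (Det G M N z).1 (Multiplicative.ofAdd T) ^ (p ^ q) : (valRing N N)ˣ) : valRing N N) : N)

/-- The logarithmic map `α_G = ψ⁻¹ ∘ Log_F : O_M[G]^* → M{G}`. -/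
def alphaG (q : ℕ) (F : M ≃ₐ[K] M) (z : (MonoidAlgebra (valRing M N) G)ˣ) : ConjClasses G →₀ M :=
  Function.invFun (fun (a : ConjClasses G →₀ M) (T : RepRing G N) => (psi G M N a).1 T)
    (LogF p G N q F z)

end Logarithm

end DetDescent

end

/-! The argument of the logarithm lies in 1 + (maximal ideal). The augmentation ideal of O_M[G] is
nil modulo p, so Det(z)(T) is congruent to the (dim T)-th power of the augmentation of z
(`norm_det_evalRep_sub_lt`); Adams operations preserve dimension and F reduces to the p^q-th power
map (`norm_logArg_sub_one_lt`). The same nilpotence makes 1 + A_M(G) consist of units. Consequently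
Log_F(u) is additive and Galois equivariant on R(G) and depends only on characters. Since characters
pair integrally and nondegenerately, such a function is an N-linear combination of evaluations at
conjugacy classes (`exists_eq_sum_character`); the coefficients are unique because characters span
the class functions (`span_range_character`), and equivariance then puts them in M
(`exists_psi_eq`).

That α_G(u) depends only on Det(u) comes from extending F to an automorphism σ of N: Det(F(u))(T) =
σ(Det(u)(σ⁻¹T)) (`detValue_galUnits`).

For injectivity, log vanishes only at roots of unity of p-power order. If Log_F(u) = 0, then up to
such roots Det(F(u))(ψ^(p^q) T) equals Det(u)(T)^(p^q). Iterating until the Adams operation makes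
the character constant, the left side becomes a power of an augmentation, which is 1 for u in 1 +
A_M(G). So Det(u) has torsion values (`exists_detValue_pow_eq_one`), and it remains to see that
Det(1 + A_M(G)) is torsion free (`detValue_eq_one_of_torsion`).

This is proved by induction on |G| and on the degree of T, for square matrices over the group ring
whose determinant over the group ring of G^ab is 1; matrices are needed because restriction to a
subgroup turns an element into a matrix. If T splits, use smaller degree; if its matrices commute,
its determinant is controlled by G^ab. Otherwise T is induced from a normal subgroup H of index p,
and det T(v) is a determinant attached to the restriction of v to H. To continue, the determinant Δ
of this restriction over the group ring of H^ab must be 1. By Higman's theorem Δ is a group element,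
having augmentation 1 and torsion character values. Modulo p, a fixed-point count identifies the
coefficient of 1 in Δ with that in the transfer of the determinant over G^ab, which is 1
(`coeff_one_det_induced`). Hence Δ = 1. -/

noncomputable section

/-! ### Determinants from traces of powers; idempotent matrices -/

namespace Matrix

open PowerSeries in
/-- **Jacobi's formula** for an invertible matrix over a commutative ring with a derivation. -/
theorem derivation_det {A S n : Type*} [CommRing A] [CommRing S] [Algebra A S] [Fintype n]
    [DecidableEq n] (d : Derivation A S S) (M G : Matrix n n S) (h : M * G = 1) :
    d M.det = M.det * (G * M.map d).trace := by
  -- A derivation is the same as the ring homomorphism a ↦ a + ε d(a) to the dual numbers; the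
  -- formula is then the ε-part of det(M(1 + εQ)) = det M · (1 + ε tr Q).
  let φ : S →+* DualNumber S :=
    { toFun := fun f => TrivSqZeroExt.inl f + TrivSqZeroExt.inr (d f)
      map_one' := by ext <;> simp
      map_zero' := by ext <;> simp
      map_add' := fun a b => by ext <;> simp
      map_mul' := fun a b => by ext <;> simp [mul_comm] }
  let ι : S →+* DualNumber S := TrivSqZeroExt.inlHom S S
  obtain ⟨Q, hQ⟩ : ∃ Q, Q = G * M.map d := ⟨_, rfl⟩
  have e : M.map d = M * Q := by rw [hQ, ← Matrix.mul_assoc, h, Matrix.one_mul]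
  rw [← hQ]
  have hφ : φ.mapMatrix M =
      ι.mapMatrix M * (1 + (DualNumber.eps : DualNumber S) • ι.mapMatrix Q) := by
    rw [Matrix.mul_add, Matrix.mul_one, Matrix.mul_smul, ← map_mul, ← e]
    ext i j <;> simp [φ, ι, -DualNumber.inr_eq_smul_eps]
  have := congrArg Matrix.det hφ
  rw [Matrix.det_mul, Matrix.det_one_add_smul, ← RingHom.map_det, ← RingHom.map_det] at this
  have h2 := congrArg TrivSqZeroExt.snd this
  have h3 : (ι.mapMatrix Q).trace = ι Q.trace :=
    (AddMonoidHom.map_trace ι _).symm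
  rw [h3] at h2
  rw [pow_two, DualNumber.eps_mul_eps, mul_zero, add_zero] at h2
  simpa [φ, ι, -DualNumber.inr_eq_smul_eps] using h2

open PowerSeries in
/-- The logarithmic derivative of `det (1 - t A)` is `-∑ tr (A ^ (k + 1)) t ^ k`. -/
theorem derivative_charpolyRev_eq {K l : Type*} [Field K] [Fintype l] [DecidableEq l]
    (A : Matrix l l K) :
    PowerSeries.derivative K (A.charpolyRev : K⟦X⟧) =
      (A.charpolyRev : K⟦X⟧) * PowerSeries.mk fun k => -(A ^ (k + 1)).trace := by
  let M : Matrix l l K⟦X⟧ := 1 - (PowerSeries.X : K⟦X⟧) • A.map (PowerSeries.C (R := K))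
  -- The geometric series ∑ t^k A^k, inverse to 1 - tA.
  let G : Matrix l l K⟦X⟧ := Matrix.of fun i j => PowerSeries.mk fun k => (A ^ k) i j
  have hdet : (A.charpolyRev : K⟦X⟧) = M.det := by
    rw [Matrix.charpolyRev, ← Polynomial.coeToPowerSeries.ringHom_apply, RingHom.map_det]
    congr 1
    ext1 i j
    simp only [RingHom.mapMatrix_apply, Matrix.map_apply, Matrix.sub_apply, Matrix.smul_apply,
      map_sub, smul_eq_mul, map_mul, M]
    congr 1
    · by_cases hij : i = j <;> simp [Matrix.one_apply, hij]
    · simp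
  have hG : M * G = 1 := by
    have hAG : (A.map (PowerSeries.C (R := K)) * G) =
        Matrix.of fun i j => PowerSeries.mk fun k => (A ^ (k + 1)) i j := by
      ext i j k
      simp [Matrix.mul_apply, G, pow_succ']
    rw [Matrix.sub_mul, Matrix.one_mul, Matrix.smul_mul, hAG]
    ext i j k
    rcases k with _ | k
    · by_cases hij : i = j <;> simp [G, Matrix.one_apply, hij]
    · by_cases hij : i = j <;>
        simp [G, Matrix.one_apply, hij, PowerSeries.coeff_succ_X_mul, PowerSeries.coeff_one]
  have hM : M.map (PowerSeries.derivative K) = -(A.map (PowerSeries.C (R := K))) := by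
    ext1 i j
    by_cases hij : i = j
    · subst hij
      simp [M, Derivation.leibniz]
    · simp [M, hij, Derivation.leibniz]
  rw [hdet, derivation_det _ M G hG, hM]
  congr 1
  ext k
  simp [Matrix.trace, Matrix.mul_apply, G, pow_succ]

-- Newton's identities: the logarithmic derivative determines (k + 1) times the coefficient of
-- degree k + 1 from the lower ones, and the constant term is 1. The zeroth power does not enter, so
-- the two matrices may have different sizes.
open PowerSeries in
theorem charpolyRev_eq_of_trace_pow {K m n : Type*} [Field K] [CharZero K] [Fintype m]
    [Fintype n] [DecidableEq m] [DecidableEq n] (A : Matrix m m K) (B : Matrix n n K)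
    (h : ∀ k, 0 < k → (A ^ k).trace = (B ^ k).trace) : A.charpolyRev = B.charpolyRev := by
  rw [← Polynomial.coe_inj]
  have hA := derivative_charpolyRev_eq A
  have hB := derivative_charpolyRev_eq B
  have e : (PowerSeries.mk fun k => -(A ^ (k + 1)).trace) =
      PowerSeries.mk fun k => -(B ^ (k + 1)).trace := by
    ext k; simp [h (k + 1) k.succ_pos]
  rw [e] at hA
  ext k
  induction k using Nat.strong_induction_on with
  | _ k ih =>
    rcases k with _ | k
    · simp [Polynomial.coeff_zero_eq_eval_zero, Matrix.eval_charpolyRev]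
    · have h1 := congrArg (PowerSeries.coeff k) hA
      have h2 := congrArg (PowerSeries.coeff k) hB
      rw [PowerSeries.coeff_derivative, PowerSeries.coeff_mul] at h1 h2
      have h3 : ((A.charpolyRev : K⟦X⟧).coeff (k + 1)) * (k + 1 : K) =
          ((B.charpolyRev : K⟦X⟧).coeff (k + 1)) * (k + 1 : K) := by
        rw [h1, h2]
        refine Finset.sum_congr rfl fun x hx => ?_
        rw [ih x.1 (by have := Finset.HasAntidiagonal.mem_antidiagonal.1 hx; omega)]
      exact mul_right_cancel₀ (Nat.cast_add_one_ne_zero k) h3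

theorem eval_one_charpolyRev {K l : Type*} [CommRing K] [Fintype l] [DecidableEq l]
    (A : Matrix l l K) : A.charpolyRev.eval 1 = (1 - A).det := by
  rw [charpolyRev, ← Polynomial.coe_evalRingHom, RingHom.map_det]
  congr 1
  ext i j
  by_cases hij : i = j <;> simp [hij]

/-- Rank factorization of an idempotent matrix. -/
theorem exists_factorization_of_idempotent {K n : Type*} [Field K] [Fintype n] [DecidableEq n]
    (P : Matrix n n K) (hP : P * P = P) :
    ∃ (r : ℕ) (A : Matrix n (Fin r) K) (B : Matrix (Fin r) n K), A * B = P ∧ B * A = 1 := by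
  let f := Matrix.toLin' P
  let b := Module.finBasis K (LinearMap.range f)
  let A := LinearMap.toMatrix b (Pi.basisFun K n) (LinearMap.range f).subtype
  let B := LinearMap.toMatrix (Pi.basisFun K n) b f.rangeRestrict
  have hf : ∀ x, f (f x) = f x := fun x => by
    simp only [f, Matrix.toLin'_apply, Matrix.mulVec_mulVec, hP]
  refine ⟨_, A, B, ?_, ?_⟩
  · rw [← LinearMap.toMatrix_comp]
    have : (LinearMap.range f).subtype ∘ₗ f.rangeRestrict = f := by ext; rfl
    rw [this, LinearMap.toMatrix_eq_toMatrix', LinearMap.toMatrix'_toLin']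
  · rw [← LinearMap.toMatrix_comp]
    have : f.rangeRestrict ∘ₗ (LinearMap.range f).subtype = LinearMap.id := by
      apply LinearMap.ext
      rintro ⟨_, x, rfl⟩
      exact Subtype.ext (hf x)
    rw [this, LinearMap.toMatrix_id]

end Matrix

/-! ### Spectral projections of an element of finite order -/

/-- The average of the powers of `c`; if `c ^ m = 1`, the projection to the fixed points of `c`. -/
def cycAverage {K A : Type*} [Field K] [Ring A] [Algebra K A] (m : ℕ) (c : A) : A :=
  (m : K)⁻¹ • ∑ i ∈ Finset.range m, c ^ i

section CycAverage

variable {K A : Type*} [Field K] [Ring A] [Algebra K A]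

theorem mul_cycAverage {m : ℕ} {c : A} (hc : c ^ m = 1) :
    c * cycAverage (K := K) m c = cycAverage (K := K) m c := by
  rw [cycAverage, mul_smul_comm, Finset.mul_sum]
  congr 1
  have h1 := Finset.sum_range_succ' (fun i => c ^ i) m
  rw [Finset.sum_range_succ, hc, pow_zero] at h1
  simpa [pow_succ'] using (add_right_cancel h1).symm

theorem pow_mul_cycAverage {m : ℕ} {c : A} (hc : c ^ m = 1) (i : ℕ) :
    c ^ i * cycAverage (K := K) m c = cycAverage (K := K) m c := by
  induction i with
  | zero => simp
  | succ i ih => rw [pow_succ, mul_assoc, mul_cycAverage hc, ih]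

theorem cycAverage_mul_self {m : ℕ} {c : A} (hm : (m : K) ≠ 0) (hc : c ^ m = 1) :
    cycAverage (K := K) m c * cycAverage (K := K) m c = cycAverage (K := K) m c := by
  conv_lhs => enter [1]; rw [cycAverage]
  rw [smul_mul_assoc, Finset.sum_mul, Finset.sum_congr rfl fun i _ => pow_mul_cycAverage hc i,
    Finset.sum_const, Finset.card_range, ← Nat.cast_smul_eq_nsmul K, smul_smul,
    inv_mul_cancel₀ hm, one_smul]

/-- The sum of the spectral projections of an element `c` with `c ^ m = 1` is one. -/
theorem sum_cycAverage {m : ℕ} {c : A} {ζ : K} (hm : (m : K) ≠ 0) (hζ : IsPrimitiveRoot ζ m) :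
    ∑ j ∈ Finset.range m, cycAverage (K := K) m (ζ ^ j • c) = 1 := by
  have hm0 : 0 < m := Nat.pos_of_ne_zero (by rintro rfl; simp at hm)
  simp only [cycAverage, ← Finset.smul_sum, smul_pow, ← pow_mul]
  -- After the interchange, orthogonality of roots of unity kills every power of `c` except the
  -- zeroth.
  rw [Finset.sum_comm]
  simp only [← Finset.sum_smul]
  rw [Finset.sum_eq_single_of_mem 0 (Finset.mem_range.2 hm0)]
  · simp [← Nat.cast_smul_eq_nsmul K, smul_smul, inv_mul_cancel₀ hm]
  · intro i hi hi0
    have h1 : ζ ^ i ≠ 1 := hζ.pow_ne_one_of_pos_of_lt hi0 (Finset.mem_range.1 hi)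
    have : ∑ j ∈ Finset.range m, ζ ^ (j * i) = 0 := by
      have := geom_sum_eq h1 m
      simp only [mul_comm _ i, pow_mul]
      rw [this, ← pow_mul, mul_comm, pow_mul, hζ.pow_eq_one]
      simp
    rw [this, zero_smul]

theorem smul_mul_cycAverage_smul {m : ℕ} {c : A} {ζ : K} (hc : c ^ m = 1) (hζ : ζ ^ m = 1) (hζ0 : ζ ≠ 0) :
    c * cycAverage (K := K) m (ζ • c) = ζ⁻¹ • cycAverage (K := K) m (ζ • c) := by
  have h : (ζ • c) ^ m = 1 := by rw [smul_pow, hζ, hc, one_smul]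
  have := mul_cycAverage (K := K) h
  rw [smul_mul_assoc] at this
  conv_rhs => rw [← this]
  rw [smul_smul, inv_mul_cancel₀ hζ0, one_smul]

theorem Commute.cycAverage_right {m : ℕ} {c x : A} (h : Commute x c) :
    Commute x (cycAverage (K := K) m c) :=
  (Commute.sum_right _ _ _ fun _ _ => h.pow_right _).smul_right _

end CycAverage

/-! ### Permutation matrices and tensor powers -/

/-- The permutation representation. -/
def permMatrixHom (X N : Type*) [Fintype X] [DecidableEq X] [Semiring N] :
    Equiv.Perm X →* Matrix X X N where
  toFun σ := Matrix.of fun i j => if i = σ j then 1 else 0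
  map_one' := by
    ext i j
    change (if i = j then (1 : N) else 0) = _
    rw [Matrix.one_apply]
  map_mul' σ τ := by
    ext i j
    change (if i = σ (τ j) then (1 : N) else 0) =
      ∑ k, (if i = σ k then 1 else 0) * (if k = τ j then 1 else 0)
    rw [Finset.sum_eq_single (τ j)] <;> simp +contextual

theorem permMatrixHom_apply {X N : Type*} [Fintype X] [DecidableEq X] [Semiring N]
    (σ : Equiv.Perm X) (i j : X) :
    permMatrixHom X N σ i j = if i = σ j then 1 else 0 := rfl

theorem trace_mul_permMatrixHom {X N : Type*} [Fintype X] [DecidableEq X] [CommSemiring N]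
    (A : Matrix X X N) (σ : Equiv.Perm X) :
    (A * permMatrixHom X N σ).trace = ∑ a, A a (σ a) := by
  simp [Matrix.trace, Matrix.mul_apply, permMatrixHom_apply]

namespace Matrix

theorem pow_succ_apply_eq_sum {K d : Type*} [CommSemiring K] [Fintype d] [DecidableEq d]
    (X : Matrix d d K) (n : ℕ) (x y : d) :
    (X ^ (n + 1)) x y =
      ∑ f : Fin n → d, ∏ i : Fin (n + 1), X (Fin.cons (α := fun _ => d) x f i)
        (Fin.snoc (α := fun _ => d) f y i) := by
  induction n generalizing x with
  | zero => simp [Fin.snoc]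
  | succ n ih =>
    rw [pow_succ', Matrix.mul_apply, ← (Fin.consEquiv fun _ => d).sum_comp,
      Fintype.sum_prod_type]
    refine Finset.sum_congr rfl fun z _ => ?_
    rw [ih, Finset.mul_sum]
    refine Finset.sum_congr rfl fun f _ => ?_
    rw [Fin.prod_univ_succ (n := n + 1)]
    have e : Fin.snoc (α := fun _ => d) (Fin.cons (α := fun _ => d) z f) y =
        Fin.cons (α := fun _ => d) z (Fin.snoc (α := fun _ => d) f y) :=
      (Fin.cons_snoc_eq_snoc_cons z f y).symm
    change _ = X _ (Fin.snoc (α := fun _ => d) (Fin.cons (α := fun _ => d) z f) y 0) * ∏ i,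
      X _ (Fin.snoc (α := fun _ => d) (Fin.cons (α := fun _ => d) z f) y (Fin.succ i))
    rw [e]
    rfl

theorem trace_pow_eq_sum {K d : Type*} [CommSemiring K] [Fintype d] [DecidableEq d]
    (X : Matrix d d K) (n : ℕ) :
    (X ^ (n + 1)).trace = ∑ a : Fin (n + 1) → d, ∏ i, X (a i) (a (i + 1)) := by
  rw [← (Fin.consEquiv fun _ => d).sum_comp, Fintype.sum_prod_type]
  refine Finset.sum_congr rfl fun x _ => ?_
  rw [Matrix.diag_apply, pow_succ_apply_eq_sum]
  refine Finset.sum_congr rfl fun f _ => Finset.prod_congr rfl fun i _ => ?_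
  congr 1
  induction i using Fin.lastCases with
  | last => simp
  | cast i => simp [Fin.coeSucc_eq_succ]

/-- Multiplication by `j` permutes `ZMod p`, so the cycle with step `j` can be relabelled as the
cycle with step 1. In this form every nontrivial cyclic shift of the p-th tensor power contributes
the same trace tr(X^p). -/
theorem trace_pow_prime_eq_sum {K d : Type*} [CommSemiring K] [Fintype d] [DecidableEq d]
    (X : Matrix d d K) (p : ℕ) [hp : Fact p.Prime] (j : ZMod p) (hj : j ≠ 0) :
    (X ^ p).trace = ∑ a : ZMod p → d, ∏ i, X (a i) (a (i + j)) := by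
  have h1 : (X ^ p).trace = ∑ a : ZMod p → d, ∏ i, X (a i) (a (i + 1)) := by
    -- With `p` a literal successor, `ZMod p` is `Fin (n + 1)` by definition.
    obtain ⟨n, rfl⟩ : ∃ n, p = n + 1 := ⟨p - 1, by have := hp.1.pos; omega⟩
    exact trace_pow_eq_sum X n
  rw [h1]
  let e : ZMod p ≃ ZMod p := Equiv.mulRight₀ j hj
  rw [← (Equiv.arrowCongr e.symm (Equiv.refl d)).sum_comp fun a => ∏ i, X (a i) (a (i + 1))]
  refine Finset.sum_congr rfl fun a _ => ?_
  rw [← Equiv.prod_comp e fun i => X (a i) (a (i + j))]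
  refine Finset.prod_congr rfl fun i _ => ?_
  have : e i + j = e (i + 1) := by simp [e, add_mul]
  rw [this]
  simp

/-- The `ι`-fold tensor power of matrices. -/
def tensorPow (ι : Type*) {K d : Type*} [CommSemiring K] [Fintype d] [DecidableEq d] [Fintype ι]
    [DecidableEq ι] : Matrix d d K →* Matrix (ι → d) (ι → d) K where
  toFun A := Matrix.of fun a b => ∏ i, A (a i) (b i)
  map_one' := by
    ext a b
    by_cases h : a = b
    · subst h
      simp
    · obtain ⟨i, hi⟩ := Function.ne_iff.1 h
      rw [Matrix.one_apply_ne h]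
      exact Finset.prod_eq_zero (Finset.mem_univ i) (Matrix.one_apply_ne hi)
  map_mul' A B := by
    ext a b
    simp only [Matrix.of_apply, Matrix.mul_apply, ← Finset.prod_mul_distrib]
    rw [Finset.prod_univ_sum, Fintype.piFinset_univ]

end Matrix

/-- The representation cut out by an idempotent commuting with a representation. -/
theorem exists_compression {G N n : Type*} [Monoid G] [Field N] [Fintype n] [DecidableEq n]
    (ρ : G →* Matrix n n N) (P : Matrix n n N) (hP : P * P = P) (hc : ∀ g, Commute (ρ g) P) :
    ∃ (r : ℕ) (A : Matrix n (Fin r) N) (B : Matrix (Fin r) n N)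
      (T : G →* Matrix (Fin r) (Fin r) N), A * B = P ∧ B * A = 1 ∧ ∀ g, T g = B * ρ g * A := by
  obtain ⟨r, A, B, hAB, hBA⟩ := Matrix.exists_factorization_of_idempotent P hP
  refine ⟨r, A, B, ⟨⟨fun g => B * ρ g * A, by simp [hBA]⟩, fun g h => ?_⟩, hAB, hBA, fun g => rfl⟩
  calc B * ρ (g * h) * A = B * A * (B * ρ (g * h) * A) := by rw [hBA, Matrix.one_mul]
    _ = B * ((A * B) * ρ g) * ρ h * A := by rw [map_mul]; simp only [Matrix.mul_assoc]
    _ = B * (ρ g * (A * B)) * ρ h * A := by rw [hAB, (hc g).eq]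
    _ = B * ρ g * A * (B * ρ h * A) := by simp only [Matrix.mul_assoc]

namespace DetDescent

/-! ### Existence of Adams operations -/

section

variable {G N : Type*} [Group G] [Field N]

@[simp] theorem character_repClass (T : MatRep G N) (g : G) :
    character (repClass T) (ConjClasses.mk g) = (T.rho g).1.trace := by
  rw [character, repLift_repClass]; rfl

/-- A matrix representation with an arbitrary index type, as a `MatRep`. -/
def MatRep.ofHom {n : Type*} [Fintype n] [DecidableEq n] (ρ : G →* Matrix n n N) :
    MatRep G N where
  dim := Fintype.card n
  rho := ((Matrix.reindexRingEquiv N (Fintype.equivFin n)).toRingHom.toMonoidHom.comp ρ).toHomUnits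

theorem MatRep.ofHom_rho {n : Type*} [Fintype n] [DecidableEq n] (ρ : G →* Matrix n n N)
    (g : G) : ((MatRep.ofHom ρ).rho g).1 =
      Matrix.reindex (Fintype.equivFin n) (Fintype.equivFin n) (ρ g) := rfl

@[simp] theorem character_ofHom {n : Type*} [Fintype n] [DecidableEq n] (ρ : G →* Matrix n n N)
    (g : G) : character (repClass (MatRep.ofHom ρ)) (ConjClasses.mk g) = (ρ g).trace := by
  rw [character_repClass, MatRep.ofHom_rho]
  exact (Fintype.equivFin n).symm.sum_comp fun i => ρ g i i

theorem exists_character_of_idempotent {n : Type*} [Fintype n] [DecidableEq n]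
    (ρ : G →* Matrix n n N) (P : Matrix n n N) (hP : P * P = P) (hc : ∀ g, Commute (ρ g) P) :
    ∃ y : RepRing G N, ∀ g, character y (ConjClasses.mk g) = (ρ g * P).trace := by
  obtain ⟨r, A, B, T, hAB, -, hT⟩ := exists_compression ρ P hP hc
  refine ⟨repClass (MatRep.ofHom T), fun g => ?_⟩
  rw [character_ofHom, hT, ← hAB, Matrix.trace_mul_comm, ← Matrix.mul_assoc,
    Matrix.trace_mul_comm]

/-- The existence of the Adams operation of prime degree. -/
theorem exists_adams_prime [CharZero N] (p : ℕ) [hp : Fact p.Prime] {ζ : N}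
    (hζ : IsPrimitiveRoot ζ p) (x : RepRing G N) :
    ∃ y : RepRing G N, ∀ g : G,
      character y (ConjClasses.mk g) = character x (ConjClasses.mk (g ^ p)) := by
  induction x using repRing_induction with
  | zero => exact ⟨0, fun g => by simp⟩
  | neg x hx =>
    obtain ⟨y, hy⟩ := hx
    exact ⟨-y, fun g => by simp [hy]⟩
  | add x₁ x₂ h₁ h₂ =>
    obtain ⟨y₁, hy₁⟩ := h₁
    obtain ⟨y₂, hy₂⟩ := h₂
    exact ⟨y₁ + y₂, fun g => by simp [hy₁, hy₂]⟩
  | of T =>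
    let ρ : G →* Matrix (ZMod p → Fin T.dim) (ZMod p → Fin T.dim) N :=
      (Matrix.tensorPow (ZMod p)).comp ((Units.coeHom _).comp T.rho)
    let τ (j : ZMod p) : Equiv.Perm (ZMod p → Fin T.dim) :=
      Equiv.arrowCongr (Equiv.subRight j) (Equiv.refl _)
    have hτ (j : ZMod p) (a : ZMod p → Fin T.dim) (i : ZMod p) : τ j a i = a (i + j) := by
      simp [τ]
    have hτpow (k : ℕ) : τ 1 ^ k = τ k := by
      induction k with
      | zero => ext a i; simp [hτ]
      | succ k ih =>
        ext a i
        rw [pow_succ, ih, Equiv.Perm.mul_apply, hτ, hτ, hτ]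
        push_cast
        rw [add_assoc]
    let c : Matrix (ZMod p → Fin T.dim) (ZMod p → Fin T.dim) N := permMatrixHom _ N (τ 1)
    have hcpow (k : ℕ) : c ^ k = permMatrixHom _ N (τ k) := by
      rw [← map_pow, hτpow]
    have hc : c ^ p = 1 := by
      rw [hcpow, ← map_one (permMatrixHom (ZMod p → Fin T.dim) N)]
      congr 1
      ext a i
      simp [hτ]
    have hp0 : (p : N) ≠ 0 := Nat.cast_ne_zero.2 hp.1.ne_zero
    have hcomm (g : G) : Commute (ρ g) c := by
      change ρ g * c = c * ρ g
      ext a b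
      have e1 : (ρ g * c) a b = ρ g a (τ 1 b) := by
        simp [Matrix.mul_apply, c, permMatrixHom_apply]
      have e2 : (c * ρ g) a b = ρ g ((τ 1).symm a) b := by
        rw [Matrix.mul_apply, Finset.sum_eq_single ((τ 1).symm a)]
        · simp [c, permMatrixHom_apply]
        · intro e _ he
          have : a ≠ τ 1 e := fun h => he (by rw [h, Equiv.symm_apply_apply])
          simp [c, permMatrixHom_apply, this]
        · simp
      rw [e1, e2]
      change ∏ i, _ = ∏ i, _
      obtain ⟨a, rfl⟩ := (τ 1).surjective a
      rw [← Equiv.prod_comp (Equiv.addRight (1 : ZMod p)) fun i =>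
        ((Units.coeHom _).comp T.rho) g ((τ 1).symm (τ 1 a) i) (b i)]
      refine Finset.prod_congr rfl fun i _ => ?_
      simp [hτ]
    have htr (g : G) (k : ℕ) (hk : k ∈ Finset.range p) (hk0 : k ≠ 0) :
        (ρ g * c ^ k).trace = ((T.rho g).1 ^ p).trace := by
      have hk' : (k : ZMod p) ≠ 0 := by
        rw [Ne, ZMod.natCast_eq_zero_iff]
        exact fun h => by
          have := Nat.le_of_dvd (Nat.pos_of_ne_zero hk0) h
          have := Finset.mem_range.1 hk
          omega
      rw [hcpow, trace_mul_permMatrixHom, Matrix.trace_pow_prime_eq_sum _ p _ hk']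
      refine Finset.sum_congr rfl fun a _ => ?_
      change ∏ i, _ = _
      simp [hτ]
    obtain ⟨y₁, hy₁⟩ := exists_character_of_idempotent ρ (cycAverage (K := N) p c)
      (cycAverage_mul_self hp0 hc) fun g => (hcomm g).cycAverage_right
    obtain ⟨y₂, hy₂⟩ := exists_character_of_idempotent ρ (cycAverage (K := N) p (ζ • c))
      (cycAverage_mul_self hp0 (by rw [smul_pow, hζ.pow_eq_one, hc, one_smul]))
      fun g => ((hcomm g).smul_right ζ).cycAverage_right
    -- With `c` the cyclic shift of the p-th tensor power, this is the fixed space of `c` minus that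
    -- of `ζ • c`. Its character is p⁻¹ ∑ (1 - ζ^k) tr(ρ(g) c^k): the term k = 0 vanishes, all other
    -- traces equal tr(T(g)^p), and the coefficients 1 - ζ^k sum to p.
    refine ⟨y₁ - y₂, fun g => ?_⟩
    have hsum : ∑ k ∈ Finset.range p, (1 - ζ ^ k) = (p : N) := by
      rw [Finset.sum_sub_distrib, hζ.geom_sum_eq_zero hp.1.one_lt]
      simp
    rw [map_sub, Pi.sub_apply, hy₁, hy₂, ← Matrix.trace_sub, ← Matrix.mul_sub, cycAverage,
      cycAverage, ← smul_sub, ← Finset.sum_sub_distrib, Matrix.mul_smul, Matrix.trace_smul,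
      Matrix.mul_sum, Matrix.trace_sum, character_repClass, map_pow, Units.val_pow_eq_pow_val,
      smul_eq_mul, inv_mul_eq_iff_eq_mul₀ hp0, ← hsum, Finset.sum_mul]
    refine Finset.sum_congr rfl fun k hk => ?_
    have : c ^ k - (ζ • c) ^ k = (1 - ζ ^ k) • c ^ k := by rw [smul_pow, sub_smul, one_smul]
    rw [this, Matrix.mul_smul, Matrix.trace_smul, smul_eq_mul]
    rcases eq_or_ne k 0 with rfl | hk0
    · simp
    · rw [htr g k hk hk0]

theorem exists_adams_prime_pow [CharZero N] (p : ℕ) [hp : Fact p.Prime] {ζ : N}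
    (hζ : IsPrimitiveRoot ζ p) (q : ℕ) (x : RepRing G N) :
    ∃ y : RepRing G N, ∀ g : G,
      character y (ConjClasses.mk g) = character x (ConjClasses.mk (g ^ p ^ q)) := by
  induction q with
  | zero => exact ⟨x, by simp⟩
  | succ q ih =>
    obtain ⟨y, hy⟩ := ih
    obtain ⟨z, hz⟩ := exists_adams_prime p hζ y
    exact ⟨z, fun g => by rw [hz, hy, ← pow_mul, pow_succ']⟩

theorem character_adams {m : ℕ} {x : RepRing G N}
    (h : ∃ y : RepRing G N, ∀ g : G,
      character y (ConjClasses.mk g) = character x (ConjClasses.mk (g ^ m))) (g : G) :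
    character (adams m x) (ConjClasses.mk g) = character x (ConjClasses.mk (g ^ m)) :=
  Classical.epsilon_spec h g

end

/-! ### Characters span the class functions -/

section Finite

variable {G N : Type*} [Group G] [Finite G] [Field N] [CharZero N]

/-- The characters span the class functions, over a field with enough roots of unity. -/
theorem span_range_character {n : ℕ} {ζ : N} (hζ : IsPrimitiveRoot ζ n)
    (hn : ∀ g : G, orderOf g ∣ n) (hn0 : n ≠ 0) :
    Submodule.span N (Set.range (character : RepRing G N → ConjClasses G → N)) = ⊤ := by
  classical
  have := Fintype.ofFinite G
  have := Fintype.ofFinite (ConjClasses G)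
  rw [eq_top_iff]
  have hsingle (g₀ : G) : (Pi.single (ConjClasses.mk g₀) 1 : ConjClasses G → N) ∈
      Submodule.span N (Set.range (character : RepRing G N → ConjClasses G → N)) := by
    let m := orderOf g₀
    have hm0 : (m : N) ≠ 0 := Nat.cast_ne_zero.2 (orderOf_pos g₀).ne'
    obtain ⟨k, hk⟩ := hn g₀
    have hξ : IsPrimitiveRoot (ζ ^ k) m := hζ.pow (Nat.pos_of_ne_zero hn0) (by rw [hk, mul_comm])
    have hξ0 : ζ ^ k ≠ 0 := hξ.ne_zero (orderOf_pos g₀).ne'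
    let ρ : G →* Matrix G G N := (permMatrixHom G N).comp (MulAction.toPermHom G G)
    let c : Matrix G G N := permMatrixHom G N (Equiv.mulRight g₀⁻¹)
    have hc : c ^ m = 1 := by
      rw [← map_pow, ← map_one (permMatrixHom G N)]
      congr 1
      ext h
      simp [m, Equiv.pow_mulRight]
    have hcomm (g : G) : Commute (ρ g) c := by
      change permMatrixHom G N _ * permMatrixHom G N _ = permMatrixHom G N _ * permMatrixHom G N _
      rw [← map_mul, ← map_mul]
      congr 1
      ext h
      simp [mul_assoc]
    have hy (j : ℕ) := exists_character_of_idempotent ρ (cycAverage (K := N) m ((ζ ^ k) ^ j • c))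
      (cycAverage_mul_self hm0 (by
        rw [smul_pow, hc, ← pow_mul, mul_comm j, pow_mul, hξ.pow_eq_one, one_pow, one_smul]))
      fun g => ((hcomm g).smul_right _).cycAverage_right
    choose y hy using hy
    -- Spectral decomposition of `c`; each projection cuts out a subrepresentation, so g ↦ tr(ρ(g)c)
    -- is a combination of characters.
    have hsum : c = ∑ j ∈ Finset.range m, ((ζ ^ k) ^ j)⁻¹ •
        cycAverage (K := N) m ((ζ ^ k) ^ j • c) := by
      conv_lhs => rw [← mul_one c, ← sum_cycAverage (c := c) hm0 hξ, Finset.mul_sum]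
      refine Finset.sum_congr rfl fun j _ => smul_mul_cycAverage_smul hc ?_ (pow_ne_zero _ hξ0)
      rw [← pow_mul, mul_comm j, pow_mul, hξ.pow_eq_one, one_pow]
    have htr (g : G) : (ρ g * c).trace =
        ∑ j ∈ Finset.range m, ((ζ ^ k) ^ j)⁻¹ * character (y j) (ConjClasses.mk g) := by
      conv_lhs => rw [hsum]
      rw [Matrix.mul_sum, Matrix.trace_sum]
      refine Finset.sum_congr rfl fun j _ => ?_
      rw [Matrix.mul_smul, Matrix.trace_smul, hy, smul_eq_mul]
    have htr2 (g : G) : (ρ g * c).trace =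
        ((Finset.univ.filter fun h : G => h * g₀ * h⁻¹ = g).card : N) := by
      change (permMatrixHom G N _ * permMatrixHom G N _).trace = _
      rw [← map_mul, ← one_mul (permMatrixHom G N _), trace_mul_permMatrixHom,
        Finset.card_filter, Nat.cast_sum]
      refine Finset.sum_congr rfl fun h _ => ?_
      have : h = g * (h * g₀⁻¹) ↔ h * g₀ * h⁻¹ = g := by
        constructor
        · intro e
          calc h * g₀ * h⁻¹ = (g * (h * g₀⁻¹)) * g₀ * h⁻¹ := by rw [← e]
            _ = g := by group
        · rintro rfl
          group
      simp [Matrix.one_apply, this]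
    let z : N := ((Finset.univ.filter fun h : G => h * g₀ * h⁻¹ = g₀).card : N)
    have hz : z ≠ 0 := by
      refine Nat.cast_ne_zero.2 (Finset.card_pos.2 ⟨1, by simp⟩).ne'
    have hf : (Pi.single (ConjClasses.mk g₀) 1 : ConjClasses G → N) =
        z⁻¹ • ∑ j ∈ Finset.range m, ((ζ ^ k) ^ j)⁻¹ • character (y j) := by
      funext cl
      obtain ⟨g, rfl⟩ := ConjClasses.exists_rep cl
      rw [Pi.smul_apply, Finset.sum_apply]
      change (Pi.single (ConjClasses.mk g₀) 1 : ConjClasses G → N) (ConjClasses.mk g) = z⁻¹ • ∑ j ∈ Finset.range m, ((ζ ^ k) ^ j)⁻¹ * character (y j) (ConjClasses.mk g)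
      rw [← htr]
      by_cases hg : ConjClasses.mk g = ConjClasses.mk g₀
      · have : (ρ g * c).trace = (ρ g₀ * c).trace := by
          rw [htr, htr, hg]
        rw [this, htr2, hg, Pi.single_eq_same]
        exact (inv_mul_cancel₀ hz).symm
      · rw [Pi.single_eq_of_ne hg, htr2, Finset.filter_false_of_mem]
        · simp
        · intro h _ e
          exact hg (ConjClasses.mk_eq_mk_iff_isConj.2 (isConj_iff.2 ⟨h, e⟩)).symm
    rw [hf]
    exact Submodule.smul_mem _ _ (Submodule.sum_mem _ fun j _ =>
      Submodule.smul_mem _ _ (Submodule.subset_span ⟨_, rfl⟩))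
  intro f _
  have : f = ∑ c, f c • (Pi.single c 1 : ConjClasses G → N) := by
    funext d
    simp [Finset.sum_apply, Pi.single_apply]
  rw [this]
  refine Submodule.sum_mem _ fun c _ => Submodule.smul_mem _ _ ?_
  obtain ⟨g, rfl⟩ := ConjClasses.exists_rep c
  exact hsingle g

end Finite

end DetDescent

namespace DetDescent

/-! ### Integrality of the character pairing; additive functions of characters -/

section Pairing

open scoped Matrix

variable {G N : Type*} [Group G] [Fintype G] [Field N]

/-- The standard bilinear form on class functions. -/
def classPairing : (ConjClasses G → N) →ₗ[N] (ConjClasses G → N) →ₗ[N] N :=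
  LinearMap.mk₂ N
    (fun f h => (Fintype.card G : N)⁻¹ * ∑ g : G, f (ConjClasses.mk g⁻¹) * h (ConjClasses.mk g))
    (fun _ _ _ => by simp [add_mul, Finset.sum_add_distrib, mul_add])
    (fun c _ _ => by
      simp only [Pi.smul_apply, smul_eq_mul, mul_assoc, ← Finset.mul_sum]
      ring)
    (fun _ _ _ => by simp [Finset.sum_add_distrib, mul_add])
    (fun c _ _ => by
      simp only [Pi.smul_apply, smul_eq_mul, mul_left_comm _ c, ← Finset.mul_sum])

theorem classPairing_apply (f h : ConjClasses G → N) : classPairing f h =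
    (Fintype.card G : N)⁻¹ * ∑ g : G, f (ConjClasses.mk g⁻¹) * h (ConjClasses.mk g) := rfl

variable [CharZero N]

theorem classPairing_nondegenerate (h : ConjClasses G → N) (hh : ∀ f, classPairing f h = 0) :
    h = 0 := by
  classical
  funext c
  obtain ⟨g₀, rfl⟩ := ConjClasses.exists_rep c
  -- The inverse is needed because the first argument of the pairing is evaluated at g⁻¹.
  have := hh (Pi.single (ConjClasses.mk g₀⁻¹) 1)
  rw [classPairing_apply, mul_eq_zero, or_iff_right
    (inv_ne_zero (Nat.cast_ne_zero.2 Fintype.card_ne_zero))] at this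
  have h2 (g : G) : (Pi.single (ConjClasses.mk g₀⁻¹) 1 : ConjClasses G → N) (ConjClasses.mk g⁻¹) *
      h (ConjClasses.mk g) = if ConjClasses.mk g = ConjClasses.mk g₀ then
        h (ConjClasses.mk g₀) else 0 := by
    have : ConjClasses.mk g⁻¹ = ConjClasses.mk g₀⁻¹ ↔ ConjClasses.mk g = ConjClasses.mk g₀ := by
      simp only [ConjClasses.mk_eq_mk_iff_isConj, isConj_iff]
      refine exists_congr fun c => ?_
      rw [← inv_inj]
      simp [mul_assoc]
    rw [Pi.single_apply]
    simp only [this]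
    split_ifs with e
    · rw [e, one_mul]
    · rw [zero_mul]
  rw [Finset.sum_congr rfl fun g _ => h2 g, ← Finset.sum_filter, Finset.sum_const,
    nsmul_eq_mul, mul_eq_zero] at this
  refine this.resolve_left (Nat.cast_ne_zero.2 (Finset.card_pos.2 ⟨g₀, by simp⟩).ne')

/-- For representations, the pairing is the trace of the averaging projection onto the invariants of
T^∨ ⊗ T', which is the rank of an idempotent. -/
theorem exists_int_classPairing (x y : RepRing G N) :
    ∃ k : ℤ, classPairing (character x) (character y) = k := by
  induction x using repRing_induction with
  | zero => exact ⟨0, by simp⟩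
  | neg x hx =>
    obtain ⟨k, hk⟩ := hx
    exact ⟨-k, by simp [hk]⟩
  | add x₁ x₂ h₁ h₂ =>
    obtain ⟨k₁, hk₁⟩ := h₁
    obtain ⟨k₂, hk₂⟩ := h₂
    exact ⟨k₁ + k₂, by simp [hk₁, hk₂]⟩
  | of T =>
  induction y using repRing_induction with
  | zero => exact ⟨0, by simp⟩
  | neg x hx =>
    obtain ⟨k, hk⟩ := hx
    exact ⟨-k, by simp [hk]⟩
  | add x₁ x₂ h₁ h₂ =>
    obtain ⟨k₁, hk₁⟩ := h₁
    obtain ⟨k₂, hk₂⟩ := h₂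
    exact ⟨k₁ + k₂, by simp [hk₁, hk₂]⟩
  | of T' =>
    let ρ : G →* Matrix (Fin T.dim × Fin T'.dim) (Fin T.dim × Fin T'.dim) N :=
      { toFun := fun g => Matrix.kroneckerMap (· * ·) (T.rho g⁻¹).1.transpose (T'.rho g).1
        map_one' := by simp
        map_mul' := fun g h => by
          rw [← Matrix.mul_kronecker_mul, mul_inv_rev, map_mul, map_mul, Units.val_mul,
            Units.val_mul, Matrix.transpose_mul] }
    let P := (Fintype.card G : N)⁻¹ • ∑ g, ρ g
    have hP1 (g : G) : ρ g * P = P := by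
      simp only [P, Matrix.mul_smul, Finset.mul_sum, ← map_mul]
      congr 1
      exact Equiv.sum_comp (Equiv.mulLeft g) fun h => ρ h
    have hP : P * P = P := by
      conv_lhs => enter [1]; simp only [P]
      rw [Matrix.smul_mul, Finset.sum_mul, Finset.sum_congr rfl fun g _ => hP1 g,
        Finset.sum_const, Finset.card_univ, ← Nat.cast_smul_eq_nsmul N, smul_smul,
        inv_mul_cancel₀ (Nat.cast_ne_zero.2 Fintype.card_ne_zero), one_smul]
    obtain ⟨r, A, B, hAB, hBA⟩ := Matrix.exists_factorization_of_idempotent P hP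
    refine ⟨r, ?_⟩
    have htr : P.trace = r := by
      rw [← hAB, Matrix.trace_mul_comm, hBA]
      simp
    rw [Int.cast_natCast, ← htr, classPairing_apply, Matrix.trace_smul, Matrix.trace_sum,
      smul_eq_mul]
    congr 1
    refine Finset.sum_congr rfl fun g _ => ?_
    rw [character_repClass, character_repClass]
    exact ((Matrix.trace_kronecker _ _).trans (by rw [Matrix.trace_transpose])).symm

/-- An additive function on the representation ring that depends only on characters is a linear
combination of evaluations of characters. -/
theorem exists_eq_sum_character [Fintype (ConjClasses G)]
    (hspan : Submodule.span N (Set.range (character : RepRing G N → ConjClasses G → N)) = ⊤)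
    (L : RepRing G N →+ N) (hL : ∀ x y, character x = character y → L x = L y) :
    ∃ a : ConjClasses G → N, ∀ x, L x = ∑ c, a c * character x c := by
  classical
  obtain ⟨ι, b, hb⟩ : ∃ (ι : Type _) (b : Module.Basis ι N (ConjClasses G → N)),
      ∀ i, ∃ β : RepRing G N, character β = b i :=
    ⟨_, Module.Basis.ofSpan hspan.ge, fun i => Module.Basis.ofSpan_subset hspan.ge ⟨i, rfl⟩⟩
  choose β hβ using hb
  have := Module.Finite.finite_basis b
  have := Fintype.ofFinite ι
  choose k hk using exists_int_classPairing (G := G) (N := N)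
  -- The Gram matrix of a basis consisting of characters. It is integral, and invertible over N by
  -- nondegeneracy; this is what lets a merely additive function be extended N-linearly.
  let B : Matrix ι ι ℤ := Matrix.of fun i j => k (β i) (β j)
  let BN : Matrix ι ι N := B.map (Int.castRingHom N)
  have hBN (i j : ι) : BN i j = classPairing (b i) (b j) := by
    rw [← hβ, ← hβ, hk]
    rfl
  have hdetN : BN.det = (B.det : N) := ((Int.castRingHom N).map_det B).symm
  have hdet : (B.det : N) ≠ 0 := by
    rw [← hdetN]
    intro h0
    obtain ⟨v, hv, hv0⟩ := Matrix.exists_mulVec_eq_zero_iff.2 h0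
    have h1 (i : ι) : classPairing (b i) (∑ j, v j • b j) = 0 := by
      have := congrFun hv0 i
      rw [map_sum]
      refine Eq.trans ?_ this
      simp [Matrix.mulVec, dotProduct, hBN, mul_comm]
    have h2 : ∑ j, v j • b j = 0 := by
      refine classPairing_nondegenerate _ fun f => ?_
      rw [← b.sum_repr f, map_sum classPairing, LinearMap.sum_apply]
      refine Finset.sum_eq_zero fun i _ => ?_
      rw [map_smul, LinearMap.smul_apply, h1, smul_zero]
    exact hv (funext fun j => Fintype.linearIndependent_iff.1 b.linearIndependent v h2 j)
  let φ : (ConjClasses G → N) →ₗ[N] N := b.constr N fun i => L (β i)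
  have hφ (x : RepRing G N) : L x = φ (character x) := by
    let v : ι → N := fun i => b.repr (character x) i
    -- Cramer's rule: det(B) times the coordinates of a character in the basis are integers, so
    -- det(B) • x has the same character as an integral combination of the β i, to which additivity
    -- of `L` applies.
    let m : ι → ℤ := (fun j => k x (β j)) ᵥ* B.adjugate
    have hs : v ᵥ* BN = fun j => (k x (β j) : N) := by
      funext j
      rw [← hk, hβ]
      conv_rhs => rw [← b.sum_repr (character x), map_sum, LinearMap.sum_apply]
      simp [Matrix.vecMul, dotProduct, hBN, v]
    have hm (i : ι) : (m i : N) = (B.det : N) * v i := by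
      have h1 : (fun j => (k x (β j) : N)) ᵥ* BN.adjugate = (B.det : N) • v := by
        rw [← hs, Matrix.vecMul_vecMul, Matrix.mul_adjugate, hdetN, Matrix.vecMul_smul,
          Matrix.vecMul_one]
      have h2 := congrFun h1 i
      rw [Pi.smul_apply, smul_eq_mul] at h2
      rw [← h2]
      have h3 : BN.adjugate = B.adjugate.map (Int.castRingHom N) :=
        ((Int.castRingHom N).map_adjugate B).symm
      simp [m, h3, Matrix.vecMul, dotProduct]
    have hx : character (B.det • x) = character (∑ i, m i • β i) := by
      rw [map_zsmul, map_sum]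
      simp only [map_zsmul, hβ, ← Int.cast_smul_eq_zsmul N, hm, mul_smul]
      rw [← Finset.smul_sum, b.sum_repr]
    have := hL _ _ hx
    rw [map_zsmul, map_sum] at this
    simp only [map_zsmul, ← Int.cast_smul_eq_zsmul N, hm, smul_eq_mul, mul_assoc] at this
    rw [← Finset.mul_sum] at this
    rw [mul_left_cancel₀ hdet this]
    simp [φ, v, Module.Basis.constr_apply_fintype, Module.Basis.equivFun_apply]
  refine ⟨fun c => φ (Pi.single c 1), fun x => ?_⟩
  rw [hφ]
  have : character x = ∑ c, character x c • (Pi.single c 1 : ConjClasses G → N) := by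
    funext d
    simp [Finset.sum_apply, Pi.single_apply]
  conv_lhs => rw [this, map_sum]
  simp [mul_comm]

end Pairing

/-! ### Det depends only on characters -/

section Determinant

variable {G N : Type*} [Group G] [Field N]

theorem trace_evalRep_eq_of_character {R : Type*} [CommRing R] (f : R →+* N)
    {S T : MatRep G N} (h : character (repClass S) = character (repClass T))
    (u : MonoidAlgebra R G) : (evalRep f S.rho u).trace = (evalRep f T.rho u).trace := by
  induction u using MonoidAlgebra.induction_linear with
  | zero => simp
  | add a b ha hb => rw [map_add, Matrix.trace_add, ha, hb, map_add, Matrix.trace_add]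
  | single g r =>
    rw [evalRep_single, evalRep_single, Matrix.trace_smul, Matrix.trace_smul,
      ← character_repClass, ← character_repClass, h]

/-- The determinant of 1 - X is the value at 1 of the reversed characteristic polynomial of X, which
is determined by the traces of powers. For X the image of 1 - u these traces are linear in the
character. -/
theorem det_evalRep_eq_of_character [CharZero N] {R : Type*} [CommRing R] (f : R →+* N)
    {S T : MatRep G N} (h : character (repClass S) = character (repClass T))
    (u : MonoidAlgebra R G) : (evalRep f S.rho u).det = (evalRep f T.rho u).det := by
  have e (T : MatRep G N) : evalRep f T.rho u = 1 - evalRep f T.rho (1 - u) := by simp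
  rw [e S, e T, ← Matrix.eval_one_charpolyRev, ← Matrix.eval_one_charpolyRev]
  refine congrArg _ (Matrix.charpolyRev_eq_of_trace_pow _ _ fun k _ => ?_)
  rw [← map_pow, ← map_pow, trace_evalRep_eq_of_character f h]

theorem MatRep.exists_intertwining_ofHom {n : Type*} [Fintype n] [DecidableEq n]
    (ρ : G →* Matrix n n N) :
    ∃ (P : Matrix (Fin (MatRep.ofHom ρ).dim) n N) (Q : Matrix n (Fin (MatRep.ofHom ρ).dim) N),
      P * Q = 1 ∧ Q * P = 1 ∧ ∀ g, ((MatRep.ofHom ρ).rho g).1 * P = P * ρ g := by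
  let e := Fintype.equivFin n
  have key : ∃ (P : Matrix (Fin (Fintype.card n)) n N) (Q : Matrix n (Fin (Fintype.card n)) N),
      P * Q = 1 ∧ Q * P = 1 ∧ ∀ g, Matrix.reindex e e (ρ g) * P = P * ρ g := by
    refine ⟨Matrix.submatrix 1 e.symm id, Matrix.submatrix 1 id e.symm, ?_, ?_, fun g => ?_⟩
    · ext i j
      simp [Matrix.mul_apply, Matrix.one_apply]
    · ext i j
      rw [Matrix.submatrix_mul_equiv]
      simp only [Matrix.mul_one, Matrix.submatrix_apply]
      rfl
    · ext i j
      have := Matrix.submatrix_mul_equiv (ρ g) (1 : Matrix n n N) e.symm e.symm id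
      rw [Matrix.reindex_apply, this]
      simp [Matrix.mul_apply, Matrix.one_apply]
  exact key

/-- The direct sum of two representations. -/
def MatRep.sum (S T : MatRep G N) : MatRep G N :=
  MatRep.ofHom (n := Fin S.dim ⊕ Fin T.dim)
    { toFun := fun g => Matrix.fromBlocks (S.rho g).1 0 0 (T.rho g).1
      map_one' := by simp
      map_mul' := fun g h => by simp [Matrix.fromBlocks_multiply] }

theorem MatRep.sum_isDirectSum (S T : MatRep G N) : IsDirectSum (S.sum T) S T := by
  obtain ⟨P, Q, h1, h2, h3⟩ := MatRep.exists_intertwining_ofHom (N := N)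
    (n := Fin S.dim ⊕ Fin T.dim) (G := G)
    { toFun := fun g => Matrix.fromBlocks (S.rho g).1 0 0 (T.rho g).1
      map_one' := by simp
      map_mul' := fun g h => by simp [Matrix.fromBlocks_multiply] }
  exact ⟨P, Q, h1, h2, h3⟩

theorem repClass_sum (S T : MatRep G N) : repClass (S.sum T) = repClass S + repClass T := by
  rw [← sub_eq_zero]
  exact (QuotientAddGroup.eq_zero_iff _).2
    (AddSubgroup.subset_closure ⟨_, _, _, MatRep.sum_isDirectSum S T, rfl⟩)

theorem repClass_zero : repClass (MatRep.ofHom (1 : G →* Matrix (Fin 0) (Fin 0) N)) = 0 := by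
  have : repClass (MatRep.ofHom (1 : G →* Matrix (Fin 0) (Fin 0) N)) =
      repClass (MatRep.ofHom (1 : G →* Matrix (Fin 0) (Fin 0) N)) +
      repClass (MatRep.ofHom (1 : G →* Matrix (Fin 0) (Fin 0) N)) := by
    rw [← sub_eq_zero]
    refine (QuotientAddGroup.eq_zero_iff _).2 (AddSubgroup.subset_closure ⟨_, _, _, ?_, rfl⟩)
    have : IsEmpty (Fin (MatRep.ofHom (1 : G →* Matrix (Fin 0) (Fin 0) N)).dim) := by
      change IsEmpty (Fin (Fintype.card (Fin 0)))
      rw [Fintype.card_fin]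
      infer_instance
    exact ⟨0, 0, Subsingleton.elim _ _, Subsingleton.elim _ _, fun g => Subsingleton.elim _ _⟩
  simpa using this

theorem exists_eq_repClass_sub (x : RepRing G N) :
    ∃ S T : MatRep G N, x = repClass S - repClass T := by
  induction x using repRing_induction with
  | of T => exact ⟨T, _, by rw [repClass_zero, sub_zero]⟩
  | add x y hx hy =>
    obtain ⟨S, T, rfl⟩ := hx
    obtain ⟨S', T', rfl⟩ := hy
    exact ⟨S.sum S', T.sum T', by rw [repClass_sum, repClass_sum]; abel⟩
  | zero => exact ⟨_, _, (sub_self (repClass (MatRep.ofHom (1 : G →* Matrix (Fin 0) (Fin 0) N)))).symm⟩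
  | neg x hx =>
    obtain ⟨S, T, rfl⟩ := hx
    exact ⟨T, S, by abel⟩

end Determinant

/-! ### The values of Det in N -/

section DetValue

variable {G M N : Type*} [Group G] [Finite G] [Field M] [NormedField N] [IsUltrametricDist N]
  [Algebra M N]

/-- The value of `Det u` at an element of the representation ring, in `N`. -/
def detValue (u : (MonoidAlgebra (valRing M N) G)ˣ) (x : RepRing G N) : N :=
  ((detFun u x).toMul : valRing N N)

@[simp] theorem detValue_repClass (u : (MonoidAlgebra (valRing M N) G)ˣ) (T : MatRep G N) :
    detValue u (repClass T) = (evalRep (valRingToN M N) T.rho u.1).det := by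
  rw [detValue, detFun, repLift_repClass]
  rfl

@[simp] theorem detValue_add (u : (MonoidAlgebra (valRing M N) G)ˣ) (x y : RepRing G N) :
    detValue u (x + y) = detValue u x * detValue u y := by
  simp [detValue]

@[simp] theorem detValue_zero (u : (MonoidAlgebra (valRing M N) G)ˣ) :
    detValue u (0 : RepRing G N) = 1 := by
  simp [detValue]

theorem detValue_ne_zero (u : (MonoidAlgebra (valRing M N) G)ˣ) (x : RepRing G N) :
    detValue u x ≠ 0 := by
  intro h
  have := detValue_add u x (-x)
  rw [h, add_neg_cancel, detValue_zero, zero_mul] at this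
  exact one_ne_zero this

@[simp] theorem detValue_neg (u : (MonoidAlgebra (valRing M N) G)ˣ) (x : RepRing G N) :
    detValue u (-x) = (detValue u x)⁻¹ := by
  refine eq_inv_of_mul_eq_one_left ?_
  rw [← detValue_add, neg_add_cancel, detValue_zero]

@[simp] theorem detValue_mul (u v : (MonoidAlgebra (valRing M N) G)ˣ) (x : RepRing G N) :
    detValue (u * v) x = detValue u x * detValue v x := by
  simp [detValue, detFun_mul]

@[simp] theorem detValue_one (x : RepRing G N) :
    detValue (1 : (MonoidAlgebra (valRing M N) G)ˣ) x = 1 := by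
  have := detValue_mul (1 : (MonoidAlgebra (valRing M N) G)ˣ) 1 x
  rw [one_mul] at this
  exact mul_eq_left₀ (detValue_ne_zero _ _) |>.1 this.symm

/-- Moving negative parts to the other side reduces to genuine representations. Since `adams` is
specified only through its character, this is what makes Det at an Adams operation computable,
without injectivity of `character`. -/
theorem detValue_eq_of_character [CharZero N] (u : (MonoidAlgebra (valRing M N) G)ˣ)
    {x y : RepRing G N} (h : character x = character y) : detValue u x = detValue u y := by
  obtain ⟨S, T, rfl⟩ := exists_eq_repClass_sub x
  obtain ⟨S', T', rfl⟩ := exists_eq_repClass_sub y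
  have h1 : character (repClass (S.sum T')) = character (repClass (S'.sum T)) := by
    rw [map_sub, map_sub, sub_eq_sub_iff_add_eq_add] at h
    rw [repClass_sum, repClass_sum, map_add, map_add, h]
  have h2 : detValue u (repClass (S.sum T')) = detValue u (repClass (S'.sum T)) := by
    rw [detValue_repClass, detValue_repClass, det_evalRep_eq_of_character _ h1]
  rw [repClass_sum, repClass_sum, detValue_add, detValue_add] at h2
  rw [sub_eq_add_neg, sub_eq_add_neg, detValue_add, detValue_add, detValue_neg, detValue_neg,
    ← div_eq_mul_inv, ← div_eq_mul_inv,
    div_eq_div_iff (detValue_ne_zero _ _) (detValue_ne_zero _ _), h2]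

theorem Det_eq_Det_iff (u v : (MonoidAlgebra (valRing M N) G)ˣ) :
    Det G M N u = Det G M N v ↔ ∀ x, detValue u x = detValue v x := by
  constructor
  · intro h x
    have := DFunLike.congr_fun (congrArg Subtype.val h) (Multiplicative.ofAdd x)
    exact congrArg (fun y : (valRing N N)ˣ => (y : valRing N N).1) this
  · intro h
    refine Subtype.ext (MonoidHom.ext fun x => Units.ext (Subtype.ext ?_))
    exact h x.toAdd

end DetValue

end DetDescent

namespace DetDescent

open Filter Topology

/-! ### Norms, residue fields and principal units -/

section Padic

variable (p : ℕ) [hp : Fact p.Prime] {N : Type*} [NormedField N] [NormedAlgebra ℚ_[p] N]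

theorem norm_natCast_eq_padic (n : ℕ) : ‖(n : N)‖ = ‖(n : ℚ_[p])‖ := by
  rw [← norm_algebraMap' N (n : ℚ_[p]), map_natCast]

theorem norm_prime_eq : ‖(p : N)‖ = (p : ℝ)⁻¹ := by
  rw [norm_natCast_eq_padic p, Padic.norm_p]

theorem norm_prime_lt_one : ‖(p : N)‖ < 1 := by
  rw [norm_natCast_eq_padic p]
  exact Padic.norm_p_lt_one

include p in
theorem charZero_of_normedAlgebra_padic : CharZero N :=
  charZero_of_injective_algebraMap (algebraMap ℚ_[p] N).injective

-- Only the p-part of n affects the norm. The resulting linear growth of 1/n bounds the terms of the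
-- logarithm series.
include p in
theorem inv_norm_natCast_le (n : ℕ) (hn : n ≠ 0) : ‖(n : N)‖⁻¹ ≤ n := by
  obtain ⟨e, m, hm, rfl⟩ := Nat.exists_eq_pow_mul_and_not_dvd hn p hp.1.ne_one
  have h1 : ‖(m : N)‖ = 1 := by
    rw [norm_natCast_eq_padic p, Padic.norm_natCast_eq_one_iff]
    exact (Nat.Prime.coprime_iff_not_dvd hp.1).2 hm
  have hm1 : 1 ≤ m := Nat.pos_of_ne_zero (by rintro rfl; simp at hm)
  push_cast
  rw [norm_mul, norm_pow, h1, mul_one, norm_prime_eq p, ← inv_pow, inv_inv]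
  exact le_mul_of_one_le_right (by positivity) (by exact_mod_cast hm1)

variable [IsUltrametricDist N]

theorem mem_maximalIdeal_valRing {L N : Type*} [Field L] [NormedField N] [IsUltrametricDist N]
    [Algebra L N] (x : valRing L N) :
    x ∈ IsLocalRing.maximalIdeal (valRing L N) ↔ ‖algebraMap L N x‖ < 1 := by
  rw [IsLocalRing.mem_maximalIdeal, mem_nonunits_iff]
  have hx := (mem_valRing (N := N) x.1).1 x.2
  constructor
  · intro h
    refine lt_of_le_of_ne hx fun h1 => h ?_
    have hx0 : x.1 ≠ 0 := by
      intro h0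
      rw [h0] at h1
      simp at h1
    have hinv : x.1⁻¹ ∈ valRing L N := by
      rw [mem_valRing, map_inv₀, norm_inv, h1, inv_one]
    exact IsUnit.of_mul_eq_one (⟨_, hinv⟩ : valRing L N) (Subtype.ext (mul_inv_cancel₀ hx0))
  · rintro h ⟨u, rfl⟩
    have h1 : ‖algebraMap L N u.1.1‖ * ‖algebraMap L N (u⁻¹).1.1‖ = 1 := by
      rw [← norm_mul, ← map_mul]
      have : u.1.1 * (u⁻¹).1.1 = 1 := congrArg Subtype.val u.mul_inv
      rw [this, map_one, norm_one]
    have h2 := (mem_valRing (N := N) (u⁻¹).1.1).1 (u⁻¹).1.2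
    nlinarith [norm_nonneg (algebraMap L N u.1.1), norm_nonneg (algebraMap L N (u⁻¹).1.1)]

theorem residue_eq_iff {L N : Type*} [Field L] [NormedField N] [IsUltrametricDist N]
    [Algebra L N] (x y : valRing L N) :
    IsLocalRing.residue (valRing L N) x = IsLocalRing.residue (valRing L N) y ↔
      ‖algebraMap L N x - algebraMap L N y‖ < 1 := by
  rw [← sub_eq_zero, ← map_sub, IsLocalRing.residue_eq_zero_iff, mem_maximalIdeal_valRing,
    ← map_sub]
  rfl

theorem charP_residueField (L : Type*) [Field L] [Algebra L N] :
    CharP (IsLocalRing.ResidueField (valRing L N)) p := by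
  rw [CharP.charP_iff_prime_eq_zero hp.1]
  have := (residue_eq_iff (N := N) (p : valRing L N) 0).2 (by
    have := norm_prime_lt_one p (N := N)
    simpa using this)
  simpa using this

/-- Frobenius is injective on the residue field, which is a field of characteristic p. -/
theorem norm_sub_lt_one_of_pow {a b : N} (ha : ‖a‖ ≤ 1) (hb : ‖b‖ ≤ 1) (k : ℕ)
    (h : ‖a ^ p ^ k - b ^ p ^ k‖ < 1) : ‖a - b‖ < 1 := by
  have := charP_residueField p (N := N) N
  let x : valRing N N := ⟨a, (mem_valRing a).2 ha⟩
  let y : valRing N N := ⟨b, (mem_valRing b).2 hb⟩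
  refine (residue_eq_iff x y).1 ?_
  have h1 := (residue_eq_iff (x ^ p ^ k) (y ^ p ^ k)).2 h
  have := Fact.mk hp.1
  rw [map_pow, map_pow, ← sub_eq_zero, ← sub_pow_char_pow] at h1
  exact sub_eq_zero.1 (eq_zero_of_pow_eq_zero h1)

theorem norm_root_sub_one_lt {η : N} {k : ℕ} (h : η ^ p ^ k = 1) : ‖η - 1‖ < 1 := by
  have h1 : ‖η‖ = 1 := by
    have := congrArg norm h
    rw [norm_pow, norm_one] at this
    exact (pow_eq_one_iff_of_nonneg (norm_nonneg _) (pow_ne_zero _ hp.1.ne_zero)).1 this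
  refine norm_sub_lt_one_of_pow p h1.le norm_one.le k ?_
  rw [h, one_pow, sub_self, norm_zero]
  exact one_pos

theorem norm_eq_one_of_norm_sub_one_lt {x : N} (h : ‖x - 1‖ < 1) : ‖x‖ = 1 := by
  have := IsUltrametricDist.norm_add_eq_max_of_norm_ne_norm (x := x - 1) (y := 1)
    (by rw [norm_one]; exact h.ne)
  rwa [sub_add_cancel, norm_one, max_eq_right h.le] at this

theorem norm_mul_sub_one_lt {x y : N} (hx : ‖x - 1‖ < 1) (hy : ‖y - 1‖ < 1) :
    ‖x * y - 1‖ < 1 := by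
  have : x * y - 1 = x * (y - 1) + (x - 1) := by ring
  rw [this]
  refine (IsUltrametricDist.norm_add_le_max _ _).trans_lt (max_lt ?_ hx)
  rwa [norm_mul, norm_eq_one_of_norm_sub_one_lt hx, one_mul]

theorem norm_inv_sub_one_lt {x : N} (hx : ‖x - 1‖ < 1) : ‖x⁻¹ - 1‖ < 1 := by
  have h1 := norm_eq_one_of_norm_sub_one_lt hx
  have h0 : x ≠ 0 := by rintro rfl; simp at h1
  have : x⁻¹ - 1 = -(x⁻¹ * (x - 1)) := by field_simp; ring
  rw [this, norm_neg, norm_mul, norm_inv, h1, inv_one, one_mul]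
  exact hx

/-! ### The p-adic logarithm and its kernel -/

section Log

/-- The `p`-adic logarithm is the limit of `(y ^ p ^ k - 1) / p ^ k`. -/
theorem tendsto_padicLog [CompleteSpace N] {y : N} (hy : ‖y - 1‖ < 1) :
    Tendsto (fun k : ℕ => (y ^ p ^ k - 1) / (p : N) ^ k) atTop (𝓝 (padicLog y)) := by
  have := charZero_of_normedAlgebra_padic p (N := N)
  have hp0 : (p : N) ≠ 0 := Nat.cast_ne_zero.2 hp.1.ne_zero
  obtain ⟨x, rfl⟩ : ∃ x, y = x + 1 := ⟨y - 1, by ring⟩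
  rw [add_sub_cancel_right] at hy
  -- Pulling p^k out of the binomial coefficient gives (y^(p^k) - 1)/p^k the coefficients C(p^k - 1,
  -- j)/(j + 1), which tend p-adically to those of the logarithm.
  have hchoose (k j : ℕ) : ((p ^ k).choose (j + 1) : N) =
      (p : N) ^ k * (((p ^ k - 1).choose j : N) / (j + 1 : N)) := by
    have hk : p ^ k - 1 + 1 = p ^ k := Nat.sub_add_cancel (Nat.one_le_pow _ _ hp.1.pos)
    have h := Nat.add_one_mul_choose_eq (p ^ k - 1) j
    rw [hk] at h
    have h2 : (p : N) ^ k * ((p ^ k - 1).choose j : N) = ((p ^ k).choose (j + 1) : N) * (j + 1) := by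
      exact_mod_cast h
    have : (j + 1 : N) ≠ 0 := Nat.cast_add_one_ne_zero j
    field_simp
    linear_combination -h2
  have hexp (k : ℕ) : ((x + 1) ^ p ^ k - 1) / (p : N) ^ k =
      ∑' j : ℕ, ((p ^ k - 1).choose j : N) * x ^ (j + 1) / (j + 1 : N) := by
    rw [tsum_eq_sum (s := Finset.range (p ^ k)), add_pow, Finset.sum_range_succ']
    · simp only [one_pow, mul_one, pow_zero, Nat.choose_zero_right, Nat.cast_one,
        add_sub_cancel_right]
      rw [Finset.sum_div]
      refine Finset.sum_congr rfl fun j _ => ?_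
      rw [hchoose]
      field_simp
    · intro j hj
      have hj : p ^ k ≤ j := by simpa using hj
      have hpos : 0 < p ^ k := pow_pos hp.1.pos k
      rw [Nat.choose_eq_zero_of_lt (by omega)]
      simp
  -- By Pascal's rule C(p^k - 1, j + 1) = C(p^k, j + 1) - C(p^k - 1, j), where the first term is p^k
  -- times a convergent sequence.
  have hlim (j : ℕ) : Tendsto (fun k : ℕ => ((p ^ k - 1).choose j : N)) atTop (𝓝 ((-1) ^ j)) := by
    induction j with
    | zero => simp
    | succ j ih =>
      have h1 (k : ℕ) : ((p ^ k - 1).choose (j + 1) : N) =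
          (p : N) ^ k * (((p ^ k - 1).choose j : N) / (j + 1 : N)) - ((p ^ k - 1).choose j : N) := by
        rw [← hchoose]
        have hk : p ^ k - 1 + 1 = p ^ k := Nat.sub_add_cancel (Nat.one_le_pow _ _ hp.1.pos)
        have := Nat.choose_succ_succ (p ^ k - 1) j
        rw [Nat.succ_eq_add_one, hk] at this
        rw [this]
        push_cast
        ring
      have h2 := ((tendsto_pow_atTop_nhds_zero_of_norm_lt_one (norm_prime_lt_one p (N := N))).mul
        (ih.div_const (j + 1 : N))).sub ih
      simp only [zero_mul, zero_sub] at h2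
      rw [pow_succ, mul_neg_one]
      exact h2.congr fun k => (h1 k).symm
  simp only [hexp]
  have hpl : padicLog (x + 1) = ∑' j : ℕ, (-1) ^ j * x ^ (j + 1) / (j + 1 : N) := by
    simp [padicLog]
  rw [hpl]
  refine tendsto_tsum_of_dominated_convergence
    (bound := fun j : ℕ => ((j + 1 : ℕ) : ℝ) ^ 1 * ‖x‖ ^ (j + 1)) ?_
    (fun j => ((hlim j).mul_const _).div_const _) (Eventually.of_forall fun k j => ?_)
  · exact (summable_nat_add_iff 1).2
      (summable_pow_mul_geometric_of_norm_lt_one 1 (r := ‖x‖) (by rwa [norm_norm]))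
  · rw [mul_div_assoc, norm_mul, norm_div, norm_pow, pow_one, div_eq_mul_inv]
    have h1 : ‖((p ^ k - 1).choose j : N)‖ ≤ 1 := IsUltrametricDist.norm_natCast_le_one N _
    have h2 := inv_norm_natCast_le p (N := N) (j + 1) j.succ_ne_zero
    push_cast at h2 ⊢
    calc _ ≤ 1 * (‖x‖ ^ (j + 1) * (j + 1 : ℝ)) := by gcongr
      _ = _ := by ring

theorem tendsto_pow_one [CompleteSpace N] {y : N} (hy : ‖y - 1‖ < 1) :
    Tendsto (fun k : ℕ => y ^ p ^ k) atTop (𝓝 1) := by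
  have := charZero_of_normedAlgebra_padic p (N := N)
  have hp0 : (p : N) ≠ 0 := Nat.cast_ne_zero.2 hp.1.ne_zero
  have h := ((tendsto_pow_atTop_nhds_zero_of_norm_lt_one (norm_prime_lt_one p (N := N))).mul
    (tendsto_padicLog p hy)).add_const 1
  rw [zero_mul, zero_add] at h
  refine h.congr fun k => ?_
  field_simp
  ring

-- With P = p^k, one has (xy)^P - 1 = x^P (y^P - 1) + (x^P - 1) and x^P → 1; divide by P and pass to
-- the limit.
include p in
theorem padicLog_mul [CompleteSpace N] {x y : N} (hx : ‖x - 1‖ < 1) (hy : ‖y - 1‖ < 1) :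
    padicLog (x * y) = padicLog x + padicLog y := by
  refine tendsto_nhds_unique (tendsto_padicLog p (norm_mul_sub_one_lt hx hy)) ?_
  have h := ((tendsto_pow_one p hx).mul (tendsto_padicLog p hy)).add (tendsto_padicLog p hx)
  rw [one_mul, add_comm (padicLog y)] at h
  refine h.congr fun k => ?_
  rw [mul_pow]
  ring

theorem padicLog_one {N : Type*} [NormedField N] : padicLog (1 : N) = 0 := by
  simp [padicLog]

include p in
theorem padicLog_pow [CompleteSpace N] {x : N} (hx : ‖x - 1‖ < 1) (n : ℕ) :
    ‖x ^ n - 1‖ < 1 ∧ padicLog (x ^ n) = n * padicLog x := by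
  induction n with
  | zero => simp [padicLog_one]
  | succ n ih =>
    rw [pow_succ]
    refine ⟨norm_mul_sub_one_lt ih.1 hx, ?_⟩
    rw [padicLog_mul p ih.1 hx, ih.2]
    push_cast
    ring

include p in
theorem padicLog_map [CompleteSpace N] (σ : N →+* N) (hσ : Continuous σ) {x : N}
    (hx : ‖x - 1‖ < 1) (hσx : ‖σ x - 1‖ < 1) : padicLog (σ x) = σ (padicLog x) := by
  refine tendsto_nhds_unique (tendsto_padicLog p hσx) ?_
  refine ((hσ.tendsto _).comp (tendsto_padicLog p hx)).congr fun k => ?_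
  simp

/-- The linear term p(y - 1) of y^p - 1 strictly dominates the remainder, a multiple of (y - 1)^2 by
an integral element. -/
theorem norm_pow_prime_sub_one {y : N} (hy : ‖y - 1‖ < ‖(p : N)‖) :
    ‖y ^ p - 1‖ = ‖(p : N)‖ * ‖y - 1‖ := by
  have hp1 := norm_prime_lt_one p (N := N)
  rcases eq_or_ne y 1 with rfl | hne
  · simp
  have hpos : 0 < ‖y - 1‖ := norm_pos_iff.2 (sub_ne_zero.2 hne)
  let x : valRing N N := ⟨y - 1, (mem_valRing _).2 (hy.trans hp1).le⟩
  obtain ⟨k, hk⟩ := Polynomial.powAddExpansion 1 x p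
  have hk' : y ^ p - 1 = k.1 * (y - 1) ^ 2 + p * (y - 1) := by
    have := congrArg Subtype.val hk
    simp [x] at this
    rw [this]
    ring
  have hk1 : ‖k.1‖ ≤ 1 := (mem_valRing (N := N) k.1).1 k.2
  rw [hk', ← norm_mul]
  have hlt : ‖k.1 * (y - 1) ^ 2‖ < ‖(p : N) * (y - 1)‖ := by
    rw [norm_mul, norm_mul, norm_pow]
    calc ‖k.1‖ * ‖y - 1‖ ^ 2 ≤ 1 * ‖y - 1‖ ^ 2 := by gcongr
      _ = ‖y - 1‖ * ‖y - 1‖ := by ring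
      _ < _ := by gcongr
  rw [IsUltrametricDist.norm_add_eq_max_of_norm_ne_norm hlt.ne, max_eq_right hlt.le]

/-- Near 1 each p-th power scales the distance to 1 by exactly |p|, so the quotients converging to
the logarithm all have the same norm. -/
theorem norm_padicLog_of_small [CompleteSpace N] {y : N} (hy : ‖y - 1‖ < ‖(p : N)‖) :
    ‖padicLog y‖ = ‖y - 1‖ := by
  have := charZero_of_normedAlgebra_padic p (N := N)
  have hp0 : (p : N) ≠ 0 := Nat.cast_ne_zero.2 hp.1.ne_zero
  have hp1 := norm_prime_lt_one p (N := N)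
  have h (k : ℕ) : ‖y ^ p ^ k - 1‖ = ‖(p : N)‖ ^ k * ‖y - 1‖ := by
    induction k with
    | zero => simp
    | succ k ih =>
      rw [pow_succ, pow_mul, norm_pow_prime_sub_one p, ih]
      · ring
      · rw [ih]
        refine lt_of_le_of_lt (mul_le_of_le_one_left (norm_nonneg _) ?_) hy
        exact pow_le_one₀ (norm_nonneg _) hp1.le
  refine tendsto_nhds_unique (tendsto_padicLog p (hy.trans hp1)).norm ?_
  refine tendsto_const_nhds.congr fun k => ?_
  rw [norm_div, norm_pow, h]
  field_simp

/-- Some y^(p^k) enters the region where the logarithm preserves the distance to 1, and its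
logarithm is still 0. -/
theorem exists_pow_eq_one_of_padicLog_eq_zero [CompleteSpace N] {y : N} (hy : ‖y - 1‖ < 1)
    (h : padicLog y = 0) : ∃ k, y ^ p ^ k = 1 := by
  have := charZero_of_normedAlgebra_padic p (N := N)
  have hp0 : (p : N) ≠ 0 := Nat.cast_ne_zero.2 hp.1.ne_zero
  obtain ⟨k, hk⟩ := (((tendsto_pow_one p hy).sub_const 1).norm.eventually_lt_const
    (u := ‖(p : N)‖) (by simpa using hp0)).exists
  refine ⟨k, ?_⟩
  have h1 := norm_padicLog_of_small p hk
  rw [(padicLog_pow p hy _).2, h, mul_zero, norm_zero, eq_comm, norm_eq_zero, sub_eq_zero] at h1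
  exact h1

end Log

/-! ### Roots of unity of p-power order near 1 -/

section RootsOfUnity

variable {ζ : N} (hζ : IsPrimitiveRoot ζ p)
include hζ

-- Each primitive p-th root is a power of any other, so each difference from 1 is an integral
-- geometric sum times the other.
omit [NormedAlgebra ℚ_[p] N] in
theorem norm_primitiveRoot_sub_one_eq {ω : N} (hω : ω ^ p = 1) (hω1 : ω ≠ 1) :
    ‖ω - 1‖ = ‖ζ - 1‖ := by
  have key {a b : N} (ha : IsPrimitiveRoot a p) (hb : b ^ p = 1) : ‖b - 1‖ ≤ ‖a - 1‖ := by
    obtain ⟨i, -, rfl⟩ := ha.eq_pow_of_pow_eq_one hb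
    have han : ‖a‖ = 1 := by
      have := congrArg norm ha.pow_eq_one
      rw [norm_pow, norm_one] at this
      exact (pow_eq_one_iff_of_nonneg (norm_nonneg _) hp.1.ne_zero).1 this
    rw [← geom_sum_mul, norm_mul]
    refine mul_le_of_le_one_left (norm_nonneg _) ?_
    refine IsUltrametricDist.norm_sum_le_of_forall_le_of_nonneg zero_le_one fun j _ => ?_
    rw [norm_pow, han, one_pow]
  have hω' : IsPrimitiveRoot ω p := by
    rw [← orderOf_eq_prime hω hω1]
    exact IsPrimitiveRoot.orderOf ω
  exact (key hζ hω).antisymm (key hω' hζ.pow_eq_one)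

omit [NormedAlgebra ℚ_[p] N] [IsUltrametricDist N] in
theorem norm_pow_sub_one_eq_prod (y : N) :
    ‖y ^ p - 1‖ = ∏ ω ∈ Polynomial.nthRootsFinset p (1 : N), ‖y - ω‖ := by
  have := hζ.pow_sub_pow_eq_prod_sub_mul y 1 hp.1.pos
  rw [one_pow] at this
  rw [this, norm_prod]
  simp

/-- If y is closer to 1 than ζ is, then |y - ω| = |ζ - 1| for every p-th root ω ≠ 1, so |y^p - 1| =
|y - 1| |ζ - 1|^(p-1). Thus y^p is still close to 1 and equals 1 by induction; the product formula
then gives y = 1. -/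
theorem eq_one_of_pow_eq_one_of_norm_lt {y : N} (hy : ‖y - 1‖ < ‖ζ - 1‖) {k : ℕ}
    (h : y ^ p ^ k = 1) : y = 1 := by
  classical
  have hδ1 : ‖ζ - 1‖ < 1 := norm_root_sub_one_lt p (k := 1) (by rw [pow_one, hζ.pow_eq_one])
  induction k generalizing y with
  | zero => simpa using h
  | succ k ih =>
    have h1 : 1 ∈ Polynomial.nthRootsFinset p (1 : N) := by
      rw [Polynomial.mem_nthRootsFinset hp.1.pos]
      simp
    have hω (ω : N) (h : ω ∈ Polynomial.nthRootsFinset p (1 : N)) (h1 : ω ≠ 1) :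
        ‖y - ω‖ = ‖ζ - 1‖ := by
      rw [Polynomial.mem_nthRootsFinset hp.1.pos] at h
      have e := norm_primitiveRoot_sub_one_eq p hζ h h1
      have : y - ω = (y - 1) + -(ω - 1) := by ring
      rw [this, IsUltrametricDist.norm_add_eq_max_of_norm_ne_norm
        (by rw [norm_neg, e]; exact hy.ne), norm_neg, e, max_eq_right hy.le]
    have hprod : ‖y ^ p - 1‖ = ‖y - 1‖ * ‖ζ - 1‖ ^ (p - 1) := by
      rw [norm_pow_sub_one_eq_prod p hζ, ← Finset.mul_prod_erase _ _ h1,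
        Finset.prod_congr rfl fun ω hω' =>
          hω ω (Finset.mem_of_mem_erase hω') (Finset.ne_of_mem_erase hω'),
        Finset.prod_const, Finset.card_erase_of_mem h1, hζ.card_nthRootsFinset]
    have hyp : y ^ p = 1 := by
      refine ih ?_ (by rw [← pow_mul, ← pow_succ', h])
      rw [hprod]
      exact (mul_le_of_le_one_right (norm_nonneg _) (pow_le_one₀ (norm_nonneg _) hδ1.le)).trans_lt hy
    rw [hyp, sub_self, norm_zero, eq_comm, mul_eq_zero] at hprod
    rcases hprod with h | h
    · exact sub_eq_zero.1 (norm_eq_zero.1 h)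
    · have h0 := eq_zero_of_pow_eq_zero h
      rw [h0] at hy
      exact absurd hy (not_lt.2 (norm_nonneg _))

/-- At distance at most |ζ - 1|, the product formula gives |y^p - 1| ≤ |ζ - 1|^p < |ζ - 1|, so the
preceding strict case applies to y^p. -/
theorem pow_prime_eq_one_of_norm_le {y : N} (hy : ‖y - 1‖ ≤ ‖ζ - 1‖) {k : ℕ}
    (h : y ^ p ^ k = 1) : y ^ p = 1 := by
  have hδ1 : ‖ζ - 1‖ < 1 := norm_root_sub_one_lt p (k := 1) (by rw [pow_one, hζ.pow_eq_one])
  have hδ0 : 0 < ‖ζ - 1‖ := norm_pos_iff.2 (sub_ne_zero.2 (hζ.ne_one hp.1.one_lt))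
  refine eq_one_of_pow_eq_one_of_norm_lt p hζ (k := k) ?_
    (by rw [← pow_mul, mul_comm, pow_mul, h, one_pow])
  have hω (ω : N) (h : ω ∈ Polynomial.nthRootsFinset p (1 : N)) : ‖y - ω‖ ≤ ‖ζ - 1‖ := by
    rw [Polynomial.mem_nthRootsFinset hp.1.pos] at h
    rcases eq_or_ne ω 1 with rfl | h1
    · exact hy
    have : y - ω = (y - 1) + -(ω - 1) := by ring
    rw [this]
    refine (IsUltrametricDist.norm_add_le_max _ _).trans (max_le hy ?_)
    rw [norm_neg, norm_primitiveRoot_sub_one_eq p hζ h h1]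
  rw [norm_pow_sub_one_eq_prod p hζ]
  refine (Finset.prod_le_prod (fun _ _ => norm_nonneg _) hω).trans_lt ?_
  rw [Finset.prod_const, hζ.card_nthRootsFinset]
  exact pow_lt_self_of_lt_one₀ hδ0 hδ1 hp.1.one_lt

/-- If `1 + (1 - ζ) t` is a root of unity of `p`-power order, then it is `ζ ^ e` where `e` is
determined by the residue class of `t`. -/
theorem exists_eq_pow_of_one_add {t : N} (ht : ‖t‖ ≤ 1) {k : ℕ}
    (h : (1 + (1 - ζ) * t) ^ p ^ k = 1) :
    ∃ e < p, 1 + (1 - ζ) * t = ζ ^ e ∧ ‖t + e‖ < 1 := by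
  have hζ1 : ζ - 1 ≠ 0 := sub_ne_zero.2 (hζ.ne_one hp.1.one_lt)
  have h1 : (1 + (1 - ζ) * t) ^ p = 1 := by
    refine pow_prime_eq_one_of_norm_le p hζ ?_ h
    rw [add_sub_cancel_left, norm_mul, norm_sub_rev]
    exact mul_le_of_le_one_right (norm_nonneg _) ht
  have := NeZero.mk hp.1.ne_zero
  obtain ⟨e, he, heq⟩ := hζ.eq_pow_of_pow_eq_one h1
  refine ⟨e, he, heq.symm, ?_⟩
  -- Dividing ζ^e - 1 by 1 - ζ shows t = -(1 + ζ + ⋯ + ζ^(e-1)), which is congruent to -e.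
  have h2 : t = -∑ i ∈ Finset.range e, ζ ^ i := by
    have h3 := geom_sum_mul ζ e
    rw [heq] at h3
    refine mul_left_cancel₀ hζ1 ?_
    linear_combination h3
  have h4 : t + e = ∑ i ∈ Finset.range e, -(ζ ^ i - 1) := by
    rw [h2]
    simp [neg_add_eq_sub]
  have h5 : ‖(1 : N) - ζ‖ < 1 := by
    rw [norm_sub_rev]
    exact norm_root_sub_one_lt p (k := 1) (by rw [pow_one, hζ.pow_eq_one])
  have h6 (i : ℕ) : ‖-(ζ ^ i - 1)‖ ≤ ‖1 - ζ‖ := by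
    rcases eq_or_ne (ζ ^ i) 1 with h | h
    · simp [h]
    · rw [norm_neg, norm_sub_rev 1, norm_primitiveRoot_sub_one_eq p hζ
        (by rw [← pow_mul, mul_comm, pow_mul, hζ.pow_eq_one, one_pow]) h]
  rw [h4]
  exact (IsUltrametricDist.norm_sum_le_of_forall_le_of_nonneg (norm_nonneg _)
    fun i _ => h6 i).trans_lt h5

end RootsOfUnity

end Padic

end DetDescent

namespace DetDescent

open MonoidAlgebra

/-! ### Group rings of p-groups: the augmentation ideal is nil modulo p -/

section GroupRing

/-- The augmentation of a group ring. -/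
def augmentation (R G : Type*) [CommRing R] [Group G] : MonoidAlgebra R G →ₐ[R] R :=
  MonoidAlgebra.lift R R G 1

theorem augmentation_single {R G : Type*} [CommRing R] [Group G] (g : G) (r : R) :
    augmentation R G (single g r) = r := by
  simp [augmentation]

theorem augmentation_mapDomain {R G H : Type*} [CommRing R] [Group G] [Group H] (φ : G →* H)
    (x : MonoidAlgebra R G) :
    augmentation R H (mapDomainRingHom R φ x) = augmentation R G x := by
  induction x using MonoidAlgebra.induction_linear with
  | zero => simp
  | add a b ha hb => simp only [map_add, ha, hb]
  | single g r => simp [augmentation_single]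

theorem mapDomainRingHom_surjective {R G H : Type*} [CommRing R] [Group G] [Group H] (φ : G →* H)
    (hφ : Function.Surjective φ) : Function.Surjective (mapDomainRingHom R φ) := by
  intro y
  induction y using MonoidAlgebra.induction_linear with
  | zero => exact ⟨0, map_zero _⟩
  | add a b ha hb =>
    obtain ⟨x, rfl⟩ := ha
    obtain ⟨x', rfl⟩ := hb
    exact ⟨x + x', map_add _ _ _⟩
  | single g r =>
    obtain ⟨g, rfl⟩ := hφ g
    exact ⟨single g r, by simp⟩

/-- The kernel of `R[G] → R[G/⟨z⟩]` for `z` central. -/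
theorem exists_eq_one_sub_mul {R G : Type*} [CommRing R] [Group G] [Finite G] (z : G)
    (hz : z ∈ Subgroup.center G) [(Subgroup.zpowers z).Normal] (x : MonoidAlgebra R G)
    (hx : mapDomainRingHom R (QuotientGroup.mk' (Subgroup.zpowers z)) x = 0) :
    ∃ y, x = (1 - single z 1) * y := by
  -- Any x differs from the lift of its image along coset representatives by a multiple of 1 - z,
  -- because each g is z^k times its representative.
  have key : ∃ y, x - mapDomain Quotient.out
      (mapDomainRingHom R (QuotientGroup.mk' (Subgroup.zpowers z)) x) =
        (1 - single z 1) * y := by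
    clear hx
    induction x using MonoidAlgebra.induction_linear with
    | zero => exact ⟨0, by simp⟩
    | add a b ha hb =>
      obtain ⟨y, hy⟩ := ha
      obtain ⟨y', hy'⟩ := hb
      exact ⟨y + y', by rw [mul_add, ← hy, ← hy', map_add, mapDomain_add]; abel⟩
    | single g r =>
      let o : G := Quotient.out (g : G ⧸ Subgroup.zpowers z)
      have ho : o⁻¹ * g ∈ Subgroup.zpowers z :=
        QuotientGroup.eq.1 (Quotient.out_eq (g : G ⧸ Subgroup.zpowers z))
      obtain ⟨k, hk⟩ := (mem_powers_iff_mem_zpowers).2 ho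
      have hg : g = z ^ k * o := by
        have h1 : g = o * z ^ k := by
          change z ^ k = _ at hk
          rw [hk]; group
        rw [h1]
        exact ((Subgroup.mem_center_iff.1 (pow_mem hz k)) o)
      have h2 := (Commute.one_right (single z (1 : R))).sub_dvd_pow_sub_pow k
      refine ⟨-((∑ i ∈ Finset.range k, (single z (1 : R)) ^ i) * single o r), ?_⟩
      have h3 := mul_geom_sum (single z (1 : R)) k
      have h4 : (1 - single z (1 : R)) * -((∑ i ∈ Finset.range k, (single z (1 : R)) ^ i) *
          single o r) = ((single z (1 : R) - 1) * (∑ i ∈ Finset.range k, (single z (1 : R)) ^ i)) *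
          single o r := by
        rw [mul_neg, ← neg_mul, neg_sub, mul_assoc]
      rw [h4, h3, sub_mul, one_mul, single_pow, single_mul_single, one_pow, one_mul, ← hg]
      simp [o]
  rw [hx, mapDomain_zero, sub_zero] at key
  exact key

theorem exists_sub_eq_natCast_mul_pow {A : Type*} [Ring A] (p : ℕ) {a b : A}
    (h : ∃ y, a - b = p * y) (n : ℕ) : ∃ y, a ^ n - b ^ n = p * y := by
  induction n with
  | zero => exact ⟨0, by simp⟩
  | succ n ih =>
    obtain ⟨y, hy⟩ := h
    obtain ⟨w, hw⟩ := ih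
    refine ⟨w * a + b ^ n * y, ?_⟩
    have : a ^ (n + 1) - b ^ (n + 1) = (a ^ n - b ^ n) * a + b ^ n * (a - b) := by
      rw [pow_succ, pow_succ]; noncomm_ring
    rw [this, hw, hy, mul_add, ← mul_assoc, ← mul_assoc, ← mul_assoc,
      (Nat.cast_commute p (b ^ n)).eq]

/-- Expand 1 = ((1 - z) + z)^p: up to a multiple of p the right side is (1 - z)^p + z^p = (1 - z)^p
+ 1. -/
theorem exists_one_sub_pow_eq_natCast_mul {A : Type*} [Ring A] {p : ℕ} (hp : p.Prime) {z : A}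
    (hz : z ^ p = 1) : ∃ s, (1 - z) ^ p = p * s := by
  obtain ⟨r, hr⟩ := ((Commute.one_left z).sub_left (Commute.refl z)).exists_add_pow_prime_eq hp
  rw [sub_add_cancel, one_pow, hz] at hr
  refine ⟨-((1 - z) * z * r), ?_⟩
  have : (1 - z) ^ p + (p : A) * (1 - z) * z * r = 0 := by
    rw [← sub_eq_zero.2 hr.symm]
    abel
  rw [eq_neg_of_add_eq_zero_left this, mul_neg, mul_assoc, mul_assoc, mul_assoc]

theorem exists_central_orderOf_eq_prime {p : ℕ} [hp : Fact p.Prime] {G : Type*} [Group G]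
    [Finite G] [Nontrivial G] (hG : IsPGroup p G) :
    ∃ z ∈ Subgroup.center G, orderOf z = p := by
  have := hG.center_nontrivial
  have hc : IsPGroup p (Subgroup.center G) := hG.to_subgroup _
  obtain ⟨k, hk, hk2⟩ := (IsPGroup.nontrivial_iff_card hc).1 this
  obtain ⟨z, hz⟩ := exists_prime_orderOf_dvd_card' (G := Subgroup.center G) p
    (by rw [hk2]; exact dvd_pow_self p hk.ne')
  exact ⟨z, z.2, by rw [← hz, Subgroup.orderOf_coe]⟩

theorem normal_zpowers_of_mem_center {G : Type*} [Group G] {z : G}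
    (hz : z ∈ Subgroup.center G) : (Subgroup.zpowers z).Normal := by
  refine ⟨fun x hx g => ?_⟩
  obtain ⟨k, rfl⟩ := hx
  have := Subgroup.mem_center_iff.1 (zpow_mem hz k) g
  change g * z ^ k * g⁻¹ ∈ _
  rw [this, mul_inv_cancel_right]
  exact ⟨k, rfl⟩

theorem card_quotient_zpowers_lt {G : Type*} [Group G] [Finite G] {z : G} (hz : z ≠ 1) :
    Nat.card (G ⧸ Subgroup.zpowers z) < Nat.card G := by
  have h := Subgroup.card_eq_card_quotient_mul_card_subgroup (Subgroup.zpowers z)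
  have h1 : 1 < Nat.card (Subgroup.zpowers z) := by
    rw [Nat.card_zpowers]
    have := orderOf_pos z
    have : orderOf z ≠ 1 := fun h => hz (orderOf_eq_one_iff.1 h)
    omega
  have : 0 < Nat.card (G ⧸ Subgroup.zpowers z) := Nat.card_pos
  rw [h]
  nlinarith

/-- The augmentation ideal of a finite `p`-group is nil modulo `p`. -/
theorem exists_pow_eq_natCast_mul (p : ℕ) [hp : Fact p.Prime] {R : Type*} [CommRing R]
    (G : Type*) [Group G] [Finite G] (hG : IsPGroup p G) (x : MonoidAlgebra R G)
    (hx : augmentation R G x = 0) : ∃ (j : ℕ) (y : MonoidAlgebra R G), x ^ p ^ j = p * y := by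
  induction h : Nat.card G using Nat.strong_induction_on generalizing G with
  | _ n ih =>
  rcases subsingleton_or_nontrivial G with hs | hs
  · refine ⟨0, 0, ?_⟩
    have h1 : x = single 1 (augmentation R G x) := by
      clear hx
      induction x using MonoidAlgebra.induction_linear with
      | zero => simp
      | add a b ha hb => rw [map_add, single_add, ← ha, ← hb]
      | single g r => rw [augmentation_single, Subsingleton.elim g 1]
    rw [h1, hx]
    simp
  · obtain ⟨z, hzc, hz⟩ := exists_central_orderOf_eq_prime hG
    have := normal_zpowers_of_mem_center hzc
    have hz1 : z ≠ 1 := fun h => hp.1.ne_one (by rw [← hz, h, orderOf_one])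
    -- Passing to G/⟨z⟩ gives x^(p^j) congruent modulo p to (1 - z)w. As z is central of order p,
    -- one more p-th power is divisible by p.
    obtain ⟨j, y, hy⟩ := ih _ (h ▸ card_quotient_zpowers_lt hz1) (G ⧸ Subgroup.zpowers z)
      (hG.to_quotient _) (mapDomainRingHom R (QuotientGroup.mk' (Subgroup.zpowers z)) x)
      (by rw [augmentation_mapDomain, hx]) rfl
    obtain ⟨y, rfl⟩ := mapDomainRingHom_surjective (R := R) _
      (QuotientGroup.mk'_surjective (Subgroup.zpowers z)) y
    obtain ⟨w, hw⟩ := exists_eq_one_sub_mul z hzc (x ^ p ^ j - (p : MonoidAlgebra R G) * y) (by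
      rw [map_sub, map_pow, hy, map_mul, map_natCast, sub_self])
    obtain ⟨v, hv⟩ := exists_sub_eq_natCast_mul_pow p (a := x ^ p ^ j)
      (b := (1 - single z 1) * w) ⟨y, by rw [← hw]; abel⟩ p
    have hcomm (u : MonoidAlgebra R G) : Commute (single z (1 : R)) u := by
      induction u using MonoidAlgebra.induction_linear with
      | zero => exact Commute.zero_right _
      | add a b ha hb => exact ha.add_right hb
      | single g r =>
        change _ * _ = _ * _
        rw [single_mul_single, single_mul_single, one_mul, mul_one,
          Subgroup.mem_center_iff.1 hzc g]
    obtain ⟨r, hr⟩ := exists_one_sub_pow_eq_natCast_mul hp.1 (z := single z (1 : R))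
      (by rw [single_pow, one_pow, ← hz, pow_orderOf_eq_one, one_def])
    refine ⟨j + 1, v + r * w ^ p, ?_⟩
    rw [pow_succ, pow_mul, sub_eq_iff_eq_add.1 hv, Commute.mul_pow
      ((Commute.one_left w).sub_left (hcomm w)), hr, mul_add, mul_assoc]

end GroupRing

/-! ### Units of O_M[G] and the residue of Det -/

section ValRing

variable (p : ℕ) [hp : Fact p.Prime] {G M N : Type*} [Group G] [Finite G]
  [Field M] [NormedField N] [NormedAlgebra ℚ_[p] N] [IsUltrametricDist N] [Algebra M N]

/-- Left multiplication by 1 + py is an endomorphism of a finite free O_M-module that reduces to the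
identity on the residue field, so its determinant is a unit. -/
theorem isUnit_one_add_natCast_mul (y : MonoidAlgebra (valRing M N) G) :
    IsUnit (1 + (p : MonoidAlgebra (valRing M N) G) * y) := by
  classical
  have := charP_residueField p (N := N) M
  let R := valRing M N
  let A := MonoidAlgebra R G
  let ℓ : A →ₐ[R] Module.End R A := Algebra.lmul R A
  have hunit : IsUnit (ℓ (1 + (p : A) * y)) := by
    rw [LinearMap.isUnit_iff_isUnit_det]
    let b := Module.Free.chooseBasis R A
    rw [← LinearMap.det_toMatrix b, ← IsLocalRing.residue_ne_zero_iff_isUnit, RingHom.map_det]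
    have : (IsLocalRing.residue R).mapMatrix (LinearMap.toMatrix b b (ℓ (1 + (p : A) * y))) =
        1 := by
      rw [map_add, map_one, map_mul, map_natCast, map_add, map_add, LinearMap.toMatrix_one, map_one,
        LinearMap.toMatrix_mul, map_mul]
      have h0 : (IsLocalRing.residue R).mapMatrix
          (LinearMap.toMatrix b b ((p : ℕ) : Module.End R A)) = 0 := by
        have : ((p : ℕ) : Module.End R A) = (p : R) • 1 := by
          rw [Nat.cast_smul_eq_nsmul, nsmul_one]
        rw [this, map_smul]
        ext i j
        simp
      rw [h0, zero_mul, add_zero]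
    rw [this, Matrix.det_one]
    exact one_ne_zero
  have hbij := (Module.End.isUnit_iff _).1 hunit
  obtain ⟨b, hb⟩ := hbij.2 1
  have hb' : (1 + (p : A) * y) * b = 1 := hb
  -- Surjectivity produced a right inverse; injectivity of left multiplication makes it two-sided.
  refine ⟨⟨1 + (p : A) * y, b, hb', hbij.1 ?_⟩, rfl⟩
  change (1 + (p : A) * y) * (b * (1 + (p : A) * y)) = (1 + (p : A) * y) * 1
  rw [← mul_assoc, hb', one_mul, mul_one]

-- Multiplying 1 + a by the finite geometric sum in -a yields 1 - (-a)^n, which lies in 1 + pA.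
omit [NormedAlgebra ℚ_[p] N] hp in
theorem isUnit_one_add_of_pow_eq {A : Type*} [Ring A]
    (hA : ∀ y : A, IsUnit (1 + (p : A) * y)) {a y : A} {n : ℕ} (hy : a ^ n = p * y) :
    IsUnit (1 + a) := by
  have h1 : (1 + a) * ∑ i ∈ Finset.range n, (-a) ^ i = 1 - (-a) ^ n := by
    have := mul_neg_geom_sum (-a) n
    rwa [sub_neg_eq_add] at this
  have h2 : ∃ y', 1 - (-a) ^ n = 1 + (p : A) * y' := by
    rcases neg_one_pow_eq_or A n with h | h
    · exact ⟨-y, by rw [neg_pow, h, hy, one_mul, mul_neg, sub_eq_add_neg]⟩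
    · exact ⟨y, by rw [neg_pow, h, hy, neg_one_mul, sub_neg_eq_add]⟩
  obtain ⟨y', hy'⟩ := h2
  have h3 : Commute (1 + a) (∑ i ∈ Finset.range n, (-a) ^ i) :=
    Commute.sum_right _ _ _ fun i _ =>
      ((Commute.one_left _).add_left ((Commute.refl a).neg_right)).pow_right i
  refine (h3.isUnit_mul_iff.1 ?_).1
  rw [h1, hy']
  exact hA y'

theorem isUnit_one_add_of_augmentation_eq_zero (hG : IsPGroup p G)
    (a : MonoidAlgebra (valRing M N) G) (ha : augmentation _ G a = 0) : IsUnit (1 + a) := by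
  obtain ⟨j, y, hy⟩ := exists_pow_eq_natCast_mul p G hG a ha
  exact isUnit_one_add_of_pow_eq p (isUnit_one_add_natCast_mul p) hy

omit [NormedAlgebra ℚ_[p] N] hp in
theorem norm_det_smul_one_add_sub_lt {N n : Type*} [NormedField N] [IsUltrametricDist N]
    [Fintype n] [DecidableEq n] {s : N} (hs : ‖s‖ ≤ 1) (E : Matrix n n N)
    (hE : ∀ i j, ‖E i j‖ < 1) : ‖(s • (1 : Matrix n n N) + E).det - s ^ Fintype.card n‖ < 1 := by
  let O := valRing N N
  let s' : O := ⟨s, (mem_valRing s).2 hs⟩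
  let E' : Matrix n n O := Matrix.of fun i j => ⟨E i j, (mem_valRing _).2 (hE i j).le⟩
  have h1 : IsLocalRing.residue O (s' • (1 : Matrix n n O) + E').det =
      IsLocalRing.residue O (s' ^ Fintype.card n) := by
    have h2 : (IsLocalRing.residue O).mapMatrix (s' • (1 : Matrix n n O) + E') =
        IsLocalRing.residue O s' • 1 := by
      ext i j
      have h3 : IsLocalRing.residue O (E' i j) = 0 := by
        rw [IsLocalRing.residue_eq_zero_iff, mem_maximalIdeal_valRing]
        exact hE i j
      by_cases hij : i = j
      · subst hij
        simp [h3]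
      · simp [h3, hij]
    rw [RingHom.map_det, h2, Matrix.det_smul, Matrix.det_one, mul_one, map_pow]
  have h2 := (residue_eq_iff _ _).1 h1
  have h3 : algebraMap N N (s' • (1 : Matrix n n O) + E').det.1 =
      (s • (1 : Matrix n n N) + E).det := by
    change O.subtype _ = _
    rw [RingHom.map_det]
    congr 1
    ext i j
    by_cases hij : i = j
    · subst hij
      simp [s', E']
    · simp [s', E', hij]
  rw [h3] at h2
  exact h2

/-- The determinant of `T(u)` is congruent to a power of the augmentation of `u`. -/
theorem norm_det_evalRep_sub_lt (hG : IsPGroup p G) (T : MatRep G N)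
    (u : MonoidAlgebra (valRing M N) G) :
    ‖(evalRep (valRingToN M N) T.rho u).det -
      valRingToN M N (augmentation _ G u) ^ T.dim‖ < 1 := by
  let R := valRing M N
  let A := MonoidAlgebra R G
  let s : R := augmentation _ G u
  let f := valRingToN M N
  obtain ⟨j, y, hy⟩ := exists_pow_eq_natCast_mul p G hG (u - algebraMap R A s)
    (by rw [map_sub, AlgHom.commutes]; exact sub_self _)
  have hu : ∃ y', u ^ p ^ j = algebraMap R A (s ^ p ^ j) + (p : A) * y' := by
    have hc : Commute (algebraMap R A s) (u - algebraMap R A s) := Algebra.commutes s _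
    obtain ⟨r, hr⟩ := hc.exists_add_pow_prime_pow_eq hp.1 j
    rw [add_sub_cancel, hy] at hr
    refine ⟨y + algebraMap R A s * (u - algebraMap R A s) * r, ?_⟩
    rw [hr, map_pow]
    simp only [mul_add, mul_assoc, add_assoc]
  obtain ⟨y', hy'⟩ := hu
  -- Raising a congruence modulo p to the p^k-th power improves it to one modulo p^(k+1). The
  -- binomial computation is done in the commutative ring R[X] and then evaluated at `y'`.
  have hpow (k : ℕ) : ∃ w, u ^ p ^ (j + k) =
      algebraMap R A (s ^ p ^ (j + k)) + (p : A) ^ (k + 1) * w := by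
    have h1 := dvd_sub_pow_of_dvd_sub (p := p) (a := Polynomial.C (s ^ p ^ j) + (p : Polynomial R) * Polynomial.X)
      (b := Polynomial.C (s ^ p ^ j)) ⟨Polynomial.X, by ring⟩ k
    obtain ⟨W, hW⟩ := h1
    refine ⟨Polynomial.aeval y' W, ?_⟩
    have h2 := congrArg (Polynomial.aeval y') hW
    simp only [map_sub, map_pow, map_add, map_mul, map_natCast, Polynomial.aeval_C,
      Polynomial.aeval_X] at h2
    rw [← map_pow, ← hy', ← pow_mul, ← pow_add, ← map_pow (algebraMap R _), ← pow_mul,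
      ← pow_add, sub_eq_iff_eq_add] at h2
    rw [h2, add_comm]
  -- The matrices of T need not be integral. A high power of p absorbs the bound `C` on their
  -- entries, and injectivity of Frobenius on the residue field returns from p^(j+k)-th powers to
  -- the determinant itself.
  obtain ⟨C, hC0, hC⟩ := exists_entry_bound (M := M) T
  obtain ⟨k, hk⟩ : ∃ k : ℕ, ‖(p : N)‖ ^ (k + 1) * C < 1 := by
    have h1 := ((tendsto_pow_atTop_nhds_zero_of_lt_one (norm_nonneg _)
      (norm_prime_lt_one p (N := N))).mul_const C).comp (Filter.tendsto_add_atTop_nat 1)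
    rw [zero_mul] at h1
    exact (h1.eventually_lt_const one_pos).exists
  obtain ⟨w, hw⟩ := hpow k
  have hfs : ‖f s‖ ≤ 1 := norm_valRingToN_le s
  refine norm_sub_lt_one_of_pow p (norm_det_evalRep_le T u) ?_ (j + k) ?_
  · rw [norm_pow]
    exact pow_le_one₀ (norm_nonneg _) hfs
  · have halg (r : R) : evalRep f T.rho (algebraMap R A r) = f r • 1 := by
      have : algebraMap R A r = single 1 r := by simp [A]
      rw [this, evalRep_single, map_one]
      rfl
    have h3 := norm_det_smul_one_add_sub_lt (s := f (s ^ p ^ (j + k)))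
      (norm_valRingToN_le _) (((p : N) ^ (k + 1)) • evalRep f T.rho w) fun i l => by
        rw [Matrix.smul_apply, norm_smul, norm_pow]
        exact lt_of_le_of_lt (by gcongr; exact hC _ _ _) hk
    rw [← Matrix.det_pow, ← map_pow, hw, map_add, halg, map_mul, map_pow (evalRep f T.rho),
      map_natCast (evalRep f T.rho)]
    rw [Fintype.card_fin] at h3
    have h4 : ((p : Matrix (Fin T.dim) (Fin T.dim) N)) ^ (k + 1) * evalRep f T.rho w =
        ((p : N) ^ (k + 1)) • evalRep f T.rho w := by
      have : (p : Matrix (Fin T.dim) (Fin T.dim) N) = (p : N) • 1 := by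
        rw [Nat.cast_smul_eq_nsmul, nsmul_one]
      rw [this, smul_pow, one_pow, smul_mul_assoc, one_mul]
    rw [h4, ← pow_mul, mul_comm T.dim, pow_mul, ← map_pow f s]
    exact h3

end ValRing

end DetDescent

namespace DetDescent

open MonoidAlgebra

/-! ### Evaluation of group rings at representations -/

section GroupEval

variable {R N G B : Type*} [CommRing R] [CommRing N] [Group G] [Ring B] [Algebra N B]

/-- The extension of a representation to the group ring, with coefficients mapped by `f`. -/
def groupEval (f : R →+* N) (T : G →* B) : MonoidAlgebra R G →+* B :=
  liftNCRingHom ((algebraMap N B).comp f) T fun r _ => Algebra.commute_algebraMap_left (f r) _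

theorem groupEval_single (f : R →+* N) (T : G →* B) (g : G) (r : R) :
    groupEval f T (single g r) = f r • T g := by
  rw [groupEval, liftNCRingHom_single, Algebra.smul_def]
  rfl

theorem groupEval_eq_sum [Fintype G] (f : R →+* N) (T : G →* B) (x : MonoidAlgebra R G) :
    groupEval f T x = ∑ g, f (x.coeff g) • T g := by
  classical
  induction x using MonoidAlgebra.induction_linear with
  | zero => simp
  | add a b ha hb => simp [ha, hb, add_smul, Finset.sum_add_distrib]
  | single g r => simp [groupEval_single, Finsupp.single_apply, apply_ite f, ite_smul]

theorem groupEval_mapDomain {H : Type*} [Group H] (f : R →+* N) (T : H →* B) (φ : G →* H)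
    (x : MonoidAlgebra R G) :
    groupEval f T (mapDomainRingHom R φ x) = groupEval f (T.comp φ) x := by
  induction x using MonoidAlgebra.induction_linear with
  | zero => simp
  | add a b ha hb => simp only [map_add, ha, hb]
  | single g r => simp [groupEval_single]

theorem groupEval_mapRingHom {R' : Type*} [CommRing R'] (f : R' →+* N) (ρ : R →+* R') (T : G →* B)
    (x : MonoidAlgebra R G) :
    groupEval f T (mapRingHom G ρ x) = groupEval (f.comp ρ) T x := by
  induction x using MonoidAlgebra.induction_linear with
  | zero => simp
  | add a b ha hb => simp only [map_add, ha, hb]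
  | single g r => simp [groupEval_single]

theorem groupEval_one (f : R →+* N) (x : MonoidAlgebra R G) :
    groupEval f (1 : G →* N) x = f (augmentation R G x) := by
  induction x using MonoidAlgebra.induction_linear with
  | zero => simp
  | add a b ha hb => simp only [map_add, ha, hb]
  | single g r => simp [groupEval_single, augmentation_single]

end GroupEval

/-! ### Separation by characters of an abelian group -/

section Abelian

variable {R N A : Type*} [CommRing R] [Field N] [CommGroup A] [Finite A]

/-- The characters of a finite abelian group separate the elements of its group ring. -/
theorem eq_of_forall_groupEval_eq {f : R →+* N} (hf : Function.Injective f) {n : ℕ} {ζ : N}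
    (hζ : IsPrimitiveRoot ζ n) (hn : Nat.card A ∣ n) (hn0 : n ≠ 0) {x y : MonoidAlgebra R A}
    (h : ∀ χ : A →* N, groupEval f χ x = groupEval f χ y) : x = y := by
  classical
  have := Fintype.ofFinite A
  have : HasEnoughRootsOfUnity N (Nat.card A) := by
    have : NeZero (Nat.card A) := ⟨Nat.card_pos.ne'⟩
    obtain ⟨k, hk⟩ := hn
    exact ⟨⟨ζ ^ k, hζ.pow (Nat.pos_of_ne_zero hn0) (by rw [hk, mul_comm])⟩, inferInstance⟩
  have : HasEnoughRootsOfUnity N (Monoid.exponent A) := by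
    have : NeZero (Monoid.exponent A) := ⟨Monoid.exponent_ne_zero_of_finite⟩
    exact HasEnoughRootsOfUnity.of_dvd N (Group.exponent_dvd_nat_card (G := A))
  obtain ⟨e⟩ := CommGroup.monoidHom_mulEquiv_of_hasEnoughRootsOfUnity A N
  have : Finite (A →* Nˣ) := Finite.of_equiv A e.symm.toEquiv
  have := Fintype.ofFinite (A →* Nˣ)
  have hli : LinearIndependent N (fun χ : A →* Nˣ => fun a => (χ a : N)) := by
    refine (linearIndependent_monoidHom A N).comp
      (fun χ : A →* Nˣ => (Units.coeHom N).comp χ) fun χ χ' h => ?_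
    ext a
    exact DFunLike.congr_fun h a
  -- The characters are linearly independent and as many as the elements of A, hence a basis of the
  -- functions on A; each coefficient is therefore a combination of character values.
  have hspan := hli.span_eq_top_of_card_eq_finrank' (by
    rw [Module.finrank_fintype_fun_eq_card, ← Nat.card_eq_fintype_card,
      ← Nat.card_eq_fintype_card, Nat.card_congr e.toEquiv])
  have hsum (φ : A → N) (x : MonoidAlgebra R A) :
      ∃ ℓ : (A → N) →ₗ[N] N, (∀ χ : A →* N, ℓ χ = groupEval f χ x) ∧
        ∀ a, ℓ (Pi.single a 1) = f (x.coeff a) := by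
    refine ⟨∑ a, f (x.coeff a) • LinearMap.proj a, fun χ => ?_, fun a => ?_⟩
    · induction x using MonoidAlgebra.induction_linear with
      | zero => simp
      | add a b ha hb =>
        rw [map_add, ← ha, ← hb]
        simp [add_mul, Finset.sum_add_distrib]
      | single g r =>
        rw [groupEval_single]
        simp [Finsupp.single_apply, apply_ite f]
    · simp [Pi.single_apply]
  obtain ⟨ℓ₁, h₁, h₁'⟩ := hsum 0 x
  obtain ⟨ℓ₂, h₂, h₂'⟩ := hsum 0 y
  have heq : ℓ₁ = ℓ₂ := by
    refine LinearMap.ext_on_range hspan fun χ => ?_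
    have := h ((Units.coeHom N).comp χ)
    rw [← h₁, ← h₂] at this
    exact this
  ext a
  apply hf
  rw [← h₁', ← h₂', heq]

end Abelian

/-! ### Higman's theorem over p-adic rings -/

section Higman

variable (p : ℕ) [hp : Fact p.Prime] {R N : Type*} [CommRing R] [NormedField N]
  [NormedAlgebra ℚ_[p] N] [IsUltrametricDist N]

theorem norm_groupEval_sub_augmentation_lt {f : R →+* N} (hf : ∀ r, ‖f r‖ ≤ 1) {A : Type*}
    [Group A] (hA : IsPGroup p A) (χ : A →* N) (x : MonoidAlgebra R A) :
    ‖groupEval f χ x - f (augmentation R A x)‖ < 1 := by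
  induction x using MonoidAlgebra.induction_linear with
  | zero => simp
  | add a b ha hb =>
    rw [map_add, map_add, map_add, add_sub_add_comm]
    exact (IsUltrametricDist.norm_add_le_max _ _).trans_lt (max_lt ha hb)
  | single g r =>
    obtain ⟨k, hk⟩ := hA g
    rw [groupEval_single, augmentation_single, smul_eq_mul, ← mul_sub_one, norm_mul]
    have h1 : ‖χ g - 1‖ < 1 := norm_root_sub_one_lt p (k := k) (by rw [← map_pow, hk, map_one])
    exact (mul_le_of_le_one_left (norm_nonneg _) (hf r)).trans_lt h1

/-- **Higman's theorem** over `p`-adic rings: an element of augmentation one in the group ring of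
a finite abelian `p`-group, all of whose character values are roots of unity of `p`-power order,
is a group element. -/
theorem exists_eq_single_of_torsion {f : R →+* N} (hinj : Function.Injective f)
    (hf : ∀ r, ‖f r‖ ≤ 1) {n : ℕ} {ζ : N} (hζ : IsPrimitiveRoot ζ n) (hn0 : n ≠ 0)
    (A : Type*) [CommGroup A] [Finite A] (hA : IsPGroup p A) (hn : Nat.card A ∣ n)
    (x : MonoidAlgebra R A) (haug : augmentation R A x = 1)
    (htors : ∀ χ : A →* N, ∃ k, groupEval f χ x ^ p ^ k = 1) : ∃ a, x = single a 1 := by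
  have := charZero_of_normedAlgebra_padic p (N := N)
  induction h : Nat.card A using Nat.strong_induction_on generalizing A with
  | _ m ih =>
  rcases subsingleton_or_nontrivial A with hs | hs
  · refine ⟨1, ?_⟩
    have h1 : x = single 1 (augmentation R A x) := by
      clear haug htors
      induction x using MonoidAlgebra.induction_linear with
      | zero => simp
      | add a b ha hb => rw [map_add, single_add, ← ha, ← hb]
      | single g r => rw [augmentation_single, Subsingleton.elim g 1]
    rw [h1, haug]
  · obtain ⟨z, hzc, hz⟩ := exists_central_orderOf_eq_prime hA
    have hz1 : z ≠ 1 := fun h => hp.1.ne_one (by rw [← hz, h, orderOf_one])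
    let π : A →* A ⧸ Subgroup.zpowers z := QuotientGroup.mk' _
    obtain ⟨b, hb⟩ := ih _ (h ▸ card_quotient_zpowers_lt hz1) (A ⧸ Subgroup.zpowers z)
      (hA.to_quotient _) ((Subgroup.card_quotient_dvd_card _).trans hn) (mapDomainRingHom R π x)
      (by rw [augmentation_mapDomain, haug])
      (fun χ => by
        rw [groupEval_mapDomain]
        exact htors _) rfl
    obtain ⟨a, rfl⟩ := QuotientGroup.mk'_surjective _ b
    -- By induction x becomes a group element in A/⟨z⟩; dividing by a lift `a` of it leaves an
    -- element 1 + (1 - z)w.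
    let x' := single a⁻¹ (1 : R) * x
    obtain ⟨w, hw⟩ := exists_eq_one_sub_mul z hzc (x' - 1) (by
      rw [map_sub, map_mul, hb]
      simp [one_def])
    have hx' : x' = 1 + (1 - single z 1) * w := by rw [← hw]; abel
    have htors' (χ : A →* N) : ∃ k, groupEval f χ x' ^ p ^ k = 1 := by
      obtain ⟨k, hk⟩ := htors χ
      obtain ⟨l, hl⟩ := hA a⁻¹
      refine ⟨l + k, ?_⟩
      have h1 : groupEval f χ x' = χ a⁻¹ * groupEval f χ x := by
        rw [map_mul, groupEval_single, map_one, one_smul]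
      have h2 : χ a⁻¹ ^ p ^ (l + k) = 1 := by
        rw [pow_add, pow_mul, ← map_pow, hl, map_one, one_pow]
      have h3 : groupEval f χ x ^ p ^ (l + k) = 1 := by
        rw [add_comm, pow_add, pow_mul, hk, one_pow]
      rw [h1, mul_pow, h2, h3, one_mul]
    have hev (χ : A →* N) : groupEval f χ x' = 1 + (1 - χ z) * groupEval f χ w := by
      conv_lhs => rw [hx']
      rw [map_add, map_one, map_mul, map_sub, map_one, groupEval_single, map_one, one_smul]
    have hwn (χ : A →* N) : ‖groupEval f χ w‖ ≤ 1 := by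
      have h1 := (norm_groupEval_sub_augmentation_lt p hf hA χ w).le
      have h2 := IsUltrametricDist.norm_add_le_max (groupEval f χ w - f (augmentation R A w))
        (f (augmentation R A w))
      rw [sub_add_cancel] at h2
      exact h2.trans (max_le h1 (hf _))
    -- For χ(z) ≠ 1 the torsion value 1 + (1 - χ(z))χ(w) is χ(z)^e with e ≡ -χ(w). Since χ(w) is
    -- congruent to the augmentation of w, the exponent e < p does not depend on χ.
    have hex (χ : A →* N) (hχ : χ z ≠ 1) :
        ∃ e < p, groupEval f χ x' = χ z ^ e ∧ ‖f (augmentation R A w) + e‖ < 1 := by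
      have hprim : IsPrimitiveRoot (χ z) p := by
        have h1 : χ z ^ p = 1 := by rw [← map_pow, ← hz, pow_orderOf_eq_one, map_one]
        rw [← orderOf_eq_prime h1 hχ]
        exact IsPrimitiveRoot.orderOf _
      obtain ⟨k, hk⟩ := htors' χ
      rw [hev] at hk
      obtain ⟨e, he, h1, h2⟩ := exists_eq_pow_of_one_add p hprim (hwn χ) hk
      refine ⟨e, he, by rw [hev, h1], ?_⟩
      have h3 : f (augmentation R A w) + e = (groupEval f χ w + e) -
          (groupEval f χ w - f (augmentation R A w)) := by ring
      rw [h3, sub_eq_add_neg]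
      refine (IsUltrametricDist.norm_add_le_max _ _).trans_lt (max_lt h2 ?_)
      rw [norm_neg]
      exact norm_groupEval_sub_augmentation_lt p hf hA χ w
    have huniq {e e' : ℕ} (he : e < p) (he' : e' < p) (h : ‖f (augmentation R A w) + e‖ < 1)
        (h' : ‖f (augmentation R A w) + e'‖ < 1) : e = e' := by
      wlog hle : e ≤ e' generalizing e e'
      · exact (this he' he h' h (le_of_not_ge hle)).symm
      have h1 : ‖((e' - e : ℕ) : N)‖ < 1 := by
        have h2 : ((e' - e : ℕ) : N) = (f (augmentation R A w) + e') +
            -(f (augmentation R A w) + e) := by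
          rw [Nat.cast_sub hle]; ring
        rw [h2]
        refine (IsUltrametricDist.norm_add_le_max _ _).trans_lt (max_lt h' ?_)
        rwa [norm_neg]
      rw [norm_natCast_eq_padic p, Padic.norm_natCast_lt_one_iff] at h1
      have := Nat.eq_zero_of_dvd_of_lt h1 (by omega)
      omega
    obtain ⟨e, he⟩ : ∃ e : ℕ, ∀ χ : A →* N, groupEval f χ x' = χ z ^ e := by
      by_cases hχ₀ : ∃ χ₀ : A →* N, χ₀ z ≠ 1
      · obtain ⟨χ₀, hχ₀⟩ := hχ₀
        obtain ⟨e, he, -, h2⟩ := hex χ₀ hχ₀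
        refine ⟨e, fun χ => ?_⟩
        by_cases hχ : χ z = 1
        · rw [hev, hχ]; simp
        · obtain ⟨e', he', h1', h2'⟩ := hex χ hχ
          rw [h1', huniq he he' h2 h2']
      · push Not at hχ₀
        exact ⟨0, fun χ => by rw [hev, hχ₀ χ]; simp⟩
    -- Characters with χ(z) = 1 impose no condition on e, so one exponent serves for all characters,
    -- and these separate the elements.
    have hfin : x' = single (z ^ e) 1 := by
      refine eq_of_forall_groupEval_eq hinj hζ hn hn0 fun χ => ?_
      rw [he, groupEval_single, map_one, one_smul, map_pow]
    refine ⟨a * z ^ e, ?_⟩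
    have : x = single a 1 * x' := by
      simp only [x']
      rw [← mul_assoc, single_mul_single, mul_inv_cancel, one_mul, ← one_def, one_mul]
    rw [this, hfin, single_mul_single, one_mul]

end Higman

end DetDescent

namespace DetDescent

open MonoidAlgebra Finset Equiv

/-! ### Coset factors, transfer and induced matrices -/

section Induction

variable {G : Type*} [Group G] (H : Subgroup G)

/-- The factor set of the coset representatives: `g tᵢ = t_{gi} h` with `h = cosetFactor H g i`. -/
def cosetFactor (g : G) (i : G ⧸ H) : H :=
  ⟨(g • i).out⁻¹ * (g * i.out), by
    rw [← QuotientGroup.eq, QuotientGroup.out_eq']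
    conv_lhs => rw [← QuotientGroup.out_eq' i]
    rfl⟩

theorem cosetFactor_mul (g g' : G) (i : G ⧸ H) :
    cosetFactor H (g * g') i = cosetFactor H g (g' • i) * cosetFactor H g' i := by
  ext
  simp only [cosetFactor, mul_smul, Subgroup.coe_mul]
  group

theorem cosetFactor_one (i : G ⧸ H) : cosetFactor H 1 i = 1 := by
  ext
  simp [cosetFactor]

variable [Fintype (G ⧸ H)]

/-- The transfer of a homomorphism to a commutative group. -/
def transferHom {A : Type*} [CommGroup A] (φ : H →* A) : G →* A :=
  MonoidHom.mk' (fun g => ∏ i, φ (cosetFactor H g i)) fun g g' => by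
    simp only [cosetFactor_mul, map_mul, prod_mul_distrib]
    congr 1
    exact Equiv.prod_comp (MulAction.toPerm g') fun i => φ (cosetFactor H g i)

variable [DecidableEq (G ⧸ H)]

/-- The matrices of the representation of `G` induced by a homomorphism from `H` to the
multiplicative monoid of a ring. -/
def inducedMatrix {B : Type*} [Semiring B] (τ : H →* B) : G →* Matrix (G ⧸ H) (G ⧸ H) B where
  toFun g := Matrix.of fun j i => if j = g • i then τ (cosetFactor H g i) else 0
  map_one' := by
    ext j i
    simp [cosetFactor_one, Matrix.one_apply]
  map_mul' g g' := by
    ext j i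
    simp only [Matrix.mul_apply, Matrix.of_apply]
    rw [sum_eq_single (g' • i) (fun k _ hk => by rw [if_neg hk, mul_zero]) (by simp)]
    simp only [if_true, mul_smul, cosetFactor_mul, map_mul, ite_mul, zero_mul]

theorem inducedMatrix_apply {B : Type*} [Semiring B] (τ : H →* B) (g : G) (j i : G ⧸ H) :
    inducedMatrix H τ g j i = if j = g • i then τ (cosetFactor H g i) else 0 := rfl

end Induction

/-! ### Counting fixed points modulo p -/

section FixedPoints

/-- In characteristic `p`, the sum of a function that is invariant under a map of order `p` is
the sum over its fixed points. -/
theorem sum_eq_sum_fixedPoints {k : Type*} [Ring k] (p : ℕ) [Fact p.Prime] [CharP k p]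
    {X : Type*} [Fintype X] [DecidableEq X] (σ : X → X) (hσ : σ^[p] = id) (f : X → k)
    (hf : ∀ x, f (σ x) = f x) : ∑ x, f x = ∑ x with σ x = x, f x := by
  classical
  -- Group both sums by the value of `f`: each fibre is stable under σ, and its cardinality is
  -- congruent modulo p to its number of fixed points.
  have key (s : Finset X) : ∑ c ∈ univ.image f, ∑ x ∈ s with f x = c, c = ∑ x ∈ s, f x :=
    sum_fiberwise_of_maps_to' (fun x _ => mem_image_of_mem f (mem_univ x)) id
  rw [← key, ← key]
  refine sum_congr rfl fun c _ => ?_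
  rw [sum_const, sum_const, ← Nat.cast_smul_eq_nsmul k, ← Nat.cast_smul_eq_nsmul k]
  congr 1
  rw [CharP.natCast_eq_natCast k p]
  let σc : Function.End {x // f x = c} := fun x => ⟨σ x.1, by rw [hf, x.2]⟩
  have hit (n : ℕ) (x : {x // f x = c}) : ((σc ^ n : Function.End _) x).1 = σ^[n] x.1 := by
    induction n generalizing x with
    | zero => rfl
    | succ n ih =>
      rw [pow_succ, Function.iterate_succ_apply]
      exact ih (σc x)
  have h1 : σc ^ p ^ 1 = 1 := by
    funext x
    ext
    rw [pow_one, hit, hσ]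
    rfl
  have h2 := Equiv.Perm.card_fixedPoints_modEq h1
  rw [Fintype.card_subtype] at h2
  refine h2.trans (congrArg (· % p) ?_)
  rw [filter_filter, ← Fintype.card_subtype]
  refine Fintype.card_congr ⟨fun x => ⟨x.1.1, congrArg Subtype.val x.2, x.1.2⟩,
    fun x => ⟨⟨x.1, x.2.2⟩, Subtype.ext x.2.1⟩, fun _ => rfl, fun _ => rfl⟩

end FixedPoints

/-! ### The determinant of an induced matrix modulo p -/

section Congruence

variable {G : Type*} [Group G] (H : Subgroup G) {ι : Type*}

theorem prod_smul_ite_single {k A Y : Type*} [CommRing k] [CommGroup A] [Fintype Y]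
    (P : Y → Prop) [DecidablePred P] (c : Y → k) (m : Y → A) :
    ∏ y, c y • (if P y then single (m y) (1 : k) else 0) =
      if ∀ y, P y then single (∏ y, m y) (∏ y, c y) else 0 := by
  split_ifs with h
  · rw [← prod_single]
    exact prod_congr rfl fun y _ => by rw [if_pos (h y), smul_single, smul_eq_mul, mul_one]
  · push Not at h
    obtain ⟨y, hy⟩ := h
    exact prod_eq_zero (mem_univ y) (by rw [if_neg hy, smul_zero])

variable [H.Normal]

/-- The action of a coset on the indices of induced matrices by right translation. -/
def cosetShift (ι : Type*) (s : G ⧸ H) : Perm (ι × (G ⧸ H)) :=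
  Equiv.prodCongr (Equiv.refl ι) (Equiv.mulRight s)

theorem cosetShift_apply (s : G ⧸ H) (y : ι × (G ⧸ H)) : cosetShift H ι s y = (y.1, y.2 * s) := rfl

theorem cosetShift_pow_apply (s : G ⧸ H) (n : ℕ) (y : ι × (G ⧸ H)) :
    (cosetShift H ι s ^ n) y = (y.1, y.2 * s ^ n) := by
  induction n with
  | zero => simp
  | succ n ih => rw [_root_.pow_succ', Perm.mul_apply, ih, cosetShift_apply, pow_succ, mul_assoc]

theorem smul_coset_mul (g : G) (i s : G ⧸ H) : g • (i * s) = g • i * s := by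
  induction i using QuotientGroup.induction_on with
  | H a =>
    induction s using QuotientGroup.induction_on with
    | H b => exact congrArg QuotientGroup.mk (mul_assoc g a b).symm

/-- Transport of indices and group elements by `cosetShift`. -/
def shiftPair (s : G ⧸ H) (x : Perm (ι × (G ⧸ H)) × (ι × (G ⧸ H) → G)) :
    Perm (ι × (G ⧸ H)) × (ι × (G ⧸ H) → G) :=
  (cosetShift H ι s * x.1 * (cosetShift H ι s)⁻¹, x.2 ∘ (cosetShift H ι s).symm)

theorem shiftPair_iterate (s : G ⧸ H) (n : ℕ) (x : Perm (ι × (G ⧸ H)) × (ι × (G ⧸ H) → G)) :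
    (shiftPair H s)^[n] x = (cosetShift H ι s ^ n * x.1 * (cosetShift H ι s ^ n)⁻¹,
      x.2 ∘ (cosetShift H ι s ^ n).symm) := by
  induction n with
  | zero =>
    refine Prod.ext ?_ rfl
    simp
  | succ n ih =>
    rw [Function.iterate_succ_apply', ih, shiftPair]
    refine Prod.ext ?_ ?_
    · simp only [_root_.pow_succ', mul_inv_rev, mul_assoc]
    · funext y
      simp only [Function.comp_apply, _root_.pow_succ']
      rfl

/-- Write the representative of i·s as tᵢ tₛ hᵢ with hᵢ in H. Right translation then conjugates the
factor set by tₛ⁻¹ and multiplies it by the coboundary of h, as seen in the abelianization. -/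
theorem exists_cosetFactor_mul_right (s : G ⧸ H) : ∃ h : G ⧸ H → Abelianization H, ∀ g i,
    (Abelianization.of (cosetFactor H g (i * s)) : Abelianization H) =
      (h (g • i))⁻¹ * (MulAut.conjNormal s.out⁻¹ : H ≃* H).abelianizationCongr
        (Abelianization.of (cosetFactor H g i)) * h i := by
  have hmem (i : G ⧸ H) : (i.out * s.out)⁻¹ * (i * s).out ∈ H := by
    rw [← QuotientGroup.eq, QuotientGroup.mk_mul, QuotientGroup.out_eq', QuotientGroup.out_eq',
      QuotientGroup.out_eq']
  refine ⟨fun i => Abelianization.of ⟨_, hmem i⟩, fun g i => ?_⟩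
  rw [abelianizationCongr_of, ← map_inv, ← map_mul, ← map_mul]
  congr 1
  ext
  simp only [cosetFactor, Subgroup.coe_mul, InvMemClass.coe_inv, MulAut.conjNormal_apply,
    smul_coset_mul]
  group

variable [Fintype (G ⧸ H)] [DecidableEq (G ⧸ H)] [Fintype ι] [DecidableEq ι]

/-- The contribution of a permutation and a choice of group elements to the coefficient of `1` in
the determinant of an induced matrix. -/
def inducedTerm {k : Type*} [CommRing k] (v : Matrix ι ι (MonoidAlgebra k G))
    (x : Perm (ι × (G ⧸ H)) × (ι × (G ⧸ H) → G)) : k :=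
  open Classical in
  if (∀ y, (x.1 y).2 = x.2 y • y.2) ∧
    ∏ y, (Abelianization.of (cosetFactor H (x.2 y) y.2) : Abelianization H) = 1
  then Perm.sign x.1 • ∏ y, (v (x.1 y).1 y.1).coeff (x.2 y) else 0

omit [H.Normal] in
theorem coeff_one_det_induced_eq_sum [Fintype G] {k : Type*} [CommRing k] (v : Matrix ι ι (MonoidAlgebra k G)) :
    (Matrix.comp ι ι (G ⧸ H) (G ⧸ H) _ (v.map (groupEval (RingHom.id k)
      (inducedMatrix H ((of k (Abelianization H)).comp Abelianization.of))))).det.coeff 1 =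
      ∑ x, inducedTerm H v x := by
  classical
  rw [Matrix.det_apply, Fintype.sum_prod_type]
  have hD (y' y : ι × (G ⧸ H)) : Matrix.comp ι ι (G ⧸ H) (G ⧸ H) _ (v.map (groupEval (RingHom.id k)
      (inducedMatrix H ((of k (Abelianization H)).comp Abelianization.of)))) y' y =
      ∑ g, (v y'.1 y.1).coeff g • (if y'.2 = g • y.2 then
        single (Abelianization.of (cosetFactor H g y.2)) (1 : k) else 0) := by
    simp only [Matrix.comp_apply, Matrix.map_apply, groupEval_eq_sum, Matrix.sum_apply,
      Matrix.smul_apply, inducedMatrix_apply, RingHom.id_apply, MonoidHom.comp_apply, of_apply]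
  simp only [hD, prod_univ_sum, Fintype.piFinset_univ, prod_smul_ite_single]
  simp only [smul_sum, coeff_sum, Finsupp.finsetSum_apply]
  refine sum_congr rfl fun π _ => sum_congr rfl fun γ _ => ?_
  by_cases h : ∀ y, (π y).2 = γ y • y.2
  · simp only [inducedTerm, h, implies_true, true_and, if_true, coeff_smul, Finsupp.smul_apply,
      coeff_single, Finsupp.single_apply, smul_ite, smul_zero]
  · simp only [inducedTerm, h, false_and, if_false, smul_zero, coeff_zero, Finsupp.zero_apply]

/-- Right translation commutes with the left action of G on cosets, so the support condition is
preserved. In the product of coset factors the coboundary cancels along the permutation, and the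
remaining automorphism fixes 1; the sign is invariant under conjugation. -/
theorem inducedTerm_shiftPair {k : Type*} [CommRing k] (v : Matrix ι ι (MonoidAlgebra k G))
    (s : G ⧸ H) (x : Perm (ι × (G ⧸ H)) × (ι × (G ⧸ H) → G)) :
    inducedTerm H v (shiftPair H s x) = inducedTerm H v x := by
  classical
  obtain ⟨π, γ⟩ := x
  set τ := cosetShift H ι s with hτ
  have hinv (y) : τ⁻¹ (τ y) = y := τ.symm_apply_apply y
  have h1 : (∀ y, ((τ * π * τ⁻¹) y).2 = (γ ∘ τ.symm) y • y.2) ↔ ∀ y, (π y).2 = γ y • y.2 := by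
    rw [← τ.forall_congr_right]
    refine forall_congr' fun y => ?_
    simp only [Perm.mul_apply, hinv, Function.comp_apply, Equiv.symm_apply_apply]
    simp only [hτ, cosetShift_apply, smul_coset_mul, mul_left_inj]
  have h2 (h : ∀ y, (π y).2 = γ y • y.2) :
      ∏ y, (Abelianization.of (cosetFactor H ((γ ∘ τ.symm) y) y.2) : Abelianization H) = 1 ↔
      ∏ y, (Abelianization.of (cosetFactor H (γ y) y.2) : Abelianization H) = 1 := by
    obtain ⟨b, hb⟩ := exists_cosetFactor_mul_right H s
    rw [← Equiv.prod_comp τ]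
    simp only [Function.comp_apply, Equiv.symm_apply_apply]
    simp only [hτ, cosetShift_apply, hb, prod_mul_distrib, prod_inv_distrib, ← map_prod, ← h]
    rw [Equiv.prod_comp π fun y => b y.2, mul_right_comm, inv_mul_cancel, one_mul,
      EmbeddingLike.map_eq_one_iff]
  have h3 : ∏ y, (v ((τ * π * τ⁻¹) y).1 y.1).coeff ((γ ∘ τ.symm) y) =
      ∏ y, (v (π y).1 y.1).coeff (γ y) := by
    rw [← Equiv.prod_comp τ]
    simp only [Perm.mul_apply, hinv, Function.comp_apply, Equiv.symm_apply_apply]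
    simp only [hτ, cosetShift_apply]
  simp only [inducedTerm, shiftPair, ← hτ, h3]
  refine if_congr ⟨fun h => ⟨h1.1 h.1, (h2 (h1.1 h.1)).1 h.2⟩,
    fun h => ⟨h1.2 h.1, (h2 h.1).2 h.2⟩⟩ ?_ rfl
  rw [map_mul, map_mul, map_inv, mul_right_comm, mul_inv_cancel, one_mul]

/-- The pair of a permutation of `ι × G ⧸ H` and a choice of group elements that is determined by
a permutation of `ι` and a choice of group elements. -/
def blockPair (x : Perm ι × (ι → G)) : Perm (ι × (G ⧸ H)) × (ι × (G ⧸ H) → G) :=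
  (prodCongrLeft (fun _ => x.1) * prodCongrRight fun a => MulAction.toPerm (x.2 a),
    fun y => x.2 y.1)

omit [H.Normal] [Fintype (G ⧸ H)] [DecidableEq (G ⧸ H)] [Fintype ι] [DecidableEq ι] in
theorem blockPair_fst_apply (x : Perm ι × (ι → G)) (y : ι × (G ⧸ H)) :
    (blockPair H x).1 y = (x.1 y.1, x.2 y.1 • y.2) := rfl

/-- For odd p, δ = 1 and ε^p = ε; for p = 2, signs act trivially. -/
theorem sign_smul_eq_of_charP {k : Type*} [CommRing k] (p : ℕ) [hp : Fact p.Prime] [CharP k p]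
    (ε δ : ℤˣ) (hδ : δ ^ p = 1) (x : k) : (ε ^ p * δ) • x = ε • x := by
  rcases hp.1.eq_two_or_odd' with rfl | hodd
  · have h2 : (-x : k) = x := by
      have := CharTwo.two_eq_zero (R := k)
      linear_combination (-x) * this
    have (ε : ℤˣ) : ε • x = x := by
      rcases Int.units_eq_one_or ε with rfl | rfl
      · exact one_smul _ _
      · rw [Units.smul_def]; simpa using h2
    rw [this, this]
  · rw [Int.units_pow_eq_pow_mod_two, Nat.odd_iff.1 hodd, pow_one] at hδ ⊢
    rw [hδ, mul_one]

/-- In a block pair each coefficient occurs once for every coset, giving its p-th power, and the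
coset factors of each group element multiply to its transfer. The extra signs come from permutations
whose p-th power is 1. -/
theorem inducedTerm_blockPair {k : Type*} [CommRing k] (p : ℕ) [hp : Fact p.Prime] [CharP k p]
    (hH : Nat.card (G ⧸ H) = p) (v : Matrix ι ι (MonoidAlgebra k G)) (x : Perm ι × (ι → G)) :
    inducedTerm H v (blockPair H x) =
      open Classical in
      if ∏ a, transferHom H (Abelianization.of (G := H)) (x.2 a) = 1
      then Perm.sign x.1 • ∏ a, (v (x.1 a) a).coeff (x.2 a) ^ p else 0 := by
  have hcard : Fintype.card (G ⧸ H) = p := by rw [← Nat.card_eq_fintype_card, hH]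
  have hsign : Perm.sign (blockPair H x).1 = Perm.sign x.1 ^ p *
      ∏ a, Perm.sign (MulAction.toPerm (x.2 a) : Perm (G ⧸ H)) := by
    rw [blockPair, Perm.sign_mul, Perm.sign_prodCongrLeft, Perm.sign_prodCongrRight, prod_const,
      card_univ, hcard]
  have hpow (g : G) : (MulAction.toPerm g : Perm (G ⧸ H)) ^ p = 1 := by
    ext i
    have h1 : (MulAction.toPerm g : Perm (G ⧸ H)) ^ p = MulAction.toPerm (g ^ p) :=
      (map_pow (MulAction.toPermHom G (G ⧸ H)) g p).symm
    rw [h1]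
    induction i using QuotientGroup.induction_on with
    | H b =>
      have h2 : ((g : G ⧸ H)) ^ p = 1 := by rw [← hH, pow_card_eq_one']
      calc ((g ^ p * b : G) : G ⧸ H) = (g : G ⧸ H) ^ p * b := rfl
        _ = b := by rw [h2, one_mul]
  classical
  unfold inducedTerm
  refine if_congr ?_ ?_ rfl
  · rw [Fintype.prod_prod_type]
    exact and_iff_right fun y => rfl
  · rw [hsign, sign_smul_eq_of_charP p, Fintype.prod_prod_type]
    · congr 1
      refine prod_congr rfl fun a _ => ?_
      change ∏ i : G ⧸ H, (v (x.1 a) a).coeff (x.2 a) = _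
      rw [prod_const, card_univ, hcard]
    · rw [← prod_pow]
      exact prod_eq_one fun a _ => by rw [← map_pow, hpow, map_one]

-- Since s generates the quotient of prime order, a fixed pair is invariant under all translations:
-- its group elements and the first coordinate of its permutation depend only on the index in ι. The
-- support condition determines the second coordinate.
omit [Fintype (G ⧸ H)] [DecidableEq (G ⧸ H)] [DecidableEq ι] in
theorem exists_blockPair_eq {p : ℕ} [Fact p.Prime] (hH : Nat.card (G ⧸ H) = p) {s : G ⧸ H}
    (hs : s ≠ 1) (x : Perm (ι × (G ⧸ H)) × (ι × (G ⧸ H) → G)) (hx : shiftPair H s x = x)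
    (h : ∀ y, (x.1 y).2 = x.2 y • y.2) : ∃ z, blockPair H z = x := by
  obtain ⟨π, γ⟩ := x
  have hit (n : ℕ) : (cosetShift H ι s ^ n * π * (cosetShift H ι s ^ n)⁻¹,
      γ ∘ (cosetShift H ι s ^ n).symm) = (π, γ) := by
    rw [← shiftPair_iterate H s n (π, γ)]
    exact Function.iterate_fixed hx n
  have hγ (a : ι) (i : G ⧸ H) : γ (a, i) = γ (a, 1) := by
    obtain ⟨n, rfl⟩ := mem_powers_of_prime_card hH hs (g' := i)
    have h1 : γ ((cosetShift H ι s ^ n).symm ((cosetShift H ι s ^ n) (a, 1))) = _ :=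
      congrFun (congrArg Prod.snd (hit n)) ((cosetShift H ι s ^ n) (a, 1))
    rw [Equiv.symm_apply_apply, cosetShift_pow_apply, one_mul] at h1
    exact h1.symm
  have hπ (a : ι) (i : G ⧸ H) : (π (a, i)).1 = (π (a, 1)).1 := by
    obtain ⟨n, rfl⟩ := mem_powers_of_prime_card hH hs (g' := i)
    have h1 := congrArg (fun e : Perm _ => e ((cosetShift H ι s ^ n) (a, 1)))
      (congrArg Prod.fst (hit n))
    have hinv (e : Perm (ι × (G ⧸ H))) (y) : e⁻¹ (e y) = y := e.symm_apply_apply y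
    simp only [Perm.mul_apply, hinv] at h1
    rw [cosetShift_pow_apply, cosetShift_pow_apply, one_mul] at h1
    exact (congrArg Prod.fst h1).symm
  have hsurj : Function.Surjective fun a => (π (a, 1)).1 := fun b => by
    refine ⟨(π.symm (b, 1)).1, ?_⟩
    simp only
    rw [← hπ _ (π.symm (b, 1)).2, Prod.mk.eta, Equiv.apply_symm_apply]
  refine ⟨(Equiv.ofBijective _ (Finite.surjective_iff_bijective.1 hsurj), fun a => γ (a, 1)), ?_⟩
  refine Prod.ext (Equiv.ext fun y => ?_) (funext fun y => (hγ y.1 y.2).symm)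
  rw [blockPair_fst_apply]
  refine Prod.ext (hπ y.1 y.2).symm ?_
  rw [h]
  exact congrArg (· • y.2) (hγ y.1 y.2).symm

omit [Fintype (G ⧸ H)] [DecidableEq (G ⧸ H)] [Fintype ι] [DecidableEq ι] in
theorem blockPair_injective : Function.Injective (blockPair H (ι := ι)) := by
  rintro ⟨π, g⟩ ⟨π', g'⟩ h
  refine Prod.ext (Equiv.ext fun a => ?_) (funext fun a => ?_)
  · exact congrArg (fun e => (e.1 (a, 1)).1) h
  · exact congrArg (fun e => e.2 (a, 1)) h

/-- In characteristic `p`, the determinant of a matrix over `k[G]`, induced from a normal subgroup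
`H` of index `p`, has the same coefficient at `1` as the determinant of its image under the
transfer, the Frobenius map acting on coefficients. -/
theorem coeff_one_det_induced [Fintype G] {k : Type*} [CommRing k] (p : ℕ) [hp : Fact p.Prime] [CharP k p]
    (hH : Nat.card (G ⧸ H) = p) (v : Matrix ι ι (MonoidAlgebra k G)) :
    (Matrix.comp ι ι (G ⧸ H) (G ⧸ H) _ (v.map (groupEval (RingHom.id k)
      (inducedMatrix H ((of k (Abelianization H)).comp Abelianization.of))))).det.coeff 1 =
    (v.map (groupEval (frobenius k p) ((of k (Abelianization H)).comp
      (transferHom H Abelianization.of)))).det.coeff 1 := by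
  classical
  obtain ⟨s, hs⟩ : ∃ s : G ⧸ H, s ≠ 1 := by
    have : Nontrivial (G ⧸ H) := Finite.one_lt_card_iff_nontrivial.1 (hH ▸ hp.1.one_lt)
    exact exists_ne 1
  have hsp : (shiftPair H (ι := ι) s)^[p] = id := by
    have h1 : cosetShift H ι s ^ p = 1 := by
      ext y : 1
      rw [cosetShift_pow_apply, ← hH, pow_card_eq_one', mul_one, Perm.one_apply]
    funext x
    rw [shiftPair_iterate, h1]
    simp only [one_mul, inv_one, mul_one, id]
    rfl
  -- Translation by s has order p on the Leibniz terms, so modulo p only fixed terms survive. Those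
  -- that contribute are the block pairs, which reassemble into the Leibniz expansion on the
  -- transfer side.
  rw [coeff_one_det_induced_eq_sum,
    sum_eq_sum_fixedPoints p _ hsp _ (inducedTerm_shiftPair H v s),
    ← sum_of_injOn (s := univ) (f := fun x => inducedTerm H v (blockPair H x)) (blockPair H)
      (blockPair_injective H).injOn ?_ ?_ fun _ _ => rfl]
  · rw [Matrix.det_apply, Fintype.sum_prod_type]
    simp only [Matrix.map_apply, groupEval_eq_sum, prod_univ_sum, Fintype.piFinset_univ,
      smul_sum, coeff_sum, Finsupp.finsetSum_apply]
    refine sum_congr rfl fun π _ => sum_congr rfl fun g _ => ?_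
    rw [inducedTerm_blockPair H p hH]
    simp only [MonoidHom.comp_apply, of_apply, smul_single, smul_eq_mul, mul_one, prod_single,
      coeff_single, Finsupp.single_apply, frobenius_def]
  · intro x _
    rw [mem_coe, mem_filter]
    refine ⟨mem_univ _, Prod.ext ?_ rfl⟩
    refine mul_inv_eq_iff_eq_mul.2 (Equiv.ext fun y => ?_)
    rw [Perm.mul_apply, Perm.mul_apply, blockPair_fst_apply, blockPair_fst_apply]
    simp only [cosetShift_apply, smul_coset_mul]
  · intro x hx hx'
    simp only [inducedTerm]
    refine if_neg fun h => hx' ?_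
    obtain ⟨z, hz⟩ := exists_blockPair_eq H hH hs x (mem_filter.1 hx).2 h.1
    exact ⟨z, mem_coe.2 (mem_univ _), hz⟩

/-- A group element that is the determinant of an induced matrix is trivial, if the determinant
over the abelianized group ring is. -/
theorem eq_one_of_det_induced_eq_single [Fintype G] {R : Type*} [CommRing R] (p : ℕ) [hp : Fact p.Prime]
    (hpR : ¬ IsUnit (p : R)) (hH : Nat.card (G ⧸ H) = p) (v : Matrix ι ι (MonoidAlgebra R G))
    (hab : (v.map (mapDomainRingHom R (Abelianization.of (G := G)))).det = 1)
    (a : Abelianization H)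
    (ha : (Matrix.comp ι ι (G ⧸ H) (G ⧸ H) _ (v.map (groupEval (RingHom.id R)
      (inducedMatrix H ((of R (Abelianization H)).comp Abelianization.of))))).det = single a 1) :
    a = 1 := by
  classical
  -- The comparison takes place in R/p, nonzero because p is not a unit.
  let I : Ideal R := Ideal.span {(p : R)}
  have : CharP (R ⧸ I) p := CharP.quotient R p hpR
  have : Nontrivial (R ⧸ I) :=
    Ideal.Quotient.nontrivial_iff.2 fun h => hpR (Ideal.span_singleton_eq_top.1 h)
  let ρ : R →+* R ⧸ I := Ideal.Quotient.mk I
  let V : G →* MonoidAlgebra (R ⧸ I) (Abelianization H) :=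
    (of (R ⧸ I) (Abelianization H)).comp (transferHom H Abelianization.of)
  -- The transfer factors through G^ab, so the determinant on the transfer side is the image of 1.
  -- Its coefficient at 1 is 1, whereas that of a group element other than 1 is 0.
  let V' : Abelianization G →* MonoidAlgebra (R ⧸ I) (Abelianization H) :=
    (of (R ⧸ I) (Abelianization H)).comp (Abelianization.lift (transferHom H Abelianization.of))
  have key := coeff_one_det_induced H p hH (v.map (mapRingHom G ρ))
  have h1 : Matrix.comp ι ι (G ⧸ H) (G ⧸ H) _ ((v.map (mapRingHom G ρ)).map
      (groupEval (RingHom.id (R ⧸ I))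
        (inducedMatrix H ((of (R ⧸ I) (Abelianization H)).comp Abelianization.of)))) =
      (mapRingHom _ ρ).mapMatrix (Matrix.comp ι ι (G ⧸ H) (G ⧸ H) _ (v.map (groupEval
        (RingHom.id R) (inducedMatrix H ((of R (Abelianization H)).comp Abelianization.of))))) := by
    ext1 y' y
    simp only [Matrix.comp_apply, Matrix.map_apply, groupEval_eq_sum,
      Matrix.sum_apply, Matrix.smul_apply, inducedMatrix_apply, RingHom.mapMatrix_apply, map_sum]
    refine sum_congr rfl fun g _ => ?_
    split_ifs <;> simp
  have h2 : (v.map (mapRingHom G ρ)).map (groupEval (frobenius (R ⧸ I) p) V) =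
      (groupEval ((frobenius (R ⧸ I) p).comp ρ) V').mapMatrix
        (v.map (mapDomainRingHom R (Abelianization.of (G := G)))) := by
    ext1 y' y
    simp only [Matrix.map_apply, RingHom.mapMatrix_apply, groupEval_mapRingHom,
      groupEval_mapDomain]
    rfl
  rw [h1, ← RingHom.map_det, ha, h2, ← RingHom.map_det, hab,
    (groupEval ((frobenius (R ⧸ I) p).comp ρ) V').map_one] at key
  by_contra hne
  simp [MonoidAlgebra.one_def, hne] at key

end Congruence

end DetDescent

namespace DetDescent

open MonoidAlgebra Finset
open scoped Kronecker

/-! ### Matrices over the group ring evaluated at representations -/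

section EvalMatrix

variable {R N G ι κ κ' κ₁ κ₂ : Type*} [CommRing R] [Field N] [Group G] [Fintype ι] [DecidableEq ι]
  [Fintype κ] [DecidableEq κ] [Fintype κ'] [DecidableEq κ'] [Fintype κ₁] [DecidableEq κ₁]
  [Fintype κ₂] [DecidableEq κ₂] (f : R →+* N)

/-- The evaluation of a matrix over a group ring at a representation, as a matrix over the field. -/
def evalMatrix (T : G →* Matrix κ κ N) (v : Matrix ι ι (MonoidAlgebra R G)) :
    Matrix (ι × κ) (ι × κ) N :=
  Matrix.comp ι ι κ κ N (v.map (groupEval f T))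

omit [Fintype ι] [DecidableEq ι] in
theorem evalMatrix_apply (T : G →* Matrix κ κ N) (v : Matrix ι ι (MonoidAlgebra R G))
    (i j : ι × κ) : evalMatrix f T v i j = groupEval f T (v i.1 j.1) i.2 j.2 := rfl

omit [Fintype ι] [DecidableEq ι] in
theorem evalMatrix_eq_sum [Fintype G] (T : G →* Matrix κ κ N) (v : Matrix ι ι (MonoidAlgebra R G)) :
    evalMatrix f T v = ∑ g, (v.map fun x => f (x.coeff g)) ⊗ₖ T g := by
  ext i j
  simp [evalMatrix_apply, groupEval_eq_sum, Matrix.sum_apply]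

theorem det_evalMatrix_eq_of_intertwining [Finite G] {T : G →* Matrix κ κ N}
    {T' : G →* Matrix κ' κ' N} {A : Matrix κ κ' N} {B : Matrix κ' κ N} (hAB : A * B = 1)
    (hBA : B * A = 1) (h : ∀ g, T g * A = A * T' g) (v : Matrix ι ι (MonoidAlgebra R G)) :
    (evalMatrix f T v).det = (evalMatrix f T' v).det := by
  have := Fintype.ofFinite G
  have h1 : evalMatrix f T v = ((1 : Matrix ι ι N) ⊗ₖ A) * (evalMatrix f T' v *
      ((1 : Matrix ι ι N) ⊗ₖ B)) := by
    simp only [evalMatrix_eq_sum, Matrix.sum_mul, Matrix.mul_sum, ← Matrix.mul_kronecker_mul,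
      Matrix.mul_one, Matrix.one_mul]
    refine sum_congr rfl fun g _ => ?_
    rw [← Matrix.mul_assoc, ← h, Matrix.mul_assoc, hAB, Matrix.mul_one]
  have h2 : ((1 : Matrix ι ι N) ⊗ₖ A) * ((1 : Matrix ι ι N) ⊗ₖ B) = 1 := by
    rw [← Matrix.mul_kronecker_mul, hAB, Matrix.mul_one, Matrix.one_kronecker_one]
  have h3 : ((1 : Matrix ι ι N) ⊗ₖ B) * ((1 : Matrix ι ι N) ⊗ₖ A) = 1 := by
    rw [← Matrix.mul_kronecker_mul, hBA, Matrix.mul_one, Matrix.one_kronecker_one]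
  rw [h1, Matrix.det_comm' h2 h3, Matrix.mul_assoc, h3, Matrix.mul_one]

/-- The direct sum of two representations. -/
def sumHom (T₁ : G →* Matrix κ₁ κ₁ N) (T₂ : G →* Matrix κ₂ κ₂ N) :
    G →* Matrix (κ₁ ⊕ κ₂) (κ₁ ⊕ κ₂) N where
  toFun g := Matrix.fromBlocks (T₁ g) 0 0 (T₂ g)
  map_one' := by simp
  map_mul' g h := by simp [Matrix.fromBlocks_multiply]

theorem det_evalMatrix_sumHom [Finite G] (T₁ : G →* Matrix κ₁ κ₁ N) (T₂ : G →* Matrix κ₂ κ₂ N)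
    (v : Matrix ι ι (MonoidAlgebra R G)) :
    (evalMatrix f (sumHom T₁ T₂) v).det = (evalMatrix f T₁ v).det * (evalMatrix f T₂ v).det := by
  have := Fintype.ofFinite G
  rw [← Matrix.det_fromBlocks_zero₂₁ _ 0,
    ← Matrix.det_submatrix_equiv_self (Equiv.prodSumDistrib ι κ₁ κ₂).symm]
  congr 1
  ext (i | i) (j | j) <;>
    simp [evalMatrix_eq_sum, Matrix.sum_apply, sumHom]

theorem exists_fin_det_evalMatrix_eq [Finite G] (T : G →* Matrix κ κ N) :
    ∃ (d : ℕ) (φ : Matrix κ κ N →* Matrix (Fin d) (Fin d) N),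
      ∀ v : Matrix ι ι (MonoidAlgebra R G),
        (evalMatrix f T v).det = (evalMatrix f (φ.comp T) v).det := by
  have := Fintype.ofFinite G
  let e := Fintype.equivFin κ
  refine ⟨_, (Matrix.reindexAlgEquiv N N e).toMulEquiv.toMonoidHom, fun v => ?_⟩
  rw [← Matrix.det_submatrix_equiv_self (Equiv.prodCongr (Equiv.refl ι) e.symm)]
  congr 1
  ext i j
  simp [evalMatrix_eq_sum, Matrix.sum_apply]

/-- A matrix commuting with a representation and not scalar, of finite order, splits it. -/
theorem exists_det_evalMatrix_eq_mul [Finite G] {m d : ℕ} {ζ : N} (hm : (m : N) ≠ 0)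
    (hζ : IsPrimitiveRoot ζ m) (T : G →* Matrix (Fin d) (Fin d) N) (c : Matrix (Fin d) (Fin d) N)
    (hc : c ^ m = 1) (hcT : ∀ g, Commute (T g) c) (hns : ∀ μ : N, c ≠ μ • 1) :
    ∃ d₁ < d, ∃ d₂ < d, ∃ (T₁ : G →* Matrix (Fin d₁) (Fin d₁) N)
      (T₂ : G →* Matrix (Fin d₂) (Fin d₂) N),
      (∀ g h, T g = T h → T₁ g = T₁ h ∧ T₂ g = T₂ h) ∧ ∀ v : Matrix ι ι (MonoidAlgebra R G),
      (evalMatrix f T v).det = (evalMatrix f T₁ v).det * (evalMatrix f T₂ v).det := by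
  have hm0 : m ≠ 0 := by rintro rfl; simp at hm
  have hζ0 : ζ ≠ 0 := hζ.ne_zero hm0
  have hpow (j : ℕ) : (ζ ^ j • c) ^ m = 1 := by
    rw [smul_pow, hc, ← pow_mul, mul_comm, pow_mul, hζ.pow_eq_one, one_pow, one_smul]
  -- The spectral projections of `c` sum to 1, so one is nonzero; it is not 1, as `c` would then be
  -- scalar. This makes both summands proper.
  obtain ⟨j, hj⟩ : ∃ j, cycAverage (K := N) m (ζ ^ j • c) ≠ 0 := by
    by_contra! h
    have h1 := sum_cycAverage (c := c) hm hζ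
    rw [sum_eq_zero fun j _ => h j] at h1
    refine hns 0 ?_
    rw [← Matrix.mul_one c, ← h1]
    simp
  set e := cycAverage (K := N) m (ζ ^ j • c) with he
  have hee : e * e = e := cycAverage_mul_self hm (hpow j)
  have he1 : e ≠ 1 := fun h => by
    have h1 := mul_cycAverage (K := N) (hpow j)
    rw [← he, h, mul_one] at h1
    refine hns (ζ ^ j)⁻¹ ?_
    rw [← h1, smul_smul, inv_mul_cancel₀ (pow_ne_zero _ hζ0), one_smul]
  have heT (g : G) : Commute (T g) e := ((hcT g).smul_right _).cycAverage_right
  obtain ⟨r₁, A₁, B₁, T₁, hAB₁, hBA₁, hT₁⟩ := exists_compression T e hee heT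
  obtain ⟨r₂, A₂, B₂, T₂, hAB₂, hBA₂, hT₂⟩ := exists_compression T (1 - e)
    (by rw [mul_sub, sub_mul, sub_mul, hee]; simp) fun g => (Commute.one_right _).sub_right (heT g)
  have h12 : B₁ * A₂ = 0 := by
    calc B₁ * A₂ = (B₁ * A₁ * B₁) * (A₂ * (B₂ * A₂)) := by
          rw [hBA₁, hBA₂, Matrix.one_mul, Matrix.mul_one]
      _ = B₁ * ((A₁ * B₁) * (A₂ * B₂)) * A₂ := by simp only [Matrix.mul_assoc]
      _ = 0 := by rw [hAB₁, hAB₂, mul_sub, mul_one, hee, sub_self, Matrix.mul_zero, Matrix.zero_mul]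
  have h21 : B₂ * A₁ = 0 := by
    calc B₂ * A₁ = (B₂ * A₂ * B₂) * (A₁ * (B₁ * A₁)) := by
          rw [hBA₁, hBA₂, Matrix.one_mul, Matrix.mul_one]
      _ = B₂ * ((A₂ * B₂) * (A₁ * B₁)) * A₁ := by simp only [Matrix.mul_assoc]
      _ = 0 := by rw [hAB₁, hAB₂, sub_mul, one_mul, hee, sub_self, Matrix.mul_zero, Matrix.zero_mul]
  let A := Matrix.fromCols A₁ A₂
  let B := Matrix.fromRows B₁ B₂
  have hAB : A * B = 1 := by
    rw [Matrix.fromCols_mul_fromRows, hAB₁, hAB₂, add_sub_cancel]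
  have hBA : B * A = 1 := by
    rw [Matrix.fromRows_mul_fromCols, hBA₁, hBA₂, h12, h21, Matrix.fromBlocks_one]
  have hd : d = r₁ + r₂ := by
    simpa using Matrix.square_of_invertible A B hAB hBA
  have hr₁ : r₁ ≠ 0 := by
    rintro rfl
    exact hj (by rw [← hAB₁]; ext; simp [Matrix.mul_apply])
  have hr₂ : r₂ ≠ 0 := by
    rintro rfl
    refine he1 (sub_eq_zero.1 ?_).symm
    rw [← hAB₂]; ext; simp [Matrix.mul_apply]
  refine ⟨r₁, by omega, r₂, by omega, T₁, T₂, fun g h hgh => ?_, fun v => ?_⟩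
  · rw [hT₁, hT₂, hgh, ← hT₁, ← hT₂]
    exact ⟨rfl, rfl⟩
  rw [← det_evalMatrix_sumHom]
  refine det_evalMatrix_eq_of_intertwining f hAB hBA (fun g => ?_) v
  change T g * Matrix.fromCols A₁ A₂ = Matrix.fromCols A₁ A₂ * Matrix.fromBlocks _ _ _ _
  rw [Matrix.mul_fromCols, Matrix.fromCols_mul_fromBlocks, hT₁, hT₂]
  simp only [Matrix.mul_zero, add_zero, zero_add]
  congr 1
  · calc T g * A₁ = T g * (A₁ * (B₁ * A₁)) := by rw [hBA₁, Matrix.mul_one]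
      _ = T g * e * A₁ := by rw [← hAB₁]; simp only [Matrix.mul_assoc]
      _ = _ := by rw [(heT g).eq, ← hAB₁]; simp only [Matrix.mul_assoc]
  · calc T g * A₂ = T g * (A₂ * (B₂ * A₂)) := by rw [hBA₂, Matrix.mul_one]
      _ = T g * (1 - e) * A₂ := by rw [← hAB₂]; simp only [Matrix.mul_assoc]
      _ = _ := by
        rw [((Commute.one_right _).sub_right (heT g)).eq, ← hAB₂]; simp only [Matrix.mul_assoc]

/-- The scalars form a linear character, which factors through G^ab; the determinant is a power of
its value at the determinant over the abelianized group ring. -/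
theorem det_evalMatrix_eq_one_of_scalar [Finite G] (T : G →* Matrix κ κ N)
    (hT : ∀ g, ∃ μ : N, T g = μ • 1) (v : Matrix ι ι (MonoidAlgebra R G))
    (hab : (v.map (mapDomainRingHom R (Abelianization.of (G := G)))).det = 1) :
    (evalMatrix f T v).det = 1 := by
  have := Fintype.ofFinite G
  rcases isEmpty_or_nonempty κ with hκ | ⟨⟨k⟩⟩
  · exact Matrix.det_isEmpty
  choose μ hμ using hT
  have hμ' (g : G) : μ g = T g k k := by rw [hμ g]; simp
  let χ : G →* N :=
    { toFun := μ
      map_one' := by rw [hμ']; simp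
      map_mul' := fun g h => by
        rw [hμ', map_mul, hμ g, hμ h]
        simp [mul_comm] }
  have h1 : evalMatrix f T v = (v.map (groupEval f χ)) ⊗ₖ (1 : Matrix κ κ N) := by
    ext i j
    simp [evalMatrix_eq_sum, Matrix.sum_apply, groupEval_eq_sum, hμ, χ,
      Finset.sum_mul, mul_assoc]
  have h2 : v.map (groupEval f χ) = (groupEval f
      ((Units.coeHom N).comp (Abelianization.lift χ.toHomUnits))).mapMatrix
      (v.map (mapDomainRingHom R (Abelianization.of (G := G)))) := by
    ext1 i j
    simp only [Matrix.map_apply, RingHom.mapMatrix_apply, groupEval_mapDomain]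
    rfl
  rw [h1, Matrix.det_kronecker, h2, ← RingHom.map_det, hab, map_one, Matrix.det_one, one_pow,
    one_pow, one_mul]

/-- Split off spectral projections of a nonscalar T(z) until only scalar matrices remain. The
relations T(gh) = T(hg) pass to the summands. -/
theorem det_evalMatrix_eq_one_of_commute [Finite G] {m : ℕ} {ζ : N} (hm : (m : N) ≠ 0)
    (hζ : IsPrimitiveRoot ζ m) (hG : Nat.card G ∣ m) (T : G →* Matrix κ κ N)
    (hT : ∀ g h, Commute (T g) (T h)) (v : Matrix ι ι (MonoidAlgebra R G))
    (hab : (v.map (mapDomainRingHom R (Abelianization.of (G := G)))).det = 1) :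
    (evalMatrix f T v).det = 1 := by
  have key (d : ℕ) : ∀ T : G →* Matrix (Fin d) (Fin d) N, (∀ g h, Commute (T g) (T h)) →
      (evalMatrix f T v).det = 1 := by
    induction d using Nat.strong_induction_on with
    | _ d ih =>
    intro T hT
    by_cases hs : ∀ g, ∃ μ : N, T g = μ • 1
    · exact det_evalMatrix_eq_one_of_scalar f T hs v hab
    · push Not at hs
      obtain ⟨z, hz⟩ := hs
      obtain ⟨d₁, h₁, d₂, h₂, T₁, T₂, h, h'⟩ := exists_det_evalMatrix_eq_mul (ι := ι) f hm hζ T (T z)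
        (by rw [← map_pow, orderOf_dvd_iff_pow_eq_one.1 ((orderOf_dvd_natCard z).trans hG), map_one])
        (fun g => hT g z) hz
      have hcomm (a b : G) : T (a * b) = T (b * a) := by rw [map_mul, map_mul, (hT a b).eq]
      rw [h', ih d₁ h₁ T₁ fun a b => ?_, ih d₂ h₂ T₂ fun a b => ?_, one_mul]
      · rw [Commute, SemiconjBy, ← map_mul, ← map_mul, (h _ _ (hcomm a b)).2]
      · rw [Commute, SemiconjBy, ← map_mul, ← map_mul, (h _ _ (hcomm a b)).1]
  obtain ⟨d, φ, h⟩ := exists_fin_det_evalMatrix_eq (ι := ι) f T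
  rw [h]
  exact key d _ fun a b => (hT a b).map φ

end EvalMatrix

/-! ### Restriction of matrices and induction of representations -/

section Restriction

variable {R N G : Type*} [CommRing R] [Group G] [Finite G] (H : Subgroup G) [Fintype (G ⧸ H)]
  [DecidableEq (G ⧸ H)] {ι κ : Type*}

/-- A matrix over `R[G]`, as a matrix over `R[H]`. -/
def restrictMatrix (v : Matrix ι ι (MonoidAlgebra R G)) :
    Matrix (ι × (G ⧸ H)) (ι × (G ⧸ H)) (MonoidAlgebra R H) :=
  Matrix.comp ι ι _ _ _ (v.map (groupEval (RingHom.id R) (inducedMatrix H (of R H))))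

theorem groupEval_restrictMatrix [CommRing N] {B : Type*} [Ring B] [Algebra N B] (f : R →+* N)
    (τ : H →* B) (v : Matrix ι ι (MonoidAlgebra R G)) :
    (restrictMatrix H v).map (groupEval f τ) =
      Matrix.comp ι ι _ _ _ (v.map (groupEval f (inducedMatrix H τ))) := by
  have := Fintype.ofFinite G
  ext1 i j
  simp only [restrictMatrix, Matrix.comp_apply, Matrix.map_apply]
  rw [groupEval_eq_sum (RingHom.id R) (inducedMatrix H (of R H)),
    groupEval_eq_sum f (inducedMatrix H τ), Matrix.sum_apply, Matrix.sum_apply, map_sum]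
  refine sum_congr rfl fun g _ => ?_
  simp only [Matrix.smul_apply, inducedMatrix_apply]
  split_ifs
  · simp [groupEval_single]
  · simp

theorem mapDomain_eq_groupEval {H A : Type*} [Group H] [Group A] (φ : H →* A)
    (x : MonoidAlgebra R H) :
    mapDomainRingHom R φ x = groupEval (RingHom.id R) ((of R A).comp φ) x := by
  induction x using MonoidAlgebra.induction_linear with
  | zero => simp
  | add a b ha hb => simp only [map_add, ha, hb]
  | single g r => simp [groupEval_single]

variable [Field N] [Fintype κ] [DecidableEq κ]

/-- Induced representations, in matrix form. -/
def inducedHom (T : H →* Matrix κ κ N) : G →* Matrix ((G ⧸ H) × κ) ((G ⧸ H) × κ) N :=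
  (Matrix.compRingEquiv (G ⧸ H) κ N).toMulEquiv.toMonoidHom.comp (inducedMatrix H T)

omit [Finite G] in
theorem inducedHom_apply (T : H →* Matrix κ κ N) (g : G) (i j : (G ⧸ H) × κ) :
    inducedHom H T g i j = if i.1 = g • j.1 then T (cosetFactor H g j.1) i.2 j.2 else 0 := by
  change inducedMatrix H T g i.1 j.1 i.2 j.2 = _
  rw [inducedMatrix_apply]
  split_ifs <;> rfl

variable [Fintype ι] [DecidableEq ι]

/-- Both sides are the same block matrix with its three indices bracketed differently. Induction of
T is traded for restriction of v, at the price of enlarging the index set from ι to ι × G/H. -/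
theorem det_evalMatrix_inducedHom (f : R →+* N) (T : H →* Matrix κ κ N)
    (v : Matrix ι ι (MonoidAlgebra R G)) :
    (evalMatrix f (inducedHom H T) v).det = (evalMatrix f T (restrictMatrix H v)).det := by
  have := Fintype.ofFinite G
  change _ = (Matrix.comp _ _ _ _ N ((restrictMatrix H v).map (groupEval f T))).det
  rw [groupEval_restrictMatrix,
    ← Matrix.det_submatrix_equiv_self (Equiv.prodAssoc ι (G ⧸ H) κ)]
  congr 1
  ext ⟨⟨a, i⟩, k⟩ ⟨⟨b, j⟩, l⟩
  simp only [Matrix.submatrix_apply, Equiv.prodAssoc_apply, evalMatrix_apply, Matrix.comp_apply,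
    Matrix.map_apply]
  rw [groupEval_eq_sum, groupEval_eq_sum, Matrix.sum_apply, Matrix.sum_apply, Matrix.sum_apply]
  rfl

end Restriction

end DetDescent

namespace DetDescent

open MonoidAlgebra Finset

/-! ### Recognizing induced representations -/

section Clifford

variable {N G : Type*} [Field N] [Group G] [Finite G]

theorem mul_cycAverage_of_smul {A : Type*} [Ring A] [Algebra N A] {x c : A} {s : N}
    (h : x * c = s • (c * x)) (m : ℕ) :
    x * cycAverage (K := N) m c = cycAverage (K := N) m (s • c) * x := by
  have h1 : SemiconjBy x c (s • c) := by rw [SemiconjBy, h, smul_mul_assoc]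
  rw [cycAverage, cycAverage, mul_smul_comm, smul_mul_assoc, mul_sum, sum_mul]
  exact congrArg _ (sum_congr rfl fun i _ => h1.pow_right i)

omit [Finite G] in
/-- The sum of a function of `lam g` over the cosets of the kernel of a linear character `lam` of
prime order. -/
theorem sum_quotient_ker {p : ℕ} (lam : G →* N) [Fintype (G ⧸ lam.ker)]
    (hH : Nat.card (G ⧸ lam.ker) = p) {g₀ : G} (hg₀ : IsPrimitiveRoot (lam g₀) p)
    {A : Type*} [AddCommMonoid A] (φ : N → A) :
    ∑ i : G ⧸ lam.ker, φ (lam i.out) = ∑ k ∈ range p, φ (lam g₀ ^ k) := by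
  have hout (g : G) : lam (g : G ⧸ lam.ker).out = lam g := by
    have h1 : g⁻¹ * (g : G ⧸ lam.ker).out ∈ lam.ker := by
      rw [← QuotientGroup.eq, QuotientGroup.out_eq']
    rw [MonoidHom.mem_ker] at h1
    calc lam (g : G ⧸ lam.ker).out = lam g * lam (g⁻¹ * (g : G ⧸ lam.ker).out) := by
          rw [← map_mul, mul_inv_cancel_left]
      _ = lam g := by rw [h1, mul_one]
  let e : Fin p → G ⧸ lam.ker := fun k => ((g₀ ^ (k : ℕ) : G) : G ⧸ lam.ker)
  have he : Function.Bijective e := by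
    rw [Fintype.bijective_iff_injective_and_card]
    refine ⟨fun k l h => ?_, by rw [Fintype.card_fin, ← Nat.card_eq_fintype_card, hH]⟩
    have h1 : lam (e k).out = lam (e l).out := by rw [h]
    rw [hout, hout, map_pow, map_pow] at h1
    exact Fin.ext (hg₀.pow_inj k.2 l.2 h1)
  rw [← he.sum_comp, ← Fin.sum_univ_eq_sum_range (fun k => φ (lam g₀ ^ k))]
  exact sum_congr rfl fun k _ => by rw [hout, map_pow]

variable {R ι : Type*} [CommRing R] [Fintype ι] [DecidableEq ι]

/-- If `T` is twisted by a linear character of prime order under conjugation by a matrix, it is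
induced from the kernel of that character. -/
theorem exists_det_evalMatrix_eq_restrict (f : R →+* N) {p : ℕ}
    (hp0 : (p : N) ≠ 0) {d : ℕ} (T : G →* Matrix (Fin d) (Fin d) N) (lam : G →* N)
    [Fintype (G ⧸ lam.ker)] [DecidableEq (G ⧸ lam.ker)] (hH : Nat.card (G ⧸ lam.ker) = p)
    {g₀ : G} (hg₀ : IsPrimitiveRoot (lam g₀) p) (c : Matrix (Fin d) (Fin d) N) (hc : c ^ p = 1)
    (hcT : ∀ g, T g * c = lam g • (c * T g)) :
    ∃ (r : ℕ) (T' : lam.ker →* Matrix (Fin r) (Fin r) N), ∀ v : Matrix ι ι (MonoidAlgebra R G),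
      (evalMatrix f T v).det = (evalMatrix f T' (restrictMatrix lam.ker v)).det := by
  -- Projection onto the fixed space of `c`. By the twist relation T(g) carries it to the spectral
  -- projection of λ(g)c, so only ker λ preserves it.
  set E := cycAverage (K := N) p c with hE
  have hEE : E * E = E := cycAverage_mul_self hp0 hc
  have hcE : c * E = E := mul_cycAverage hc
  have hEc : E * c = E := by rw [← ((Commute.refl c).cycAverage_right : Commute c E).eq, hcE]
  have hTE (g : G) : T g * E = cycAverage (K := N) p (lam g • c) * T g :=
    mul_cycAverage_of_smul (hcT g) p
  have hTE' (g : G) (hg : lam g = 1) : T g * E = E * T g := by rw [hTE, hg, one_smul]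
  -- Inserting `c` next to `E` changes nothing on either side, but moving it past T(g) costs the
  -- factor λ(g) ≠ 1.
  have horth (g : G) (hg : lam g ≠ 1) : E * T g * E = 0 := by
    have h1 : E * T g * E = lam g • (E * T g * E) := by
      calc E * T g * E = E * (T g * c) * E := by rw [mul_assoc, mul_assoc E, mul_assoc, hcE]
        _ = lam g • (E * T g * E) := by
          rw [hcT, mul_smul_comm, smul_mul_assoc, ← mul_assoc, hEc]
    have h2 : (1 - lam g) • (E * T g * E) = 0 := by rw [sub_smul, one_smul, ← h1, sub_self]
    exact (smul_eq_zero.1 h2).resolve_left (sub_ne_zero.2 (Ne.symm hg))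
  obtain ⟨r, A, B, T', hAB, hBA, hT'⟩ := exists_compression (T.comp lam.ker.subtype) E hEE
    fun g => hTE' g g.2
  have hEA : E * A = A := by rw [← hAB, Matrix.mul_assoc, hBA, Matrix.mul_one]
  have hBE : B * E = B := by rw [← hAB, ← Matrix.mul_assoc, hBA, Matrix.one_mul]
  -- The translates of the image of `E` by coset representatives, side by side. Their projections
  -- sum to 1 because λ takes each p-th root of unity on exactly one coset.
  let P : Matrix (Fin d) ((G ⧸ lam.ker) × Fin r) N := Matrix.of fun a x => (T x.1.out * A) a x.2
  let Q : Matrix ((G ⧸ lam.ker) × Fin r) (Fin d) N := Matrix.of fun x a => (B * T x.1.out⁻¹) x.2 a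
  have hPQ : P * Q = 1 := by
    have h1 : P * Q = ∑ i : G ⧸ lam.ker, cycAverage (K := N) p (lam i.out • c) := by
      have h2 (i : G ⧸ lam.ker) : cycAverage (K := N) p (lam i.out • c) =
          (T i.out * A) * (B * T i.out⁻¹) := by
        rw [Matrix.mul_assoc, ← Matrix.mul_assoc A, hAB, ← Matrix.mul_assoc, hTE, mul_assoc,
          ← map_mul, mul_inv_cancel, map_one, mul_one]
      simp only [h2]
      ext a b
      rw [Matrix.mul_apply, Fintype.sum_prod_type, Matrix.sum_apply]
      exact sum_congr rfl fun i _ => by rw [Matrix.mul_apply]; rfl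
    rw [h1, sum_quotient_ker lam hH hg₀ fun μ => cycAverage (K := N) p (μ • c),
      sum_cycAverage hp0 hg₀]
  have hQP : Q * P = 1 := by
    ext ⟨i, k⟩ ⟨j, l⟩
    have h1 : (Q * P) (i, k) (j, l) = (B * T i.out⁻¹ * (T j.out * A)) k l := by
      rw [Matrix.mul_apply, Matrix.mul_apply]
      rfl
    have h2 : B * T i.out⁻¹ * (T j.out * A) = B * T (i.out⁻¹ * j.out) * A := by
      rw [map_mul]; simp only [Matrix.mul_assoc]
    rw [h1, h2]
    by_cases hij : i = j
    · subst hij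
      rw [inv_mul_cancel, map_one, Matrix.mul_one, hBA, Matrix.one_apply, Matrix.one_apply]
      simp
    · have h3 : lam (i.out⁻¹ * j.out) ≠ 1 := fun h => hij (by
        rw [← QuotientGroup.out_eq' i, ← QuotientGroup.out_eq' j, QuotientGroup.eq]
        exact h)
      have h4 : B * T (i.out⁻¹ * j.out) * A = 0 := by
        calc _ = (B * E) * T (i.out⁻¹ * j.out) * (E * A) := by rw [hBE, hEA]
          _ = B * (E * T (i.out⁻¹ * j.out) * E) * A := by simp only [Matrix.mul_assoc]
          _ = 0 := by rw [horth _ h3, Matrix.mul_zero, Matrix.zero_mul]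
      rw [h4, Matrix.one_apply_ne (fun h => hij (congrArg Prod.fst h)), Matrix.zero_apply]
  refine ⟨r, T', fun v => ?_⟩
  rw [← det_evalMatrix_inducedHom]
  refine det_evalMatrix_eq_of_intertwining f hPQ hQP (fun g => ?_) v
  ext a ⟨i, l⟩
  have h1 : (T g * P) a (i, l) = (T g * (T i.out * A)) a l := by
    rw [Matrix.mul_apply, Matrix.mul_apply]
    rfl
  have h2 : (P * inducedHom lam.ker T' g) a (i, l) =
      ((T (g • i).out * A) * T' (cosetFactor lam.ker g i)) a l := by
    rw [Matrix.mul_apply, Matrix.mul_apply, Fintype.sum_prod_type, sum_eq_single (g • i)]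
    · exact sum_congr rfl fun k _ => by rw [inducedHom_apply, if_pos rfl]; rfl
    · exact fun j _ hj => sum_eq_zero fun k _ => by
        rw [inducedHom_apply, if_neg hj, mul_zero]
    · simp
  rw [h1, h2]
  refine congrFun (congrFun ?_ a) l
  have h3 : (cosetFactor lam.ker g i : G) = (g • i).out⁻¹ * (g * i.out) := rfl
  have h4 : T (cosetFactor lam.ker g i : G) * E = E * T (cosetFactor lam.ker g i : G) :=
    hTE' _ (cosetFactor lam.ker g i).2
  rw [hT']
  change _ = T (g • i).out * A * (B * T (cosetFactor lam.ker g i : G) * A)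
  calc T g * (T i.out * A) = T (g • i).out * T (cosetFactor lam.ker g i : G) * A := by
        rw [← Matrix.mul_assoc, ← map_mul, ← map_mul, h3, mul_inv_cancel_left]
    _ = T (g • i).out * (T (cosetFactor lam.ker g i : G) * E) * A := by
        simp only [Matrix.mul_assoc, hEA]
    _ = T (g • i).out * (A * B * T (cosetFactor lam.ker g i : G)) * A := by rw [h4, hAB]
    _ = _ := by simp only [Matrix.mul_assoc]

end Clifford

/-! ### Twisting characters from the centre of a quotient -/

section Twist

variable {N G : Type*} [Field N] [Group G] [Finite G]

/-- An irreducible nonabelian representation of a `p`-group is twisted by a linear character of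
order `p` under conjugation by some group element. -/
theorem exists_twist {p : ℕ} [hp : Fact p.Prime] (hG : IsPGroup p G) {d : ℕ}
    (T : G →* Matrix (Fin d) (Fin d) N)
    (hns : ∀ z, (∀ g, Commute (T g) (T z)) → ∃ μ : N, T z = μ • 1)
    (hnc : ¬ ∀ g h, Commute (T g) (T h)) :
    ∃ (a : G) (lam : G →* N) (g₀ : G), (∀ g, T g * T a = lam g • (T a * T g)) ∧
      (∀ g, lam g ^ p = 1) ∧ IsPrimitiveRoot (lam g₀) p ∧ Nat.card (G ⧸ lam.ker) = p := by
  have hinv (g : G) : T g * T g⁻¹ = 1 := by rw [← map_mul, mul_inv_cancel, map_one]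
  have hinv' (g : G) : T g⁻¹ * T g = 1 := by rw [← map_mul, inv_mul_cancel, map_one]
  have hd : Nonempty (Fin d) := by
    by_contra h
    rw [not_nonempty_iff] at h
    exact hnc fun g h => Subsingleton.elim _ _
  have hcancel {s t : N} {g : G} (h : s • T g = t • T g) : s = t := by
    have h1 := congrArg (fun X => (X * T g⁻¹) hd.some hd.some) h
    simpa [hinv] using h1
  -- The elements acting by central, hence scalar, matrices. A nontrivial central class aZ in the
  -- p-group G/Z has all its commutators with G in Z, and their scalars form the linear character by
  -- which T(a) twists T.
  let Z : Subgroup G :=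
    { carrier := {g | ∀ h, Commute (T h) (T g)}
      one_mem' := fun h => by rw [map_one]; exact Commute.one_right _
      mul_mem' := fun ha hb h => by rw [map_mul]; exact (ha h).mul_right (hb h)
      inv_mem' := fun {g} hg h => by
        have h1 := (hg h).eq
        calc T h * T g⁻¹ = T g⁻¹ * (T g * T h) * T g⁻¹ := by
              rw [← mul_assoc, hinv', one_mul]
          _ = T g⁻¹ * T h := by rw [← h1, mul_assoc, mul_assoc, hinv, mul_one] }
  have hZ : Z.Normal := ⟨fun z hz g h => by
    have h1 : T (g * z * g⁻¹) = T z := by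
      rw [map_mul, map_mul, (hz g).eq, mul_assoc, hinv, mul_one]
    rw [h1]
    exact hz h⟩
  have : Nontrivial (G ⧸ Z) := by
    by_contra h
    rw [not_nontrivial_iff_subsingleton] at h
    exact hnc fun g h => (QuotientGroup.eq_one_iff (N := Z) h).1 (Subsingleton.elim _ _) g
  have hpc := (hG.to_quotient Z).center_nontrivial
  obtain ⟨⟨b, hbc⟩, hb1⟩ := exists_ne (1 : Subgroup.center (G ⧸ Z))
  obtain ⟨a, rfl⟩ := QuotientGroup.mk_surjective b
  have haZ : a ∉ Z := fun h => hb1 (Subtype.ext ((QuotientGroup.eq_one_iff a).2 h))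
  have hcomm (g : G) : ∃ μ : N, T (g * a * g⁻¹ * a⁻¹) = μ • 1 := by
    refine hns _ fun h => ?_
    have h1 : g * a * g⁻¹ * a⁻¹ ∈ Z := by
      rw [← QuotientGroup.eq_one_iff]
      have h2 := Subgroup.mem_center_iff.1 hbc (g : G ⧸ Z)
      rw [QuotientGroup.mk_mul, QuotientGroup.mk_mul, QuotientGroup.mk_mul, h2]
      simp
    exact h1 h
  choose μ hμ using hcomm
  have htw (g : G) : T g * T a = μ g • (T a * T g) := by
    have h1 : g * a = (g * a * g⁻¹ * a⁻¹) * (a * g) := by group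
    rw [← map_mul, h1, map_mul, hμ, smul_mul_assoc, one_mul, map_mul]
  let lam₀ : G →* N :=
    { toFun := μ
      map_one' := hcancel (g := a) (by
        have := htw 1
        rw [map_one, one_mul, mul_one] at this
        rw [← this, one_smul])
      map_mul' := fun g h => hcancel (g := a * (g * h)) (by
        rw [map_mul, ← htw, map_mul, mul_assoc, htw h, mul_smul_comm, ← mul_assoc, htw g,
          smul_mul_assoc, smul_smul, mul_comm, mul_assoc]) }
  have hpowtw (k : ℕ) (g : G) : T g * T (a ^ k) = (lam₀ ^ k) g • (T (a ^ k) * T g) := by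
    induction k with
    | zero => simp
    | succ k ih =>
      rw [pow_succ a, map_mul, ← mul_assoc, ih, smul_mul_assoc, mul_assoc, htw, mul_smul_comm,
        smul_smul, ← mul_assoc, pow_succ, MonoidHom.mul_apply]
      rfl
  -- The twisting character has p-power order; replacing a by a suitable p-power of itself lowers
  -- the order to exactly p. The order is not 1, since a is not in Z.
  have hex : ∃ m, lam₀ ^ p ^ m = 1 := by
    obtain ⟨e, he⟩ := IsPGroup.iff_card.1 hG
    refine ⟨e, MonoidHom.ext fun g => ?_⟩
    rw [MonoidHom.pow_apply, ← map_pow, ← he, pow_card_eq_one', map_one, MonoidHom.one_apply]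
  classical
  obtain ⟨m, hm, hmin⟩ : ∃ m, lam₀ ^ p ^ m = 1 ∧ ∀ l < m, lam₀ ^ p ^ l ≠ 1 :=
    ⟨Nat.find hex, Nat.find_spec hex, fun l hl => Nat.find_min hex hl⟩
  obtain ⟨l, rfl⟩ : ∃ l, m = l + 1 := by
    refine Nat.exists_eq_succ_of_ne_zero ?_
    rintro rfl
    refine haZ fun g => ?_
    have h1 := htw g
    have h2 : μ g = 1 := by
      rw [pow_zero, pow_one] at hm
      exact DFunLike.congr_fun hm g
    rwa [h2, one_smul] at h1
  obtain ⟨g₀, hg₀⟩ : ∃ g₀, (lam₀ ^ p ^ l) g₀ ≠ 1 := by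
    by_contra! h
    exact hmin l l.lt_succ_self (MonoidHom.ext h)
  have hp1 (g : G) : (lam₀ ^ p ^ l) g ^ p = 1 := by
    rw [← MonoidHom.pow_apply, ← pow_mul, ← pow_succ, hm, MonoidHom.one_apply]
  set lam := lam₀ ^ p ^ l with hlam
  have hprim : IsPrimitiveRoot (lam g₀) p := by
    rw [← orderOf_eq_prime (hp1 g₀) hg₀]
    exact IsPrimitiveRoot.orderOf _
  refine ⟨a ^ p ^ l, lam, g₀, hpowtw _, hp1, hprim, ?_⟩
  have hker : lam.ker = lam.toHomUnits.ker := by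
    ext g
    rw [MonoidHom.mem_ker, MonoidHom.mem_ker, Units.ext_iff]
    rfl
  have hprim' : IsPrimitiveRoot (lam.toHomUnits g₀) p := IsPrimitiveRoot.coe_units_iff.1 hprim
  have hrange : lam.toHomUnits.range = Subgroup.zpowers (lam.toHomUnits g₀) := by
    refine le_antisymm ?_ ?_
    · rw [hprim'.zpowers_eq]
      rintro _ ⟨g, rfl⟩
      rw [mem_rootsOfUnity, Units.ext_iff]
      exact hp1 g
    · rw [Subgroup.zpowers_le]
      exact ⟨g₀, rfl⟩
  change lam.ker.index = p
  rw [hker, Subgroup.index_ker, hrange, Nat.card_zpowers, ← hprim'.eq_orderOf]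

end Twist

end DetDescent

namespace DetDescent

open MonoidAlgebra Finset

universe u

/-! ### Torsion freeness by induction on the group -/

section TorsionFree

variable (p : ℕ) [hp : Fact p.Prime] {R N : Type*} [CommRing R] [NormedField N]
  [NormedAlgebra ℚ_[p] N] [IsUltrametricDist N]

omit [IsUltrametricDist N] in
theorem not_isUnit_natCast_of_norm_le {f : R →+* N} (hf : ∀ r, ‖f r‖ ≤ 1) :
    ¬ IsUnit (p : R) := by
  intro h
  obtain ⟨y, hy⟩ := h.exists_right_inv
  have h1 : ‖f p‖ * ‖f y‖ = 1 := by rw [← norm_mul, ← map_mul, hy, map_one, norm_one]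
  have h2 : ‖f p‖ < 1 := by rw [map_natCast]; exact norm_prime_lt_one p
  nlinarith [hf y, norm_nonneg (f p), norm_nonneg (f y)]

/-- The permutation representation on G/H factors through this cyclic group. It computes the
augmentation of the restricted determinant. -/
theorem commute_inducedMatrix_one {G B : Type*} [Group G] [Semiring B] (H : Subgroup G) [H.Normal]
    [Fintype (G ⧸ H)] [DecidableEq (G ⧸ H)] (hH : Nat.card (G ⧸ H) = p) (g h : G) :
    Commute (inducedMatrix H (1 : H →* B) g) (inducedMatrix H 1 h) := by
  have hcyc : IsCyclic (G ⧸ H) := isCyclic_of_prime_card hH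
  rw [Commute, SemiconjBy, ← map_mul, ← map_mul]
  ext j i
  have h1 : (g * h) • i = (h * g) • i := by
    induction i using QuotientGroup.induction_on with
    | H b =>
      have h2 : (g : G ⧸ H) * h = h * g := IsCyclic.isMulCommutative.is_comm.comm _ _
      calc ((g * h * b : G) : G ⧸ H) = (g : G ⧸ H) * h * b := rfl
        _ = h * g * b := by rw [h2]
  simp only [inducedMatrix_apply, h1, MonoidHom.one_apply]

variable {f : R →+* N} (hinj : Function.Injective f) (hf : ∀ r, ‖f r‖ ≤ 1) {n : ℕ} {ζ : N}
  (hζ : IsPrimitiveRoot ζ n) (hn0 : n ≠ 0)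

include hinj hf hζ hn0 in
/-- Restriction to a subgroup of index `p` preserves the triviality of the abelianized
determinant, for matrices with torsion determinants. -/
theorem det_restrictMatrix_abelianization_eq_one {G ι : Type*} [Group G] [Finite G]
    (hG : IsPGroup p G) (hn : Nat.card G ∣ n) [Fintype ι] [DecidableEq ι]
    (v : Matrix ι ι (MonoidAlgebra R G))
    (hab : (v.map (mapDomainRingHom R (Abelianization.of (G := G)))).det = 1)
    (htors : ∀ (d : ℕ) (T : G →* Matrix (Fin d) (Fin d) N), ∃ k, (evalMatrix f T v).det ^ p ^ k = 1)
    (H : Subgroup G) [H.Normal] [Fintype (G ⧸ H)] [DecidableEq (G ⧸ H)]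
    (hH : Nat.card (G ⧸ H) = p) :
    ((restrictMatrix H v).map (mapDomainRingHom R (Abelianization.of (G := H)))).det = 1 := by
  have := Fintype.ofFinite G
  have := charZero_of_normedAlgebra_padic p (N := N)
  set Δ := ((restrictMatrix H v).map (mapDomainRingHom R (Abelianization.of (G := H)))).det with hΔ
  have hΔ' : Δ = (Matrix.comp ι ι (G ⧸ H) (G ⧸ H) _ (v.map (groupEval (RingHom.id R)
      (inducedMatrix H ((of R (Abelianization H)).comp Abelianization.of))))).det := by
    rw [hΔ, ← groupEval_restrictMatrix]
    congr 1
    ext1 i j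
    exact mapDomain_eq_groupEval _ _
  have hχ (χ : Abelianization H →* N) : groupEval f χ Δ =
      (evalMatrix f (inducedMatrix H (χ.comp Abelianization.of)) v).det := by
    rw [hΔ, RingHom.map_det, evalMatrix, ← groupEval_restrictMatrix]
    congr 1
    ext1 i j
    exact groupEval_mapDomain _ _ _ _
  have hA : Nat.card (Abelianization H) ∣ n :=
    ((Subgroup.card_quotient_dvd_card _).trans (Subgroup.card_subgroup_dvd_card H)).trans hn
  -- Character values of Δ are determinants at induced representations, hence torsion by hypothesis.
  -- The trivial character induces a representation with commuting matrices, so the augmentation is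
  -- 1.
  obtain ⟨a, ha⟩ := exists_eq_single_of_torsion p hinj hf hζ hn0 (Abelianization H)
    ((hG.to_subgroup H).to_quotient _) hA Δ (by
      apply hinj
      rw [← groupEval_one, hχ, map_one]
      exact det_evalMatrix_eq_one_of_commute f (Nat.cast_ne_zero.2 hn0) hζ hn _
        (commute_inducedMatrix_one p H hH) v hab) fun χ => by
      obtain ⟨d, φ, h⟩ := exists_fin_det_evalMatrix_eq (ι := ι) f
        (inducedMatrix H (χ.comp Abelianization.of))
      rw [hχ, h]
      exact htors _ _
  have := eq_one_of_det_induced_eq_single H p (not_isUnit_natCast_of_norm_le p hf) hH v hab a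
    (hΔ' ▸ ha)
  rw [ha, this, MonoidAlgebra.one_def]

include hinj hf hζ hn0 in
/-- The group of determinants with trivial abelianization is torsion free. -/
theorem det_evalMatrix_eq_one_of_torsion (G : Type u) [Group G] [Finite G] (hG : IsPGroup p G)
    (hn : Nat.card G ∣ n) (ι : Type u) [Fintype ι] [DecidableEq ι]
    (v : Matrix ι ι (MonoidAlgebra R G))
    (hab : (v.map (mapDomainRingHom R (Abelianization.of (G := G)))).det = 1)
    (htors : ∀ (d : ℕ) (T : G →* Matrix (Fin d) (Fin d) N), ∃ k, (evalMatrix f T v).det ^ p ^ k = 1)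
    (d : ℕ) (T : G →* Matrix (Fin d) (Fin d) N) : (evalMatrix f T v).det = 1 := by
  classical
  have := charZero_of_normedAlgebra_padic p (N := N)
  have hn' : (n : N) ≠ 0 := Nat.cast_ne_zero.2 hn0
  induction hc : Nat.card G using Nat.strong_induction_on generalizing G ι d with
  | _ c ihG =>
  induction d using Nat.strong_induction_on with
  | _ d ih =>
  have hTn (z : G) : T z ^ n = 1 := by
    rw [← map_pow, orderOf_dvd_iff_pow_eq_one.1 ((orderOf_dvd_natCard z).trans hn), map_one]
  by_cases hns : ∀ z, (∀ g, Commute (T g) (T z)) → ∃ μ : N, T z = μ • 1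
  swap
  · push Not at hns
    obtain ⟨z, hz, hz'⟩ := hns
    obtain ⟨d₁, h₁, d₂, h₂, T₁, T₂, -, h⟩ := exists_det_evalMatrix_eq_mul (ι := ι) f hn' hζ T (T z)
      (hTn z) hz hz'
    rw [h, ih d₁ h₁ T₁, ih d₂ h₂ T₂, one_mul]
  by_cases hcomm : ∀ g h, Commute (T g) (T h)
  · exact det_evalMatrix_eq_one_of_commute f hn' hζ hn T hcomm v hab
  obtain ⟨a, lam, g₀, htw, hlam, hg₀, hH⟩ := exists_twist hG T hns hcomm
  have := Fintype.ofFinite (G ⧸ lam.ker)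
  have hd : Nonempty (Fin d) := by
    by_contra h
    rw [not_nonempty_iff] at h
    exact hcomm fun g h => Subsingleton.elim _ _
  -- λ has order p, so T(a)^p commutes with every T(g), and such matrices are scalar in the present
  -- case.
  obtain ⟨κ, hκ⟩ : ∃ κ : N, T (a ^ p) = κ • 1 := by
    refine hns _ fun g => ?_
    have h1 : SemiconjBy (T g) (T a) (lam g • T a) := by
      rw [SemiconjBy, htw, smul_mul_assoc]
    have h2 := h1.pow_right p
    rw [smul_pow, hlam, one_smul, ← map_pow] at h2
    exact h2
  -- On a nonzero spectral space ζ^j T(a) acts as 1. Its p-th power is scalar, hence equal to 1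
  -- everywhere; this normalizes T(a) for the induction criterion.
  obtain ⟨j, hj⟩ : ∃ j, cycAverage (K := N) n (ζ ^ j • T a) ≠ 0 := by
    by_contra! h
    have h1 := sum_cycAverage (c := T a) hn' hζ
    rw [sum_eq_zero fun j _ => h j] at h1
    exact zero_ne_one h1
  have hcp : (ζ ^ j • T a) ^ p = 1 := by
    have h1 : (ζ ^ j • T a) ^ n = 1 := by
      rw [smul_pow, hTn, ← pow_mul, mul_comm, pow_mul, hζ.pow_eq_one, one_pow, one_smul]
    have h2 := pow_mul_cycAverage (K := N) h1 p
    have h3 : (ζ ^ j • T a) ^ p = ((ζ ^ j) ^ p * κ) • (1 : Matrix (Fin d) (Fin d) N) := by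
      rw [smul_pow, ← map_pow, hκ, smul_smul]
    rw [h3, smul_mul_assoc, one_mul] at h2
    have h4 : ((ζ ^ j) ^ p * κ - 1) • cycAverage (K := N) n (ζ ^ j • T a) = 0 := by
      rw [sub_smul, h2, one_smul, sub_self]
    rw [h3, sub_eq_zero.1 ((smul_eq_zero.1 h4).resolve_right hj), one_smul]
  obtain ⟨r, T', h⟩ := exists_det_evalMatrix_eq_restrict (ι := ι) f
    (Nat.cast_ne_zero.2 hp.1.ne_zero) T lam hH hg₀ _ hcp fun g => by
      rw [mul_smul_comm, htw, smul_mul_assoc, smul_comm]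
  rw [h]
  have hlt : Nat.card lam.ker < c := by
    have h1 := lam.ker.card_eq_card_quotient_mul_card_subgroup
    rw [hH, hc] at h1
    have h2 : 0 < Nat.card lam.ker := Nat.card_pos
    have h3 := hp.1.one_lt
    nlinarith
  -- The new index set ι × G/ker λ stays in the universe of G, so the induction hypothesis applies.
  refine ihG _ hlt lam.ker (hG.to_subgroup _) ((Subgroup.card_subgroup_dvd_card _).trans hn)
    (ι × (G ⧸ lam.ker)) (restrictMatrix lam.ker v)
    (det_restrictMatrix_abelianization_eq_one p hinj hf hζ hn0 hG hn v hab htors lam.ker hH)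
    (fun d' T'' => ?_) r T' rfl
  obtain ⟨e, φ, h'⟩ := exists_fin_det_evalMatrix_eq (ι := ι) f (inducedHom lam.ker T'')
  rw [← det_evalMatrix_inducedHom, h']
  exact htors _ _

end TorsionFree

end DetDescent

namespace DetDescent

open MonoidAlgebra

/-! ### Augmentation, dimension and the residue of Det -/

section Dimension

variable {G M N : Type*} [Group G] [Finite G] [Field M] [NormedField N] [IsUltrametricDist N]
  [Algebra M N]

/-- The augmentation of a unit of `O_M[G]`, in `N`. -/
def augValue (u : (MonoidAlgebra (valRing M N) G)ˣ) : N :=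
  valRingToN M N (augmentation _ G u.1)

omit [Finite G] in
theorem augValue_mul (u v : (MonoidAlgebra (valRing M N) G)ˣ) :
    augValue (u * v) = augValue u * augValue v := by
  simp [augValue]

omit [Finite G] in
theorem norm_augValue (u : (MonoidAlgebra (valRing M N) G)ˣ) : ‖augValue u‖ = 1 := by
  have h : augValue u * augValue u⁻¹ = 1 := by
    rw [← augValue_mul, mul_inv_cancel]
    simp [augValue]
  have h' := congrArg norm h
  rw [norm_mul, norm_one] at h'
  have h1 : ‖augValue u‖ ≤ 1 := norm_valRingToN_le _
  have h2 : ‖augValue u⁻¹‖ ≤ 1 := norm_valRingToN_le _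
  nlinarith [norm_nonneg (augValue u), norm_nonneg (augValue u⁻¹)]

omit [Finite G] in
theorem augValue_ne_zero (u : (MonoidAlgebra (valRing M N) G)ˣ) : augValue u ≠ 0 := by
  rw [← norm_pos_iff, norm_augValue]
  exact one_pos

theorem detValue_sub (u : (MonoidAlgebra (valRing M N) G)ˣ) (x y : RepRing G N) :
    detValue u (x - y) = detValue u x * (detValue u y)⁻¹ := by
  rw [sub_eq_add_neg, detValue_add, detValue_neg]

theorem detValue_zsmul (u : (MonoidAlgebra (valRing M N) G)ˣ) (d : ℤ) (x : RepRing G N) :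
    detValue u (d • x) = detValue u x ^ d := by
  induction d using Int.induction_on with
  | zero => simp
  | succ n ih => rw [add_smul, one_smul, detValue_add, ih, zpow_add_one₀ (detValue_ne_zero u x)]
  | pred n ih => rw [sub_smul, one_smul, detValue_sub, ih, zpow_sub_one₀ (detValue_ne_zero u x)]

/-- The trivial representation. -/
def trivialRep (G N : Type*) [Group G] [Field N] : MatRep G N := ⟨1, 1⟩

theorem character_trivialRep {G N : Type*} [Group G] [Field N] (c : ConjClasses G) :
    character (repClass (trivialRep G N)) c = 1 := by
  induction c using Quotient.inductionOn with
  | h g =>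
    rw [character, repLift_repClass]
    change Matrix.trace (1 : Matrix (Fin 1) (Fin 1) N) = 1
    simp

theorem detValue_trivialRep (u : (MonoidAlgebra (valRing M N) G)ˣ) :
    detValue u (repClass (trivialRep G N)) = augValue u := by
  have h (v : MonoidAlgebra (valRing M N) G) : evalRep (valRingToN M N) (trivialRep G N).rho v =
      valRingToN M N (augmentation _ G v) • 1 := by
    induction v using MonoidAlgebra.induction_linear with
    | zero => simp
    | add a b ha hb => rw [map_add, map_add, map_add, add_smul, ha, hb]
    | single g r => rw [evalRep_single, augmentation_single]; rfl
  rw [detValue_repClass, h]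
  change (valRingToN M N (augmentation _ G u.1) • (1 : Matrix (Fin 1) (Fin 1) N)).det = _
  rw [Matrix.det_smul, Matrix.det_one, Fintype.card_fin, pow_one, mul_one]
  rfl

variable (p : ℕ) [hp : Fact p.Prime] [NormedAlgebra ℚ_[p] N]

theorem norm_zpow_sub_one_lt {x : N} (hx : ‖x - 1‖ < 1) (d : ℤ) : ‖x ^ d - 1‖ < 1 := by
  have h0 : x ≠ 0 := by
    rintro rfl
    simp at hx
  induction d using Int.induction_on with
  | zero => simp
  | succ n ih => rw [zpow_add_one₀ h0]; exact norm_mul_sub_one_lt ih hx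
  | pred n ih => rw [zpow_sub_one₀ h0]; exact norm_mul_sub_one_lt ih (norm_inv_sub_one_lt hx)

include p in
/-- The dimension of a virtual representation, and the residue of the values of `Det`. -/
theorem exists_dim (hG : IsPGroup p G) (x : RepRing G N) :
    ∃ d : ℤ, character x (ConjClasses.mk 1) = d ∧
      ∀ u : (MonoidAlgebra (valRing M N) G)ˣ, ‖detValue u x * ((augValue u) ^ d)⁻¹ - 1‖ < 1 := by
  have key (T : MatRep G N) (u : (MonoidAlgebra (valRing M N) G)ˣ) :
      ‖detValue u (repClass T) * ((augValue u) ^ T.dim)⁻¹ - 1‖ < 1 := by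
    have h0 := pow_ne_zero T.dim (augValue_ne_zero u)
    have h1 : detValue u (repClass T) * ((augValue u) ^ T.dim)⁻¹ - 1 =
        (detValue u (repClass T) - (augValue u) ^ T.dim) * ((augValue u) ^ T.dim)⁻¹ := by
      field_simp
    rw [h1, norm_mul, norm_inv, norm_pow, norm_augValue, one_pow, inv_one, mul_one,
      detValue_repClass]
    exact norm_det_evalRep_sub_lt p hG T u.1
  have hchar (T : MatRep G N) : character (repClass T) (ConjClasses.mk 1) = T.dim := by
    rw [character, repLift_repClass]
    change Matrix.trace (T.rho 1).1 = _
    simp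
  obtain ⟨S, T, rfl⟩ := exists_eq_repClass_sub x
  refine ⟨S.dim - T.dim, ?_, fun u => ?_⟩
  · rw [map_sub, Pi.sub_apply, hchar, hchar]
    push_cast
    rfl
  · have h := norm_mul_sub_one_lt (key S u) (norm_inv_sub_one_lt (key T u))
    convert h using 3
    rw [detValue_sub, zpow_sub₀ (augValue_ne_zero u), zpow_natCast, zpow_natCast]
    have h0 := pow_ne_zero T.dim (augValue_ne_zero u)
    have h0' := pow_ne_zero S.dim (augValue_ne_zero u)
    have h1 := detValue_ne_zero u (repClass T)
    field_simp

end Dimension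

/-! ### Compatibility of Det with an extension of F -/

section Frobenius

variable (p : ℕ) [hp : Fact p.Prime] {G K M N : Type*} [Group G] [Finite G]
  [Field K] [Field M] [NormedField N] [IsUltrametricDist N] [NormedAlgebra ℚ_[p] N]
  [FiniteDimensional ℚ_[p] N] [Algebra ℚ_[p] K] [Algebra ℚ_[p] M] [Algebra K M] [Algebra M N]
  [IsScalarTower ℚ_[p] K M] [IsScalarTower ℚ_[p] M N] (F : M ≃ₐ[K] M)

theorem valRingToN_galValRing (r : valRing M N) :
    valRingToN M N (galValRing p N F r) = algebraMap M N (F r.1) := rfl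

theorem augmentation_mapRingHom {R R' G : Type*} [CommRing R] [CommRing R'] [Group G]
    (ρ : R →+* R') (x : MonoidAlgebra R G) :
    augmentation R' G (mapRingHom G ρ x) = ρ (augmentation R G x) := by
  induction x using MonoidAlgebra.induction_linear with
  | zero => simp
  | add a b ha hb => simp only [map_add, ha, hb]
  | single g r => simp [augmentation_single]

omit [Finite G] in
theorem augmentation_galUnits (u : (MonoidAlgebra (valRing M N) G)ˣ) :
    augmentation _ G (galUnits p G N F u).1 = galValRing p N F (augmentation _ G u.1) :=
  augmentation_mapRingHom _ _

/-- The values of `Det` on the conjugate of a unit by `F`, for an extension `σ` of `F` to `N`. -/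
theorem detValue_galUnits (σ : N ≃+* N) (hσ : ∀ m, σ (algebraMap M N m) = algebraMap M N (F m))
    (u : (MonoidAlgebra (valRing M N) G)ˣ) (x : RepRing G N) :
    detValue (galUnits p G N F u) x = σ (detValue u (repConj (σ.symm : N →+* N) x)) := by
  have key (T : MatRep G N) (v : MonoidAlgebra (valRing M N) G) :
      evalRep (valRingToN M N) T.rho (mapRingHom G (galValRing p N F) v) =
        (evalRep (valRingToN M N)
          ((Matrix.GeneralLinearGroup.map (σ.symm : N →+* N)).comp T.rho) v).map σ := by
    induction v using MonoidAlgebra.induction_linear with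
    | zero => ext i j; simp
    | add a b ha hb =>
      rw [map_add, map_add, map_add, ha, hb]
      ext i j
      simp
    | single g r =>
      rw [mapRingHom_single, evalRep_single, evalRep_single, valRingToN_galValRing, ← hσ]
      ext i j
      change σ (algebraMap M N r.1) * (T.rho g).1 i j =
        σ (algebraMap M N r.1 * σ.symm ((T.rho g).1 i j))
      rw [map_mul, σ.apply_symm_apply]
  have h1 (T : MatRep G N) : detValue (galUnits p G N F u) (repClass T) =
      σ (detValue u (repConj (σ.symm : N →+* N) (repClass T))) := by
    rw [repConj, repLift_repClass, detValue_repClass, detValue_repClass]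
    refine (congrArg Matrix.det (key T u.1)).trans ?_
    exact ((σ : N →+* N).map_det _).symm
  obtain ⟨S, T, rfl⟩ := exists_eq_repClass_sub x
  rw [map_sub, detValue_sub, detValue_sub, h1, h1, map_mul, map_inv₀]

end Frobenius

end DetDescent

namespace DetDescent

open MonoidAlgebra

universe u

/-! ### Adams operations for p-groups -/

section AdamsSpec

variable (p : ℕ) [hp : Fact p.Prime] {G N : Type*} [Group G] [Finite G] [Field N] [CharZero N]

/-- The Adams operations of `p`-power degree on the representation ring of a finite `p`-group. -/
theorem character_adams_prime_pow (hG : IsPGroup p G) (hN : ∃ ζ : N, IsPrimitiveRoot ζ (Nat.card G))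
    (q : ℕ) (x : RepRing G N) (g : G) :
    character (adams (p ^ q) x) (ConjClasses.mk g) = character x (ConjClasses.mk (g ^ p ^ q)) := by
  refine character_adams ?_ g
  obtain ⟨ζ, hζ⟩ := hN
  obtain ⟨e, he⟩ := IsPGroup.iff_card.1 hG
  rcases e with _ | e
  · have := (Nat.card_eq_one_iff_unique.1 (he.trans (pow_zero p))).1
    exact ⟨x, fun g => by rw [Subsingleton.elim (g ^ p ^ q) g]⟩
  · exact exists_adams_prime_pow p
      (hζ.pow Nat.card_pos (by rw [he, pow_succ] : Nat.card G = p ^ e * p)) q x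

end AdamsSpec

/-! ### The argument of the logarithm -/

section LogArgument

variable (p : ℕ) [hp : Fact p.Prime] {G K M N : Type*} [Group G] [Finite G]
  [Field K] [Field M] [NormedField N] [IsUltrametricDist N] [NormedAlgebra ℚ_[p] N]
  [FiniteDimensional ℚ_[p] N] [Algebra ℚ_[p] K] [Algebra ℚ_[p] M] [Algebra K M] [Algebra M N]
  [IsScalarTower ℚ_[p] K M] [IsScalarTower ℚ_[p] M N]

/-- The argument of the logarithm in the definition of `LogF`. -/
def logArg (q : ℕ) (F : M ≃ₐ[K] M) (z : (MonoidAlgebra (valRing M N) G)ˣ) (x : RepRing G N) : N :=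
  detValue (galUnits p G N F z) (adams (p ^ q) x) * (detValue z x ^ p ^ q)⁻¹

theorem LogF_eq (q : ℕ) (F : M ≃ₐ[K] M) (z : (MonoidAlgebra (valRing M N) G)ˣ) (x : RepRing G N) :
    LogF p G N q F z x = padicLog (logArg p q F z x) := by
  have h (u : (valRing N N)ˣ) : ((u⁻¹ : (valRing N N)ˣ) : valRing N N).1 = (u.1.1)⁻¹ := by
    apply eq_inv_of_mul_eq_one_left
    exact congrArg Subtype.val u.inv_mul
  rw [LogF, logArg, div_eq_mul_inv]
  congr 1
  rw [Units.val_mul]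
  change _ * ((_⁻¹ : (valRing N N)ˣ) : valRing N N).1 = _
  rw [h, Units.val_pow_eq_pow_val]
  rfl

variable (q : ℕ) (F : M ≃ₐ[K] M)
  (hadams : ∀ (x : RepRing G N) (g : G),
    character (adams (p ^ q) x) (ConjClasses.mk g) = character x (ConjClasses.mk (g ^ p ^ q)))

include hadams in
theorem logArg_congr (z : (MonoidAlgebra (valRing M N) G)ˣ) {x y : RepRing G N}
    (h : character x = character y) : logArg p q F z x = logArg p q F z y := by
  have := charZero_of_normedAlgebra_padic p (N := N)
  rw [logArg, logArg, detValue_eq_of_character z h]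
  congr 1
  refine detValue_eq_of_character _ (funext fun c => ?_)
  induction c using Quotient.inductionOn with
  | h g =>
    change character _ (ConjClasses.mk g) = character _ (ConjClasses.mk g)
    rw [hadams, hadams, h]

-- Adams operations are used as additive only after taking characters, which suffices because Det
-- sees only characters.
include hadams in
theorem logArg_add (z : (MonoidAlgebra (valRing M N) G)ˣ) (x y : RepRing G N) :
    logArg p q F z (x + y) = logArg p q F z x * logArg p q F z y := by
  have := charZero_of_normedAlgebra_padic p (N := N)
  have h : detValue (galUnits p G N F z) (adams (p ^ q) (x + y)) =
      detValue (galUnits p G N F z) (adams (p ^ q) x + adams (p ^ q) y) := by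
    refine detValue_eq_of_character _ (funext fun c => ?_)
    induction c using Quotient.inductionOn with
    | h g =>
      change character _ (ConjClasses.mk g) = character _ (ConjClasses.mk g)
      rw [hadams, map_add, map_add, Pi.add_apply, Pi.add_apply, hadams, hadams]
  rw [logArg, logArg, logArg, h, detValue_add, detValue_add, mul_pow, mul_inv]
  ring

theorem logArg_mul (z w : (MonoidAlgebra (valRing M N) G)ˣ)
    (x : RepRing G N) : logArg p q F (z * w) x = logArg p q F z x * logArg p q F w x := by
  rw [logArg, logArg, logArg, map_mul, detValue_mul, detValue_mul, mul_pow, mul_inv]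
  ring

-- With s the augmentation of z and d the common dimension of x and its Adams operation, numerator
-- and denominator are congruent to F(s)^d and s^(d p^q). These agree modulo the maximal ideal by
-- the Frobenius condition.
include hadams in
theorem norm_logArg_sub_one_lt (hG : IsPGroup p G)
    (hF : ∀ z : valRing M N,
      galValRing p N F z - z ^ (p ^ q) ∈ IsLocalRing.maximalIdeal (valRing M N))
    (z : (MonoidAlgebra (valRing M N) G)ˣ) (x : RepRing G N) : ‖logArg p q F z x - 1‖ < 1 := by
  have := charZero_of_normedAlgebra_padic p (N := N)
  obtain ⟨d, hd, hdx⟩ := exists_dim (M := M) p hG x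
  obtain ⟨d', hd', hdx'⟩ := exists_dim (M := M) p hG (adams (p ^ q) x)
  have hdd : d' = d := by
    rw [hadams, one_pow, hd] at hd'
    exact_mod_cast hd'.symm
  subst hdd
  set s := augValue z with hs
  set s' := augValue (galUnits p G N F z) with hs'
  have hs0 : s ≠ 0 := augValue_ne_zero z
  have hs0' : s' ≠ 0 := augValue_ne_zero _
  have h1 : ‖s' * (s ^ p ^ q)⁻¹ - 1‖ < 1 := by
    have h2 := (mem_maximalIdeal_valRing _).1 (hF (augmentation _ G z.1))
    rw [← augmentation_galUnits] at h2
    have h3 : s' * (s ^ p ^ q)⁻¹ - 1 = (s' - s ^ p ^ q) * (s ^ p ^ q)⁻¹ := by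
      rw [sub_mul, mul_inv_cancel₀ (pow_ne_zero _ hs0)]
    rw [h3, norm_mul, norm_inv, norm_pow, norm_augValue, one_pow, inv_one, mul_one]
    convert h2 using 2
    rw [hs, hs', augValue, augValue, ← map_pow, ← map_sub]
    rfl
  have h4 := norm_mul_sub_one_lt (norm_zpow_sub_one_lt h1 d')
    (norm_mul_sub_one_lt (hdx' (galUnits p G N F z))
      (norm_inv_sub_one_lt (norm_zpow_sub_one_lt (hdx z) (p ^ q : ℕ))))
  convert h4 using 3
  rw [logArg, ← hs, ← hs', zpow_natCast, mul_zpow, inv_zpow, ← zpow_natCast s, ← zpow_mul,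
    mul_pow, inv_pow, ← zpow_natCast (s ^ d'), ← zpow_mul, mul_comm d']
  have e1 := zpow_ne_zero d' hs0'
  have e2 := zpow_ne_zero (((p ^ q : ℕ) : ℤ) * d') hs0
  have e3 := detValue_ne_zero z x
  field_simp

include hadams in
theorem logArg_repConj (σ : N ≃ₐ[M] N) (z : (MonoidAlgebra (valRing M N) G)ˣ) (x : RepRing G N) :
    logArg p q F z (repConj (σ : N →+* N) x) = σ (logArg p q F z x) := by
  have := charZero_of_normedAlgebra_padic p (N := N)
  have h : detValue (galUnits p G N F z) (adams (p ^ q) (repConj (σ : N →+* N) x)) =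
      detValue (galUnits p G N F z) (repConj (σ : N →+* N) (adams (p ^ q) x)) := by
    refine detValue_eq_of_character _ (funext fun c => ?_)
    induction c using Quotient.inductionOn with
    | h g =>
      change character _ (ConjClasses.mk g) = character _ (ConjClasses.mk g)
      rw [hadams, character_repConj, character_repConj, hadams]
  rw [logArg, logArg, h, map_mul, map_inv₀, map_pow]
  congr 1
  · exact detFun_conj _ σ _
  · congr 2
    exact detFun_conj _ σ _

include hadams in
/-- The behaviour of `logArg` under `F`, for an extension `σ` of `F` to `N`. -/
theorem logArg_galUnits (σ : N ≃+* N) (hσ : ∀ m, σ (algebraMap M N m) = algebraMap M N (F m))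
    (z : (MonoidAlgebra (valRing M N) G)ˣ) (x : RepRing G N) :
    logArg p q F (galUnits p G N F z) x =
      σ (logArg p q F z (repConj (σ.symm : N →+* N) x)) := by
  have := charZero_of_normedAlgebra_padic p (N := N)
  rw [logArg, logArg, map_mul, map_inv₀, map_pow, detValue_galUnits p F σ hσ _ (adams (p ^ q) x),
    detValue_galUnits p F σ hσ z x]
  congr 2
  refine detValue_eq_of_character _ (funext fun c => ?_)
  induction c using Quotient.inductionOn with
  | h g =>
    change character _ (ConjClasses.mk g) = character _ (ConjClasses.mk g)
    rw [character_repConj, hadams, hadams, character_repConj]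

include hadams in
/-- If all values of `logArg` at `u` are torsion, so are those of `Det u`, for `u ∈ 1 + A_M(G)`. -/
theorem exists_detValue_pow_eq_one (hG : IsPGroup p G) (hq : q ≠ 0)
    (σ : N ≃+* N) (hσ : ∀ m, σ (algebraMap M N m) = algebraMap M N (F m))
    (u : (MonoidAlgebra (valRing M N) G)ˣ) (haug : augmentation _ G u.1 = 1)
    (htors : ∀ x, ∃ k, logArg p q F u x ^ p ^ k = 1) (x : RepRing G N) :
    ∃ k, detValue u x ^ p ^ k = 1 := by
  have := charZero_of_normedAlgebra_padic p (N := N)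
  let Fu (j : ℕ) := (galUnits p G N F)^[j] u
  have hFu (j : ℕ) : (∀ x, ∃ k, logArg p q F (Fu j) x ^ p ^ k = 1) ∧
      augmentation _ G (Fu j).1 = 1 := by
    induction j with
    | zero => exact ⟨htors, haug⟩
    | succ j ih =>
      have h1 : Fu (j + 1) = galUnits p G N F (Fu j) := Function.iterate_succ_apply' _ _ _
      rw [h1]
      refine ⟨fun x => ?_, by rw [augmentation_galUnits, ih.2, map_one]⟩
      obtain ⟨k, hk⟩ := ih.1 (repConj (σ.symm : N →+* N) x)
      exact ⟨k, by rw [logArg_galUnits p q F hadams σ hσ, ← map_pow, hk, map_one]⟩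
  let xs (j : ℕ) := (adams (p ^ q))^[j] x
  have hxs (j : ℕ) (g : G) : character (xs j) (ConjClasses.mk g) =
      character x (ConjClasses.mk (g ^ p ^ (q * j))) := by
    induction j generalizing g with
    | zero => simp [xs]
    | succ j ih =>
      have h1 : xs (j + 1) = adams (p ^ q) (xs j) := Function.iterate_succ_apply' _ _ _
      rw [h1, hadams, ih, ← pow_mul, ← pow_add, Nat.mul_succ, add_comm]
  -- Up to torsion, Det of the j-th F-conjugate of u at the j-th Adams iterate is Det(u)(x) to the
  -- power p^(qj). The additional exponent p^k clears the roots of unity accumulated so far.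
  have hstep (j : ℕ) : ∃ k, detValue (Fu j) (xs j) ^ p ^ k = detValue u x ^ p ^ (q * j + k) := by
    induction j with
    | zero => exact ⟨0, by simp [Fu, xs]⟩
    | succ j ih =>
      obtain ⟨k, hk⟩ := ih
      obtain ⟨l, hl⟩ := (hFu j).1 (xs j)
      have h1 : Fu (j + 1) = galUnits p G N F (Fu j) := Function.iterate_succ_apply' _ _ _
      have h2 : xs (j + 1) = adams (p ^ q) (xs j) := Function.iterate_succ_apply' _ _ _
      refine ⟨l + k, ?_⟩
      rw [logArg, ← h1, ← h2, mul_pow, inv_pow, mul_inv_eq_one₀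
        (pow_ne_zero _ (pow_ne_zero _ (detValue_ne_zero _ _)))] at hl
      have e1 : detValue (Fu (j + 1)) (xs (j + 1)) ^ p ^ (l + k) =
          ((detValue (Fu j) (xs j) ^ p ^ k) ^ p ^ q) ^ p ^ l := by
        rw [pow_add, pow_mul, hl]
        simp only [← pow_mul]
        congr 1
        ring
      rw [e1, hk]
      simp only [← pow_mul, ← pow_add]
      congr 2
      ring
  obtain ⟨e, he⟩ := IsPGroup.iff_card.1 hG
  obtain ⟨k, hk⟩ := hstep e
  obtain ⟨d, hd, -⟩ := exists_dim (M := M) p hG x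
  -- When |G| = p^e and q ≥ 1, raising to the power p^(qe) kills G. The iterate then has the
  -- character of d trivial representations, where Det is the d-th power of the augmentation.
  have hconst : character (xs e) = character (d • repClass (trivialRep G N)) := by
    funext c
    induction c using Quotient.inductionOn with
    | h g =>
      change character _ (ConjClasses.mk g) = character _ (ConjClasses.mk g)
      have hg : g ^ p ^ (q * e) = 1 := by
        rw [← orderOf_dvd_iff_pow_eq_one]
        exact (orderOf_dvd_natCard g).trans
          (he ▸ pow_dvd_pow p (Nat.le_mul_of_pos_left e (Nat.pos_of_ne_zero hq)))
      rw [hxs, hg, hd, map_zsmul, Pi.smul_apply, character_trivialRep]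
      simp
  refine ⟨q * e + k, ?_⟩
  rw [← hk, detValue_eq_of_character _ hconst, detValue_zsmul, detValue_trivialRep, augValue,
    (hFu e).2, map_one, one_zpow, one_pow]

end LogArgument

/-! ### Torsion freeness of Det(1 + A_M(G)) -/

section Torsion

variable (p : ℕ) [hp : Fact p.Prime] {G : Type u} {M N : Type*} [Group G] [Finite G]
  [Field M] [NormedField N] [IsUltrametricDist N] [NormedAlgebra ℚ_[p] N] [Algebra M N]

/-- `Det (1 + A_M(G))` is torsion free. -/
theorem detValue_eq_one_of_torsion (hG : IsPGroup p G)
    (hN : ∃ ζ : N, IsPrimitiveRoot ζ (Nat.card G))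
    (u : (MonoidAlgebra (valRing M N) G)ˣ) (hu : u ∈ oneAddKerAb G M N)
    (htors : ∀ x, ∃ k, detValue u x ^ p ^ k = 1) (x : RepRing G N) : detValue u x = 1 := by
  obtain ⟨ζ, hζ⟩ := hN
  let f := valRingToN M N
  -- A unit viewed as a one-by-one matrix, indexed in the universe of G.
  let v : Matrix PUnit.{u + 1} PUnit.{u + 1} (MonoidAlgebra (valRing M N) G) :=
    Matrix.of fun _ _ => u.1
  have hev (d : ℕ) (T : G →* Matrix (Fin d) (Fin d) N) :
      (evalMatrix f T v).det = detValue u (repClass ⟨d, T.toHomUnits⟩) := by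
    rw [detValue_repClass, ← Matrix.det_submatrix_equiv_self (Equiv.punitProd (Fin d)).symm]
    congr 1
  have hinj : Function.Injective f :=
    (algebraMap M N).injective.comp Subtype.val_injective
  have key := det_evalMatrix_eq_one_of_torsion p hinj (fun r => norm_valRingToN_le r) hζ
    Nat.card_pos.ne' G hG dvd_rfl PUnit v (by
      rw [Matrix.det_unique]
      exact congrArg Units.val (MonoidHom.mem_ker.1 hu)) fun d T => by
      rw [hev]
      exact htors _
  have hT (T : MatRep G N) : detValue u (repClass T) = 1 := by
    have h := key T.dim ((Units.coeHom _).comp T.rho)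
    have h' : ((Units.coeHom _).comp T.rho).toHomUnits = T.rho := by
      ext
      rfl
    rwa [hev, h'] at h
  obtain ⟨S, T, rfl⟩ := exists_eq_repClass_sub x
  rw [detValue_sub, hT, hT, inv_one, one_mul]

end Torsion

end DetDescent

namespace DetDescent

open MonoidAlgebra

/-! ### The image and injectivity of psi -/

section Psi

variable {G M N : Type*} [Group G] [Field M] [Field N] [Algebra M N]

theorem psi_apply [Fintype (ConjClasses G)] (a : ConjClasses G →₀ M) (x : RepRing G N) :
    (psi G M N a).1 x = ∑ c, algebraMap M N (a c) * character x c := by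
  classical
  induction a using Finsupp.induction_linear with
  | zero => simp
  | add a b ha hb =>
    rw [map_add]
    change (psi G M N a).1 x + (psi G M N b).1 x = _
    rw [ha, hb, ← Finset.sum_add_distrib]
    exact Finset.sum_congr rfl fun c _ => by rw [Finsupp.add_apply, map_add, add_mul]
  | single c m =>
    rw [psi, Finsupp.linearCombination_single]
    change m • character x c = _
    rw [Finset.sum_eq_single c (fun c' _ h => by
      rw [Finsupp.single_eq_of_ne h, map_zero, zero_mul]) (by simp),
      Finsupp.single_eq_same, Algebra.smul_def]

theorem eq_of_sum_character_eq [Fintype (ConjClasses G)]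
    (hspan : Submodule.span N (Set.range (character : RepRing G N → ConjClasses G → N)) = ⊤)
    {a b : ConjClasses G → N}
    (h : ∀ x : RepRing G N, ∑ c, a c * character x c = ∑ c, b c * character x c) : a = b := by
  classical
  let ℓ (a : ConjClasses G → N) : (ConjClasses G → N) →ₗ[N] N :=
    ∑ c, a c • LinearMap.proj c
  have hℓ (a φ : ConjClasses G → N) : ℓ a φ = ∑ c, a c * φ c := by simp [ℓ]
  have heq : ℓ a = ℓ b := LinearMap.ext_on_range hspan fun x => by rw [hℓ, hℓ, h]
  funext c
  have := LinearMap.congr_fun heq (Pi.single c 1)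
  simpa [hℓ, Pi.single_apply] using this

theorem psi_injective [Finite G]
    (hspan : Submodule.span N (Set.range (character : RepRing G N → ConjClasses G → N)) = ⊤)
    {a b : ConjClasses G →₀ M} (h : ∀ x : RepRing G N, (psi G M N a).1 x = (psi G M N b).1 x) :
    a = b := by
  have := Fintype.ofFinite (ConjClasses G)
  simp only [psi_apply] at h
  have h1 := eq_of_sum_character_eq hspan (a := fun c => algebraMap M N (a c))
    (b := fun c => algebraMap M N (b c)) h
  ext c
  exact (algebraMap M N).injective (congrFun h1 c)

/-- A Galois-equivariant function of characters is in the image of `psi`. -/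
theorem exists_psi_eq [Finite G] [CharZero N] [FiniteDimensional M N] [IsGalois M N]
    (hspan : Submodule.span N (Set.range (character : RepRing G N → ConjClasses G → N)) = ⊤)
    (L : RepRing G N →+ N) (hL : ∀ x y, character x = character y → L x = L y)
    (hσ : ∀ (σ : N ≃ₐ[M] N) x, L (repConj (σ : N →+* N) x) = σ (L x)) :
    ∃ a : ConjClasses G →₀ M, ∀ x, (psi G M N a).1 x = L x := by
  have := Fintype.ofFinite G
  have := Fintype.ofFinite (ConjClasses G)
  obtain ⟨a, ha⟩ := exists_eq_sum_character hspan L hL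
  have hfix (c : ConjClasses G) : a c ∈ Set.range (algebraMap M N) := by
    refine (IsGalois.mem_range_algebraMap_iff_fixed (a c)).2 fun σ => ?_
    -- Equivariance makes the conjugated coefficients represent the same function `L`, so uniqueness
    -- of coefficients gives Galois invariance.
    have h1 : (fun c => σ (a c)) = a := by
      refine eq_of_sum_character_eq hspan fun x => ?_
      have h2 : character (repConj (σ : N →+* N) (repConj (σ.symm : N →+* N) x)) = character x := by
        funext c
        rw [character_repConj, character_repConj]
        exact σ.apply_symm_apply _
      rw [← ha, ← hL _ _ h2, hσ, ha, map_sum]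
      refine Finset.sum_congr rfl fun c _ => ?_
      rw [map_mul, character_repConj]
      congr 1
      exact (σ.apply_symm_apply _).symm
    exact congrFun h1 c
  choose b hb using hfix
  refine ⟨Finsupp.equivFunOnFinite.symm b, fun x => ?_⟩
  rw [psi_apply, ha]
  exact Finset.sum_congr rfl fun c _ => by rw [Finsupp.equivFunOnFinite_symm_apply_apply, hb]

end Psi

/-! ### The logarithm, the map alphaG and its kernel -/

section LogProperties

variable (p : ℕ) [hp : Fact p.Prime] {G K M N : Type*} [Group G] [Finite G] (hG : IsPGroup p G)
  [Field K] [Field M] [NormedField N] [IsUltrametricDist N] [NormedAlgebra ℚ_[p] N]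
  [FiniteDimensional ℚ_[p] N] [Algebra ℚ_[p] K] [Algebra ℚ_[p] M] [Algebra K M] [Algebra M N]
  [IsScalarTower ℚ_[p] K M] [IsScalarTower ℚ_[p] M N]
  (hN : ∃ ζ : N, IsPrimitiveRoot ζ (Nat.card G)) (q : ℕ) (F : M ≃ₐ[K] M)
  (hF : ∀ z : valRing M N,
    galValRing p N F z - z ^ (p ^ q) ∈ IsLocalRing.maximalIdeal (valRing M N))

include hG hN hF

theorem LogF_mul (u v : (MonoidAlgebra (valRing M N) G)ˣ) (x : RepRing G N) :
    LogF p G N q F (u * v) x = LogF p G N q F u x + LogF p G N q F v x := by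
  have := charZero_of_normedAlgebra_padic p (N := N)
  have : CompleteSpace N := FiniteDimensional.complete ℚ_[p] N
  have hadams := character_adams_prime_pow p hG hN q
  simp only [LogF_eq]
  rw [logArg_mul, padicLog_mul p (norm_logArg_sub_one_lt p q F hadams hG hF u x)
    (norm_logArg_sub_one_lt p q F hadams hG hF v x)]

theorem existsUnique_psi_eq_LogF [IsGalois ℚ_[p] N] (u : (MonoidAlgebra (valRing M N) G)ˣ) :
    ∃! a : ConjClasses G →₀ M, ∀ x, (psi G M N a).1 x = LogF p G N q F u x := by
  have := charZero_of_normedAlgebra_padic p (N := N)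
  have : CompleteSpace N := FiniteDimensional.complete ℚ_[p] N
  have : IsGalois M N := IsGalois.tower_top_of_isGalois ℚ_[p] M N
  have : FiniteDimensional M N := Module.Finite.of_restrictScalars_finite ℚ_[p] M N
  have hadams := character_adams_prime_pow p hG hN q
  have hspan : Submodule.span N
      (Set.range (character : RepRing G N → ConjClasses G → N)) = ⊤ := by
    obtain ⟨ζ, hζ⟩ := hN
    exact span_range_character hζ orderOf_dvd_natCard Nat.card_pos.ne'
  have hlt := norm_logArg_sub_one_lt p q F hadams hG hF u
  let L : RepRing G N →+ N := AddMonoidHom.mk' (LogF p G N q F u) fun x y => by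
    simp only [LogF_eq]
    rw [logArg_add p q F hadams, padicLog_mul p (hlt x) (hlt y)]
  obtain ⟨a, ha⟩ := exists_psi_eq (M := M) hspan L
    (fun x y h => by
      change LogF p G N q F u x = LogF p G N q F u y
      rw [LogF_eq, LogF_eq, logArg_congr p q F hadams u h])
    (fun σ x => by
      change LogF p G N q F u _ = σ (LogF p G N q F u x)
      have h1 := logArg_repConj p q F hadams σ u x
      rw [LogF_eq, LogF_eq, h1]
      refine padicLog_map p (σ : N →+* N) ?_ (hlt x) ?_
      · exact (σ.toLinearMap.restrictScalars ℚ_[p]).continuous_of_finiteDimensional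
      · change ‖σ _ - 1‖ < 1
        rw [← h1]
        exact hlt _)
  exact ⟨a, ha, fun b hb => psi_injective hspan fun x => (hb x).trans (ha x).symm⟩

theorem psi_eq_LogF_iff [IsGalois ℚ_[p] N] (u : (MonoidAlgebra (valRing M N) G)ˣ)
    (a : ConjClasses G →₀ M) :
    (∀ x, (psi G M N a).1 x = LogF p G N q F u x) ↔ a = alphaG p G N q F u := by
  obtain ⟨b, hb, huniq⟩ := existsUnique_psi_eq_LogF p hG hN q F hF u
  have h : ∀ x, (psi G M N (alphaG p G N q F u)).1 x = LogF p G N q F u x :=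
    congrFun (Function.invFun_eq (f := fun (a : ConjClasses G →₀ M) (T : RepRing G N) =>
      (psi G M N a).1 T) ⟨b, funext hb⟩)
  refine ⟨fun ha => (huniq a ha).trans (huniq _ h).symm, ?_⟩
  rintro rfl
  exact h

theorem alphaG_mul [IsGalois ℚ_[p] N] (u v : (MonoidAlgebra (valRing M N) G)ˣ) :
    alphaG p G N q F (u * v) = alphaG p G N q F u + alphaG p G N q F v := by
  symm
  rw [← psi_eq_LogF_iff p hG hN q F hF]
  intro x
  rw [LogF_mul p hG hN q F hF, map_add,
    ← (psi_eq_LogF_iff p hG hN q F hF u _).2 rfl, ← (psi_eq_LogF_iff p hG hN q F hF v _).2 rfl]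
  rfl

omit hG hN hF

/-- The numerator involves F(u), but Det(F(u)) is the σ-conjugate of Det(u) and hence determined by
it. This is the well-definedness of the map on determinants. -/
theorem LogF_congr (σ : N ≃+* N) (hσ : ∀ m, σ (algebraMap M N m) = algebraMap M N (F m))
    {u v : (MonoidAlgebra (valRing M N) G)ˣ} (h : Det G M N u = Det G M N v) :
    LogF p G N q F u = LogF p G N q F v := by
  rw [Det_eq_Det_iff] at h
  funext x
  rw [LogF_eq, LogF_eq, logArg, logArg, detValue_galUnits p F σ hσ, detValue_galUnits p F σ hσ,
    h, h]

include hG hN hF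

/-- A vanishing logarithm makes every logarithm argument a root of unity of p-power order. Iterating
Frobenius transfers this to the values of Det(u), and torsion freeness then makes them 1. -/
theorem Det_eq_one_of_alphaG_eq_zero [IsGalois ℚ_[p] N] (hq : q ≠ 0) (σ : N ≃+* N)
    (hσ : ∀ m, σ (algebraMap M N m) = algebraMap M N (F m))
    (u : (MonoidAlgebra (valRing M N) G)ˣ) (hu : u ∈ oneAddKerAb G M N)
    (h : alphaG p G N q F u = 0) : Det G M N u = 1 := by
  have := charZero_of_normedAlgebra_padic p (N := N)
  have : CompleteSpace N := FiniteDimensional.complete ℚ_[p] N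
  have hadams := character_adams_prime_pow p hG hN q
  have haug : augmentation _ G u.1 = 1 := by
    have h1 := congrArg Units.val (MonoidHom.mem_ker.1 hu)
    rw [← augmentation_mapDomain Abelianization.of]
    exact (congrArg _ h1).trans (map_one _)
  have htors (x : RepRing G N) : ∃ k, logArg p q F u x ^ p ^ k = 1 := by
    refine exists_pow_eq_one_of_padicLog_eq_zero p
      (norm_logArg_sub_one_lt p q F hadams hG hF u x) ?_
    rw [← LogF_eq, ← (psi_eq_LogF_iff p hG hN q F hF u _).2 rfl, h, map_zero]
    rfl
  rw [← map_one (Det G M N), Det_eq_Det_iff]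
  intro x
  rw [detValue_eq_one_of_torsion p hG hN u hu
    (exists_detValue_pow_eq_one p q F hadams hG hq σ hσ u haug htors), detValue_one]

end LogProperties

end DetDescent

end

/-! ### The main theorem -/

open DetDescent in
theorem proposition3p3 (p : ℕ) [Fact p.Prime]
    (G : Type*) [Group G] [Finite G] (hG : IsPGroup p G)
    (K M N : Type*) [Field K] [Field M] [NormedField N] [IsUltrametricDist N]
    [NormedAlgebra ℚ_[p] N] [FiniteDimensional ℚ_[p] N] [IsGalois ℚ_[p] N]
    [Algebra ℚ_[p] K] [Algebra ℚ_[p] M] [Algebra K M] [Algebra M N] [Algebra K N]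
    [IsScalarTower ℚ_[p] K M] [IsScalarTower ℚ_[p] M N] [IsScalarTower K M N]
    [IsGalois K M]
    (hN : ∃ ζ : N, IsPrimitiveRoot ζ (Nat.card G))
    (q : ℕ) (hq : Nat.card (IsLocalRing.ResidueField (valRing K N)) = p ^ q)
    (F : M ≃ₐ[K] M)
    (hF : ∀ z : valRing M N,
      galValRing p N F z - z ^ (p ^ q) ∈ IsLocalRing.maximalIdeal (valRing M N)) :
    -- `1 + A_M(G)` consists of units
    (∀ a ∈ kerAb G M N, IsUnit (1 + a)) ∧
    -- `α_G(u)` is the unique element of `M{G}` that `ψ` maps to `Log_F(u)`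
    (∀ (u : (MonoidAlgebra (valRing M N) G)ˣ) (a : ConjClasses G →₀ M),
      (∀ T, (psi G M N a).1 T = LogF p G N q F u T) ↔ a = alphaG p G N q F u) ∧
    -- `Det u ↦ α_G(u)` is a well-defined injective homomorphism on `Det (1 + A_M(G))`
    ∃ αhat : (oneAddKerAb G M N).map (Det G M N) →* Multiplicative (ConjClasses G →₀ M),
      (∀ (u : (MonoidAlgebra (valRing M N) G)ˣ) (hu : u ∈ oneAddKerAb G M N),
        αhat ⟨Det G M N u, Subgroup.mem_map_of_mem _ hu⟩ =
          Multiplicative.ofAdd (alphaG p G N q F u)) ∧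
      Function.Injective αhat := by
  refine ⟨fun a ha => ?_, fun u a => psi_eq_LogF_iff p hG hN q F hF u a, ?_⟩
  · refine isUnit_one_add_of_augmentation_eq_zero p hG a ?_
    rw [← augmentation_mapDomain Abelianization.of, (RingHom.mem_ker.1 ha :), map_zero]
  have : IsScalarTower ℚ_[p] K N := IsScalarTower.of_algebraMap_eq fun x => by
    rw [IsScalarTower.algebraMap_apply ℚ_[p] M N, IsScalarTower.algebraMap_apply ℚ_[p] K M,
      ← IsScalarTower.algebraMap_apply K M N]
  have : IsGalois K N := IsGalois.tower_top_of_isGalois ℚ_[p] K N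
  -- N is Galois over K, so F extends to an automorphism of N.
  let σ : N ≃+* N := (F.liftNormal N : N ≃+* N)
  have hσ (m : M) : σ (algebraMap M N m) = algebraMap M N (F m) := F.liftNormal_commutes N m
  -- A residue field has more than one element. Positivity of q makes iterated Adams operations
  -- trivialize characters.
  have hq0 : q ≠ 0 := by
    rintro rfl
    have := (Nat.card_eq_one_iff_unique.1 (hq.trans (pow_zero p))).1
    exact not_subsingleton (IsLocalRing.ResidueField (valRing K N)) this
  have hcongr {u v : (MonoidAlgebra (valRing M N) G)ˣ} (h : Det G M N u = Det G M N v) :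
      alphaG p G N q F u = alphaG p G N q F v := by
    rw [alphaG, alphaG, LogF_congr p q F σ hσ h]
  -- Choose a unit above each determinant; by `hcongr` its image does not depend on the choice, and
  -- the map is therefore multiplicative.
  choose u hu hDet using fun y : (oneAddKerAb G M N).map (Det G M N) => Subgroup.mem_map.1 y.2
  refine ⟨MonoidHom.mk' (fun y => Multiplicative.ofAdd (alphaG p G N q F (u y))) fun y y' => ?_,
    fun v hv => congrArg Multiplicative.ofAdd (hcongr (hDet _)), ?_⟩
  · rw [← ofAdd_add, ← alphaG_mul p hG hN q F hF]
    refine congrArg Multiplicative.ofAdd (hcongr ?_)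
    rw [map_mul, hDet, hDet, hDet]
    rfl
  · rw [injective_iff_map_eq_one]
    intro y hy
    ext1
    rw [← hDet y]
    exact Det_eq_one_of_alphaG_eq_zero p hG hN q F hF hq0 σ hσ (u y) (hu y)
      (Multiplicative.ofAdd.injective hy)
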